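/- Let $n\ge 1$, $1<q<p<\infty$ and $\frac1r:=\frac1q-\frac1p$; all functions are complex-valued. Consider kernels $K(x,y)$, defined for $x\ne y$ in $\mathbb R^n$, of one of the following two types. (a) (Dini-smooth kernels) There are a constant $C\in(0,\infty)$ and an increasing $\omega:[0,1)\to[0,\infty)$ with $\int_0^1\omega(t)\,\frac{dt}{t}<\infty$ such that $|K(x,y)|\le C|x-y|^{-n}$ for all $x\ne y$, and $$|K(x,y)-K(\widetilde x,y)|+|K(y,x)-K(y,\widetilde x)|\le \frac{C}{|x-y|^{n}}\,\omega\!\left(\frac{|x-\widetilde x|}{|x-y|}\right)\quad\text{whenever } |x-\widetilde x|<\tfrac12|x-y| .$$ (b) (Rough homogeneous kernels) $K(x,y)=\Omega(x-y)/|x-y|^n$, where $\Omega$ is homogeneous of degree zero, $\int_{\mathbb S^{n-1}}\Omega\,d\sigma=0$, and $\Omega\in L^v(\mathbb S^{n-1})$ for some $v\in(1,\infty]$. Suppose that $K$ is non-degenerate, which means that at least one of the following holds: (1) $K$ satisfies the size and regularity estimates of (a) with an increasing $\omega$ such that $\omega(t)\to0$ as $t\to0^+$, and there is a $c_0\in(0,\infty)$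 such that for all $y\in\mathbb R^n$ and $\rho\in(0,\infty)$ there is an $x\in\mathbb R^n\setminus B(y,\rho)$ with $|K(x,y)|\ge \frac{1}{c_0\rho^n}$; (2) $K(x,y)=\Omega(x-y)/|x-y|^n$, where $\Omega$ is homogeneous of degree zero, has mean value zero on $\mathbb S^{n-1}$, and is a nonzero element of $L^1(\mathbb S^{n-1})$. Let $T$ be a Calderón–Zygmund operator with kernel $K$, that is, a linear operator bounded on $L^s(\mathbb R^n)$ for every $s\in(1,\infty)$ such that, in case (a), $Tf(x)=\int K(x,y)f(y)\,dy$ for almost every $x\notin\operatorname{supp}f$ whenever $f\in L^2(\mathbb R^n)$ has compact support, and, in case (b), $Tf(x)=\lim_{\varepsilon\to0^+}\int_{\varepsilon<|x-y|<1/\varepsilon}K(x,y)f(y)\,dy$ for almost every $x$ whenever $f\in C_c^\infty(\mathbb R^n)$. Let $b\in L^1_{\rm loc}(\mathbb R^n)$, and let $[b,T]f:=b\,Tf-T(bf)$ for those $f\in L^p(\mathbb R^n)$ (a dense set) for which $bf\in L^s(\mathbb R^n)$ for some $s\in(1,\infty)$. Then the following three statements are equivalent: (i) $[b,T]$ extends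 to a compact linear operator from $L^p(\mathbb R^n)$ to $L^q(\mathbb R^n)$; (ii) $[b,T]$ extends to a bounded linear operator from $L^p(\mathbb R^n)$ to $L^q(\mathbb R^n)$; (iii) $b\in \dot L^r(\mathbb R^n)$, that is, $b\in L^r_{\rm loc}(\mathbb R^n)$ and $\inf_{c\in\mathbb C}\|b-c\|_{L^r(\mathbb R^n)}<\infty$. -/

import Mathlib

open MeasureTheory Filter Topology
open scoped ENNReal

noncomputable section

namespace CZCommutator

/-- The Euclidean space `ℝⁿ`, with its Euclidean norm and Lebesgue measure. -/
abbrev Rn (n : ℕ) : Type := EuclideanSpace ℝ (Fin n)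

/-- `ω : [0,1) → [0,∞)` is increasing (only the values of `ω` on `[0,1)` matter). -/
def IsModulus (ω : ℝ → ℝ) : Prop :=
  MonotoneOn ω (Set.Ico 0 1) ∧ ∀ t ∈ Set.Ico (0 : ℝ) 1, 0 ≤ ω t

/-- The Dini condition `∫₀¹ ω(t)/t dt < ∞`. -/
def DiniCondition (ω : ℝ → ℝ) : Prop :=
  IntegrableOn (fun t : ℝ => ω t / t) (Set.Ioo 0 1)

/-- The size condition and the regularity condition with modulus of continuity `ω`
(the hypothesis `‖x - x'‖ < ‖x - y‖ / 2` forces `x ≠ y`). -/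
structure IsCZKernel {n : ℕ} (K : Rn n → Rn n → ℂ) (ω : ℝ → ℝ) (C : ℝ) : Prop where
  modulus : IsModulus ω
  const_pos : 0 < C
  size : ∀ x y : Rn n, x ≠ y → ‖K x y‖ ≤ C / ‖x - y‖ ^ n
  regular : ∀ x x' y : Rn n, ‖x - x'‖ < (1 / 2) * ‖x - y‖ →
    ‖K x y - K x' y‖ + ‖K y x - K y x'‖ ≤
      C / ‖x - y‖ ^ n * ω (‖x - x'‖ / ‖x - y‖)

/-- `K` satisfies the size condition and the regularity condition for some Dini modulus. -/
def IsDiniKernel {n : ℕ} (K : Rn n → Rn n → ℂ) : Prop :=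
  ∃ (ω : ℝ → ℝ) (C : ℝ), IsCZKernel K ω C ∧ DiniCondition ω

/-- The surface measure on the unit sphere of `ℝⁿ`. -/
abbrev sphereMeasure (n : ℕ) : Measure (Metric.sphere (0 : Rn n) 1) :=
  (volume : Measure (Rn n)).toSphere

/-- `Ω ∈ L¹` of the unit sphere, homogeneous of degree zero and with mean value zero. -/
structure IsHomogeneousSymbol {n : ℕ} (Ω : Rn n → ℂ) : Prop where
  integrable : Integrable (fun θ : Metric.sphere (0 : Rn n) 1 => Ω θ) (sphereMeasure n)
  homogeneous : ∀ t : ℝ, 0 < t → ∀ x ∈ Metric.sphere (0 : Rn n) 1, Ω (t • x) = Ω x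
  mean_zero : ∫ θ : Metric.sphere (0 : Rn n) 1, Ω θ ∂(sphereMeasure n) = 0

/-- The homogeneous kernel `Ω(x - y) / |x - y|ⁿ`. -/
def homogeneousKernel {n : ℕ} (Ω : Rn n → ℂ) (x y : Rn n) : ℂ :=
  Ω (x - y) / ((‖x - y‖ ^ n : ℝ) : ℂ)

/-- Non-degenerate Calderón–Zygmund kernels: either (i) a regular kernel with `ω(t) → 0` as
`t → 0⁺` and the lower bound `|K(x,y)| ≥ 1 / (c₀ rⁿ)` at some point `x ∉ B(y,r)`, for all `y`
and `r`, or (ii) a homogeneous kernel whose `Ω` is a nonzero element of `L¹` of the sphere. -/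
def IsNondegenerate {n : ℕ} (K : Rn n → Rn n → ℂ) : Prop :=
  (∃ (ω : ℝ → ℝ) (C : ℝ), IsCZKernel K ω C ∧ Tendsto ω (𝓝[>] 0) (𝓝 0) ∧
    ∃ c₀ : ℝ, 0 < c₀ ∧ ∀ (y : Rn n) (r : ℝ), 0 < r →
      ∃ x : Rn n, x ∉ Metric.ball y r ∧ 1 / (c₀ * r ^ n) ≤ ‖K x y‖) ∨
  (∃ Ω : Rn n → ℂ, IsHomogeneousSymbol Ω ∧
    ¬ ((fun θ : Metric.sphere (0 : Rn n) 1 => Ω θ) =ᵐ[sphereMeasure n] 0) ∧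
    ∀ x y : Rn n, x ≠ y → K x y = homogeneousKernel Ω x y)

/-- `T` is a linear operator, bounded on `Lˢ(ℝⁿ)` for every `s ∈ (1,∞)`. The operator is given
on functions, and only its values (up to null sets) on functions that lie in some `Lˢ` with
`1 < s < ∞` matter; so its actions on the various `Lˢ` are consistent. -/
structure IsLpBounded {n : ℕ} (T : (Rn n → ℂ) → (Rn n → ℂ)) : Prop where
  map_add : ∀ s : ℝ≥0∞, 1 < s → s < ∞ → ∀ f g : Rn n → ℂ,
    MemLp f s volume → MemLp g s volume → T (f + g) =ᵐ[volume] T f + T g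
  map_smul : ∀ s : ℝ≥0∞, 1 < s → s < ∞ → ∀ (c : ℂ) (f : Rn n → ℂ),
    MemLp f s volume → T (c • f) =ᵐ[volume] c • T f
  bounded : ∀ s : ℝ≥0∞, 1 < s → s < ∞ → ∃ C : NNReal, ∀ f : Rn n → ℂ,
    MemLp f s volume → MemLp (T f) s volume ∧ eLpNorm (T f) s volume ≤ C * eLpNorm f s volume

/-- `T` has the kernel `K`: `Tf(x) = ∫ K(x,y) f(y) dy` for almost all `x` outside the support
of `f`, for every `f ∈ L²` with compact support. -/
def HasKernel {n : ℕ} (T : (Rn n → ℂ) → (Rn n → ℂ)) (K : Rn n → Rn n → ℂ) : Prop :=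
  ∀ f : Rn n → ℂ, MemLp f 2 volume → HasCompactSupport f →
    ∀ᵐ x : Rn n, x ∉ tsupport f → T f x = ∫ y, K x y * f y

/-- `Tf = p.v. ∫ K(x,y) f(y) dy`, the limit as `ε → 0⁺` of the integrals over
`ε < |x - y| < 1/ε`, almost everywhere for every `f ∈ C_c^∞`. -/
def IsPrincipalValue {n : ℕ} (T : (Rn n → ℂ) → (Rn n → ℂ)) (K : Rn n → Rn n → ℂ) : Prop :=
  ∀ f : Rn n → ℂ, ContDiff ℝ (⊤ : ℕ∞) f → HasCompactSupport f →
    ∀ᵐ x : Rn n, Tendsto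
      (fun ε : ℝ => ∫ y in {y : Rn n | ε < ‖x - y‖ ∧ ‖x - y‖ < 1 / ε}, K x y * f y)
      (𝓝[>] 0) (𝓝 (T f x))

/-- `T` is a Calderón–Zygmund operator whose kernel `K` is a Dini kernel. -/
def IsDiniOperator {n : ℕ} (T : (Rn n → ℂ) → (Rn n → ℂ)) (K : Rn n → Rn n → ℂ) : Prop :=
  IsLpBounded T ∧ IsDiniKernel K ∧ HasKernel T K

/-- `T` is a Calderón–Zygmund operator `T_Ω` with the rough homogeneous kernel
`K(x,y) = Ω(x - y) / |x - y|ⁿ`, where `Ω ∈ Lᵛ` of the sphere for some `v ∈ (1,∞]`. -/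
def IsRoughOperator {n : ℕ} (T : (Rn n → ℂ) → (Rn n → ℂ)) (K : Rn n → Rn n → ℂ) : Prop :=
  IsLpBounded T ∧
  (∃ Ω : Rn n → ℂ, IsHomogeneousSymbol Ω ∧
    (∃ v : ℝ≥0∞, 1 < v ∧
      MemLp (fun θ : Metric.sphere (0 : Rn n) 1 => Ω θ) v (sphereMeasure n)) ∧
    ∀ x y : Rn n, x ≠ y → K x y = homogeneousKernel Ω x y) ∧
  IsPrincipalValue T K

/-- The commutator `[b,T]f = b Tf - T(bf)`. -/
def commutator {n : ℕ} (b : Rn n → ℂ) (T : (Rn n → ℂ) → (Rn n → ℂ)) (f : Rn n → ℂ) :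
    Rn n → ℂ :=
  fun x => b x * T f x - T (fun y => b y * f y) x

/-- The continuous linear operator `S : Lᵖ → L^q` is the extension of `[b,T]`: it agrees with
`[b,T]f = b Tf - T(bf)` for all `f ∈ Lᵖ` for which `T(bf)` makes sense, that is, for which `bf`
lies in some `Lˢ` with `1 < s < ∞`. These `f` are dense in `Lᵖ` for `p < ∞` (they include the
bounded functions with compact support on whose support `b` is bounded), so there is at most
one such `S`. -/
def ExtendsCommutator {n : ℕ} (b : Rn n → ℂ) (T : (Rn n → ℂ) → (Rn n → ℂ))
    {p q : ℝ≥0∞} [Fact (1 ≤ p)] [Fact (1 ≤ q)]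
    (S : Lp ℂ p (volume : Measure (Rn n)) →L[ℂ] Lp ℂ q (volume : Measure (Rn n))) : Prop :=
  ∀ f : Lp ℂ p (volume : Measure (Rn n)),
    (∃ s : ℝ≥0∞, 1 < s ∧ s < ∞ ∧ MemLp (fun y => b y * f y) s volume) →
      (S f : Rn n → ℂ) =ᵐ[volume] commutator b T f

/-- `[b,T]` is bounded from `Lᵖ` to `L^q`. -/
def CommutatorBounded {n : ℕ} (b : Rn n → ℂ) (T : (Rn n → ℂ) → (Rn n → ℂ))
    (p q : ℝ≥0∞) [Fact (1 ≤ p)] [Fact (1 ≤ q)] : Prop :=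
  ∃ S : Lp ℂ p (volume : Measure (Rn n)) →L[ℂ] Lp ℂ q (volume : Measure (Rn n)),
    ExtendsCommutator b T S

/-- `[b,T]` is compact from `Lᵖ` to `L^q`. -/
def CommutatorCompact {n : ℕ} (b : Rn n → ℂ) (T : (Rn n → ℂ) → (Rn n → ℂ))
    (p q : ℝ≥0∞) [Fact (1 ≤ p)] [Fact (1 ≤ q)] : Prop :=
  ∃ S : Lp ℂ p (volume : Measure (Rn n)) →L[ℂ] Lp ℂ q (volume : Measure (Rn n)),
    ExtendsCommutator b T S ∧ IsCompactOperator S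

/-- `b` lies in `Lʳ` modulo constants: `b ∈ Lʳ_loc` and `inf_c ‖b - c‖_r < ∞`. -/
def MemLpModConst {n : ℕ} (b : Rn n → ℂ) (r : ℝ≥0∞) : Prop :=
  (∀ (x : Rn n) (R : ℝ), MemLp b r (volume.restrict (Metric.ball x R))) ∧
  (⨅ c : ℂ, eLpNorm (fun x => b x - c) r volume) < ∞

end CZCommutator

end

/-! ### The operator on functions: independence of representatives and consistency across exponents.
-/

namespace CZCommutator

/-! Only (iii) ⇒ (i) and (ii) ⇒ (iii) need work. Two properties of the kernel drive them:
`OffDiagonalKernel`, which follows from either type of operator, and `LocallyNearConst`, which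
follows from either type of non-degeneracy. Both see the kernel only up to null sets in each
variable, so the two types may be mixed freely.

(iii) ⇒ (i). Constants commute with `T`, so `b` may be replaced by a function `a` in `Lʳ`. By
Hölder's inequality the commutator depends continuously on `a`, in operator norm from `Lᵖ` to `L^q`.
Compact operators form a closed set and `r` is finite because `q < p`, so it is enough to treat the
indicator of a compact set `F`. Here `[1_F, T]` is `1_F T 1_{Fᶜ} - 1_{Fᶜ} T 1_F`, and the complement
of `F` is cut into three pieces. On `U \ F`, with `U` an open neighbourhood of nearly the same
measure, multiplication by the indicator has small norm from `Lᵖ` to `L^q`. Far from the origin,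
Young's inequality and the integrability of the kernel at infinity make the operator small. The
remaining piece is compact and disjoint from `F`; there the kernel is a limit of continuous ones,
and discretizing these in one variable gives finite rank operators
(`OffDiagonalKernel.isCompactOperator_of_disjoint`).

(ii) ⇒ (iii). For every ball there is a disjoint ball of the same radius, at a comparable distance,
such that between the two the kernel is almost a constant of size comparable to `ρ⁻ⁿ`. With the
kernel frozen, three explicit pairs of test functions suffice to detect the oscillation of `b` on
the ball (`exists_test_functions`), so the oscillation is bounded by a pairing of `S ψ` with `φ`. To
sum this over many balls, the test functions are combined with signs for which the bilinear form of
`S` dominates its diagonal (`exists_signs`). If the balls have disjoint dilates on each level and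
the levels grow geometrically, the `Lᵖ` and `L^{q'}` norms of the combinations are controlled by the
quantity to be estimated, and duality bounds the sum of `λʳ ρⁿ` over balls on which `b` has mean
oscillation at least of order `λ` (`sum_levels_le`).

It remains to pass from oscillations to the size of `b`. A stopping time argument on the dyadic
subcubes of a large cube gives a good-λ inequality: inside a stopping cube of small oscillation the
next level set fills only a small fraction (`volume_levelSet_le`). The other stopping cubes are
handled by a Vitali selection and the sum bound. After absorption, the integral of `|b - a|ʳ` over
the cube, with `a` the mean, is bounded independently of the cube. Fatou's lemma along growing cubes
concludes. -/

/-- Truncations of an `Lˢ` function to sets that eventually contain every point converge to it. -/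
theorem tendsto_eLpNorm_indicator_sub {α : Type*} [MeasurableSpace α] {μ : Measure α}
    {s : ℝ≥0∞} (hs0 : s ≠ 0) (hs : s ≠ ∞) {f : α → ℂ} (hf : MemLp f s μ)
    {E : ℕ → Set α} (hE : ∀ k, MeasurableSet (E k)) (hmem : ∀ᵐ x ∂μ, ∀ᶠ k in atTop, x ∈ E k) :
    Tendsto (fun k => eLpNorm ((E k).indicator f - f) s μ) atTop (𝓝 0) := by
  have hs' : 0 < s.toReal := ENNReal.toReal_pos hs0 hs
  have key : Tendsto (fun k => ∫⁻ x, ‖((E k).indicator f - f) x‖ₑ ^ s.toReal ∂μ) atTop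
      (𝓝 (∫⁻ _, 0 ∂μ)) := by
    refine tendsto_lintegral_of_dominated_convergence' (fun x => ‖f x‖ₑ ^ s.toReal) ?_ ?_ ?_ ?_
    · intro k
      exact (((hf.1.indicator (hE k)).sub hf.1).enorm).pow_const _
    · intro k
      refine ae_of_all _ fun x => ?_
      refine ENNReal.rpow_le_rpow ?_ hs'.le
      by_cases hx : x ∈ E k <;> simp [hx]
    · exact (lintegral_rpow_enorm_lt_top_of_eLpNorm_lt_top hs0 hs hf.2).ne
    · filter_upwards [hmem] with x hx
      refine tendsto_const_nhds.congr' ?_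
      filter_upwards [hx] with k hk
      simp [hk, hs']
  simp only [eLpNorm_eq_lintegral_rpow_enorm_toReal hs0 hs]
  have := (ENNReal.continuous_rpow_const (y := 1 / s.toReal)).tendsto (∫⁻ _ : α, 0 ∂μ)
  have h2 := this.comp key
  simpa [hs', Function.comp_def] using h2

namespace IsLpBounded

variable {n : ℕ} {T : (Rn n → ℂ) → (Rn n → ℂ)}

theorem ae_eq_zero (hT : IsLpBounded T) {s : ℝ≥0∞} (h1 : 1 < s) (h2 : s < ∞) {f : Rn n → ℂ}
    (hf : f =ᵐ[volume] 0) : T f =ᵐ[volume] 0 := by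
  obtain ⟨C, hC⟩ := hT.bounded s h1 h2
  have hm : MemLp f s volume := (MemLp.zero (ε := ℂ)).ae_eq hf.symm
  obtain ⟨h, h'⟩ := hC f hm
  rw [eLpNorm_congr_ae hf, eLpNorm_zero, mul_zero, nonpos_iff_eq_zero] at h'
  exact (eLpNorm_eq_zero_iff h.1 (zero_lt_one.trans h1).ne').1 h'

/-- Independence of the representative is not part of the axioms for `T`; it comes from additivity
and from the bound applied to the null function `g - f`. -/
theorem congr_ae (hT : IsLpBounded T) {s : ℝ≥0∞} (h1 : 1 < s) (h2 : s < ∞) {f g : Rn n → ℂ}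
    (hf : MemLp f s volume) (hfg : f =ᵐ[volume] g) : T f =ᵐ[volume] T g := by
  have hg : MemLp g s volume := hf.ae_eq hfg
  have h := hT.map_add s h1 h2 f (g - f) hf (hg.sub hf)
  have h0 : T (g - f) =ᵐ[volume] 0 := hT.ae_eq_zero h1 h2 <| by
    filter_upwards [hfg] with x hx; simp [hx]
  rw [add_sub_cancel] at h
  filter_upwards [h, h0] with x hx hx0
  simp [hx, hx0]

theorem memLp (hT : IsLpBounded T) {s : ℝ≥0∞} (h1 : 1 < s) (h2 : s < ∞) {f : Rn n → ℂ}
    (hf : MemLp f s volume) : MemLp (T f) s volume :=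
  ((hT.bounded s h1 h2).choose_spec f hf).1

theorem map_sub (hT : IsLpBounded T) {s : ℝ≥0∞} (h1 : 1 < s) (h2 : s < ∞) {f g : Rn n → ℂ}
    (hf : MemLp f s volume) (hg : MemLp g s volume) :
    T (f - g) =ᵐ[volume] T f - T g := by
  have h := hT.map_add s h1 h2 (f - g) g (hf.sub hg) hg
  rw [sub_add_cancel] at h
  filter_upwards [h] with x hx
  simp [hx]

/-- The action of `T` on `Lˢ`, as a continuous linear map. -/
noncomputable def toCLM (hT : IsLpBounded T) {s : ℝ≥0∞} [Fact (1 ≤ s)] (h1 : 1 < s) (h2 : s < ∞) :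
    Lp ℂ s (volume : Measure (Rn n)) →L[ℂ] Lp ℂ s (volume : Measure (Rn n)) :=
  LinearMap.mkContinuous
    { toFun := fun f => (hT.memLp h1 h2 (Lp.memLp f)).toLp
      map_add' := fun f g => by
        rw [← MemLp.toLp_add]
        refine MemLp.toLp_congr _ _ ?_
        exact (hT.congr_ae h1 h2 (Lp.memLp _) (Lp.coeFn_add f g)).trans
          (hT.map_add s h1 h2 _ _ (Lp.memLp f) (Lp.memLp g))
      map_smul' := fun c f => by
        rw [RingHom.id_apply, ← MemLp.toLp_const_smul]
        refine MemLp.toLp_congr _ _ ?_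
        exact (hT.congr_ae h1 h2 (Lp.memLp _) (Lp.coeFn_smul c f)).trans
          (hT.map_smul s h1 h2 _ _ (Lp.memLp f)) }
    (hT.bounded s h1 h2).choose
    (fun f => by
      have h := ((hT.bounded s h1 h2).choose_spec f (Lp.memLp f)).2
      simp only [LinearMap.coe_mk, AddHom.coe_mk, Lp.norm_toLp]
      rw [Lp.norm_def]
      refine (ENNReal.toReal_mono ?_ h).trans ?_
      · exact ENNReal.mul_ne_top ENNReal.coe_ne_top (Lp.eLpNorm_ne_top f)
      · simp [ENNReal.toReal_mul])

theorem coeFn_toCLM (hT : IsLpBounded T) {s : ℝ≥0∞} [Fact (1 ≤ s)] (h1 : 1 < s) (h2 : s < ∞)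
    (f : Lp ℂ s (volume : Measure (Rn n))) :
    (hT.toCLM h1 h2 f : Rn n → ℂ) =ᵐ[volume] T f :=
  MemLp.coeFn_toLp (hT.memLp h1 h2 (Lp.memLp f))

/-- Convergence in measure does not remember the exponent, so limits obtained in different `Lˢ` can
be compared with each other. -/
theorem tendstoInMeasure (hT : IsLpBounded T) {s : ℝ≥0∞} (h1 : 1 < s) (h2 : s < ∞)
    {f : Rn n → ℂ} {F : ℕ → Rn n → ℂ} (hf : MemLp f s volume) (hF : ∀ k, MemLp (F k) s volume)
    (h : Tendsto (fun k => eLpNorm (F k - f) s volume) atTop (𝓝 0)) :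
    TendstoInMeasure volume (fun k => T (F k)) atTop (T f) := by
  obtain ⟨C, hC⟩ := hT.bounded s h1 h2
  refine tendstoInMeasure_of_tendsto_eLpNorm (zero_lt_one.trans h1).ne'
    (fun k => (hT.memLp h1 h2 (hF k)).1) (hT.memLp h1 h2 hf).1 ?_
  have h3 : Tendsto (fun k => (C : ℝ≥0∞) * eLpNorm (F k - f) s volume) atTop (𝓝 0) := by
    simpa using ENNReal.Tendsto.const_mul h (Or.inr ENNReal.coe_ne_top)
  refine tendsto_of_tendsto_of_tendsto_of_le_of_le tendsto_const_nhds h3 (fun _ => zero_le) ?_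
  intro k
  have := (hC _ ((hF k).sub hf)).2
  rwa [eLpNorm_congr_ae (hT.map_sub h1 h2 (hF k) hf)] at this

/-- `T` is additive across the different `Lˢ` spaces on which it acts. -/
theorem map_add_of_memLp (hT : IsLpBounded T) {s₁ s₂ s₃ : ℝ≥0∞} (h1 : 1 < s₁) (h1' : s₁ < ∞)
    (h2 : 1 < s₂) (h2' : s₂ < ∞) (h3 : 1 < s₃) (h3' : s₃ < ∞) {f g : Rn n → ℂ}
    (hf : MemLp f s₁ volume) (hg : MemLp g s₂ volume) (hfg : MemLp (f + g) s₃ volume) :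
    T (f + g) =ᵐ[volume] T f + T g := by
  set f' := hf.1.mk f
  set g' := hg.1.mk g
  have hf' : Measurable f' := hf.1.stronglyMeasurable_mk.measurable
  have hg' : Measurable g' := hg.1.stronglyMeasurable_mk.measurable
  -- Bounded sets on which both functions are bounded: the truncations of `f` and `g` lie in a
  -- common `Lˢ`, where additivity is an axiom.
  let E : ℕ → Set (Rn n) := fun k => {x | ‖x‖ ≤ k} ∩ ({x | ‖f' x‖ ≤ k} ∩ {x | ‖g' x‖ ≤ k})
  have hE : ∀ k, MeasurableSet (E k) := fun k =>
    (measurableSet_le measurable_norm measurable_const).inter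
      ((measurableSet_le hf'.norm measurable_const).inter
        (measurableSet_le hg'.norm measurable_const))
  have hmem : ∀ᵐ x : Rn n, ∀ᶠ k in atTop, x ∈ E k := by
    refine ae_of_all _ fun x => ?_
    filter_upwards [eventually_ge_atTop ⌈‖x‖⌉₊, eventually_ge_atTop ⌈‖f' x‖⌉₊,
      eventually_ge_atTop ⌈‖g' x‖⌉₊] with k h1 h2 h3
    exact ⟨Nat.ceil_le.1 h1, Nat.ceil_le.1 h2, Nat.ceil_le.1 h3⟩
  have hEfin : ∀ k, volume (E k) < ∞ := fun k =>
    (measure_mono fun x hx => mem_closedBall_zero_iff.2 hx.1).trans_lt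
      (measure_closedBall_lt_top (x := (0 : Rn n)) (r := k))
  have hbdd : ∀ (u : Rn n → ℂ), AEStronglyMeasurable u volume → ∀ k : ℕ,
      (∀ᵐ x, x ∈ E k → ‖u x‖ ≤ k) → MemLp ((E k).indicator u) s₁ volume := by
    intro u hu k hk
    rw [memLp_indicator_iff_restrict (hE k)]
    have : IsFiniteMeasure (volume.restrict (E k)) := ⟨by simpa using hEfin k⟩
    refine MemLp.of_bound hu.restrict k ?_
    rwa [ae_restrict_iff' (hE k)]
  have hfk : ∀ k, MemLp ((E k).indicator f) s₁ volume := fun k => hbdd f hf.1 k <| by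
    filter_upwards [hf.1.ae_eq_mk] with x hx hxE
    rw [hx]; exact hxE.2.1
  have hgk : ∀ k, MemLp ((E k).indicator g) s₁ volume := fun k => hbdd g hg.1 k <| by
    filter_upwards [hg.1.ae_eq_mk] with x hx hxE
    rw [hx]; exact hxE.2.2
  have A := hT.tendstoInMeasure h1 h1' hf (fun k => hf.indicator (hE k))
    (tendsto_eLpNorm_indicator_sub (zero_lt_one.trans h1).ne' h1'.ne hf hE hmem)
  have B := hT.tendstoInMeasure h2 h2' hg (fun k => hg.indicator (hE k))
    (tendsto_eLpNorm_indicator_sub (zero_lt_one.trans h2).ne' h2'.ne hg hE hmem)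
  have D := hT.tendstoInMeasure h3 h3' hfg (fun k => hfg.indicator (hE k))
    (tendsto_eLpNorm_indicator_sub (zero_lt_one.trans h3).ne' h3'.ne hfg hE hmem)
  -- Successive extraction yields one subsequence along which the three images converge almost
  -- everywhere.
  obtain ⟨a, ha, ha'⟩ := A.exists_seq_tendsto_ae
  obtain ⟨c, hc, hc'⟩ := (B.comp ha.tendsto_atTop).exists_seq_tendsto_ae
  obtain ⟨d, hd, hd'⟩ := ((D.comp ha.tendsto_atTop).comp hc.tendsto_atTop).exists_seq_tendsto_ae
  have hall : ∀ᵐ x, ∀ k, T ((E k).indicator (f + g)) x =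
      T ((E k).indicator f) x + T ((E k).indicator g) x := by
    rw [ae_all_iff]
    intro k
    have := hT.map_add s₁ h1 h1' _ _ (hfk k) (hgk k)
    rw [← Set.indicator_add'] at this
    exact this
  filter_upwards [ha', hc', hd', hall] with x hx1 hx2 hx3 hx4
  refine tendsto_nhds_unique hx3 ?_
  have e1 := (hx1.comp hc.tendsto_atTop).comp hd.tendsto_atTop
  have e2 := hx2.comp hd.tendsto_atTop
  refine (e1.add e2).congr fun k => ?_
  simp [hx4]

end IsLpBounded

end CZCommutator

/-! ### Young's convolution inequality. -/

namespace CZCommutator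

/-- **Young's convolution inequality**, for nonnegative functions. -/
theorem lintegral_convolution_rpow_le {n : ℕ} {p u s : ℝ} (hp : 1 ≤ p) (hu : 1 ≤ u) (hs : 0 < s)
    (h : 1 / p + 1 / u = 1 + 1 / s) {a g : Rn n → ℝ≥0∞} (ha : Measurable a) (hg : AEMeasurable g) :
    ∫⁻ x, (∫⁻ y, a (x - y) * g y) ^ s ≤
      (∫⁻ z, a z ^ u) ^ (s / u) * (∫⁻ y, g y ^ p) ^ (s / p) := by
  wlog hgm : Measurable g generalizing g
  · have := this hg.measurable_mk.aemeasurable hg.measurable_mk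
    have e1 : ∀ x, ∫⁻ y, a (x - y) * g y = ∫⁻ y, a (x - y) * hg.mk g y := fun x =>
      lintegral_congr_ae <| by filter_upwards [hg.ae_eq_mk] with y hy; rw [hy]
    have e2 : ∫⁻ y, g y ^ p = ∫⁻ y, hg.mk g y ^ p :=
      lintegral_congr_ae <| by filter_upwards [hg.ae_eq_mk] with y hy; rw [hy]
    simpa only [e1, e2] using this
  have hp0 : 0 < p := by linarith
  have hu0 : 0 < u := by linarith
  set A := ∫⁻ z, a z ^ u
  set G := ∫⁻ y, g y ^ p
  have hp1 : 1 / p ≤ 1 := by rw [div_le_one hp0]; exact hp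
  have hu1 : 1 / u ≤ 1 := by rw [div_le_one hu0]; exact hu
  have hs1 : 0 < 1 / s := by positivity
  have hA : ∀ x, ∫⁻ y, a (x - y) ^ u = A := fun x =>
    lintegral_sub_left_eq_self (fun z => a z ^ u) x
  have key : ∀ x, ∫⁻ y, a (x - y) * g y ≤
      (∫⁻ y, a (x - y) ^ u * g y ^ p) ^ (1 / s) * A ^ (1 - 1 / p) * G ^ (1 - 1 / u) := by
    intro x
    -- Hölder with three factors: `a g = (aᵘ gᵖ)^(1/s) (aᵘ)^(1-1/p) (gᵖ)^(1-1/u)`. The relation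
    -- between `p`, `u` and `s` says exactly that the three exponents add up to one.
    let f : Fin 3 → Rn n → ℝ≥0∞ := ![fun y => a (x - y) ^ u * g y ^ p, fun y => a (x - y) ^ u,
      fun y => g y ^ p]
    let w : Fin 3 → ℝ := ![1 / s, 1 - 1 / p, 1 - 1 / u]
    have hax : Measurable fun y => a (x - y) := ha.comp (measurable_const.sub measurable_id)
    have := ENNReal.lintegral_prod_norm_pow_le (μ := volume) Finset.univ (f := f) (p := w)
      (by
        intro i _
        fin_cases i
        · exact ((hax.pow_const u).mul (hgm.pow_const p)).aemeasurable
        · exact (hax.pow_const u).aemeasurable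
        · exact (hgm.pow_const p).aemeasurable)
      (by simp [w, Fin.sum_univ_three]; simp at h; linarith)
      (by intro i _; fin_cases i <;> simp [w] <;> simp at hp1 hu1 <;> linarith)
    simp only [Fin.prod_univ_three, f, w, Matrix.cons_val, hA] at this
    refine le_trans (lintegral_mono fun y => ?_) this
    have e1 : u * (1 / s) + u * (1 - 1 / p) = 1 := by
      rw [← mul_add, show 1 / s + (1 - 1 / p) = 1 / u by linarith]; field_simp
    have e2 : p * (1 / s) + p * (1 - 1 / u) = 1 := by
      rw [← mul_add, show 1 / s + (1 - 1 / u) = 1 / p by linarith]; field_simp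
    rw [ENNReal.mul_rpow_of_nonneg _ _ hs1.le, ← ENNReal.rpow_mul, ← ENNReal.rpow_mul,
      ← ENNReal.rpow_mul, ← ENNReal.rpow_mul]
    have f1 : a (x - y) = a (x - y) ^ (u * (1 / s)) * a (x - y) ^ (u * (1 - 1 / p)) := by
      rw [← ENNReal.rpow_add_of_nonneg _ _ (by positivity)
        (mul_nonneg hu0.le (by linarith)), e1, ENNReal.rpow_one]
    have f2 : g y = g y ^ (p * (1 / s)) * g y ^ (p * (1 - 1 / u)) := by
      rw [← ENNReal.rpow_add_of_nonneg _ _ (by positivity)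
        (mul_nonneg hp0.le (by linarith)), e2, ENNReal.rpow_one]
    apply le_of_eq
    calc a (x - y) * g y = _ * _ := by conv_lhs => rw [f1, f2]
      _ = _ := by ring
  have hjoint : Measurable fun z : Rn n × Rn n => a (z.1 - z.2) ^ u * g z.2 ^ p :=
    ((ha.comp (measurable_fst.sub measurable_snd)).pow_const u).mul
      ((hgm.comp measurable_snd).pow_const p)
  have hint : ∫⁻ x, ∫⁻ y, a (x - y) ^ u * g y ^ p = A * G := by
    rw [lintegral_lintegral_swap hjoint.aemeasurable]
    have : ∀ y, ∫⁻ x, a (x - y) ^ u * g y ^ p = A * g y ^ p := fun y => by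
      have hay : Measurable fun x => a (x - y) := ha.comp (measurable_id.sub measurable_const)
      rw [lintegral_mul_const _ (hay.pow_const u)]
      congr 1
      exact lintegral_sub_right_eq_self (fun z => a z ^ u) y
    simp only [this]
    rw [lintegral_const_mul _ (hgm.pow_const p)]
  calc ∫⁻ x, (∫⁻ y, a (x - y) * g y) ^ s
      ≤ ∫⁻ x, (∫⁻ y, a (x - y) ^ u * g y ^ p) * (A ^ (1 - 1 / p) * G ^ (1 - 1 / u)) ^ s := by
        refine lintegral_mono fun x => ?_
        refine (ENNReal.rpow_le_rpow (key x) hs.le).trans (le_of_eq ?_)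
        rw [mul_assoc, ENNReal.mul_rpow_of_nonneg _ _ hs.le, ← ENNReal.rpow_mul,
          one_div_mul_cancel hs.ne', ENNReal.rpow_one]
    _ = A * G * (A ^ (1 - 1 / p) * G ^ (1 - 1 / u)) ^ s := by
        rw [lintegral_mul_const _ (hjoint.lintegral_prod_right'), hint]
    _ = A ^ (s / u) * G ^ (s / p) := by
        rw [ENNReal.mul_rpow_of_nonneg _ _ hs.le, ← ENNReal.rpow_mul, ← ENNReal.rpow_mul]
        have e1 : s / u = 1 + (1 - 1 / p) * s := by
          have : 1 / u = 1 / s + (1 - 1 / p) := by linarith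
          rw [div_eq_mul_one_div, this]; field_simp
        have e2 : s / p = 1 + (1 - 1 / u) * s := by
          have : 1 / p = 1 / s + (1 - 1 / u) := by linarith
          rw [div_eq_mul_one_div, this]; field_simp
        rw [e1, e2, ENNReal.rpow_add_of_nonneg _ _ zero_le_one (mul_nonneg (by linarith) hs.le),
          ENNReal.rpow_add_of_nonneg _ _ zero_le_one (mul_nonneg (by linarith) hs.le),
          ENNReal.rpow_one, ENNReal.rpow_one]
        ring

end CZCommutator

/-! ### Off-diagonal kernels, multiplication operators and separated supports. -/

namespace CZCommutator

variable {n : ℕ} {T : (Rn n → ℂ) → (Rn n → ℂ)} {k : Rn n → Rn n → ℂ}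

/-- `T` is given off the diagonal by a measurable kernel `k` that is dominated by a convolution
kernel with some integrability at infinity, and that can be approximated, on products of
disjoint compact sets, by continuous kernels. -/
structure OffDiagonalKernel (T : (Rn n → ℂ) → (Rn n → ℂ)) (k : Rn n → Rn n → ℂ) : Prop where
  measurable : Measurable (Function.uncurry k)
  rep : ∀ F : Set (Rn n), IsCompact F → ∀ f : Rn n → ℂ, MemLp f ∞ volume → (∀ x ∉ F, f x = 0) →
    ∀ᵐ x, x ∉ F → T f x = ∫ y, k x y * f y
  dominated : ∃ h : Rn n → ℝ≥0∞, Measurable h ∧ (∀ x y, ‖k x y‖ₑ ≤ h (x - y)) ∧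
    ∃ v : ℝ, 1 < v ∧ ∀ u, 1 < u → u ≤ v → ∫⁻ z in {z : Rn n | 1 ≤ ‖z‖}, h z ^ u < ∞
  approx : ∀ F G : Set (Rn n), IsCompact F → IsCompact G → Disjoint F G → ∀ ε : ℝ≥0∞, ε ≠ 0 →
    ∃ (k' : Rn n → Rn n → ℂ) (h' : Rn n → ℝ≥0∞), Measurable (Function.uncurry k') ∧
      ContinuousOn (Function.uncurry k') (F ×ˢ G) ∧ Measurable h' ∧ ∫⁻ z, h' z ≤ ε ∧
      ∀ x ∈ F, ∀ y ∈ G, ‖k x y - k' x y‖ₑ ≤ h' (x - y)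

/-- Multiplication by a function in `Lʳ`, as an operator from `Lᵖ` to `L^q`. -/
noncomputable def mulOp (r p q : ℝ≥0∞) [Fact (1 ≤ r)] [Fact (1 ≤ p)] [Fact (1 ≤ q)]
    [ENNReal.HolderTriple r p q] (a : Rn n → ℂ) (ha : MemLp a r volume) :
    Lp ℂ p (volume : Measure (Rn n)) →L[ℂ] Lp ℂ q (volume : Measure (Rn n)) :=
  (ContinuousLinearMap.mul ℂ ℂ).holderL volume r p q (ha.toLp)

section mulOp

variable {r p q : ℝ≥0∞} [Fact (1 ≤ r)] [Fact (1 ≤ p)] [Fact (1 ≤ q)] [ENNReal.HolderTriple r p q]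

theorem coeFn_mulOp {a : Rn n → ℂ} (ha : MemLp a r volume)
    (f : Lp ℂ p (volume : Measure (Rn n))) :
    (mulOp r p q a ha f : Rn n → ℂ) =ᵐ[volume] fun x => a x * f x := by
  filter_upwards [(ContinuousLinearMap.mul ℂ ℂ).coeFn_holder (r := q) ha.toLp f,
    ha.coeFn_toLp] with x hx hx'
  rw [mulOp, ContinuousLinearMap.holderL_apply_apply, hx, hx']
  rfl

theorem norm_mulOp_le {a : Rn n → ℂ} (ha : MemLp a r volume) :
    ‖mulOp r p q a ha‖ ≤ (eLpNorm a r volume).toReal := by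
  refine (ContinuousLinearMap.le_opNorm _ _).trans ?_
  rw [Lp.norm_toLp]
  refine mul_le_of_le_one_left ENNReal.toReal_nonneg ?_
  exact (ContinuousLinearMap.norm_holderL_le _).trans (ContinuousLinearMap.opNorm_mul_le ℂ ℂ)

end mulOp

/-- The characteristic function of a set, with complex values. -/
noncomputable def ind (A : Set (Rn n)) : Rn n → ℂ := A.indicator fun _ => 1

theorem ind_mul (A : Set (Rn n)) (f : Rn n → ℂ) : (fun x => ind A x * f x) = A.indicator f := by
  ext x
  by_cases hx : x ∈ A <;> simp [ind, hx]

theorem memLp_ind_top {A : Set (Rn n)} (hA : MeasurableSet A) : MemLp (ind A) ∞ volume :=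
  (memLp_top_const (1 : ℂ)).indicator hA

theorem memLp_ind {A : Set (Rn n)} (hA : MeasurableSet A) (hA' : volume A ≠ ∞) (r : ℝ≥0∞) :
    MemLp (ind A) r volume :=
  memLp_indicator_const r hA 1 (Or.inr hA')

theorem norm_mulOp_ind_top_le {p : ℝ≥0∞} [Fact (1 ≤ p)] {A : Set (Rn n)} (hA : MeasurableSet A) :
    ‖mulOp ∞ p p (ind A) (memLp_ind_top hA)‖ ≤ 1 := by
  refine (norm_mulOp_le _).trans ?_
  refine ENNReal.toReal_le_of_le_ofReal zero_le_one ?_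
  refine (eLpNorm_indicator_const_le 1 ∞).trans ?_
  simp

/-- Norm bounds on compactly supported continuous functions extend to `Lᵖ`. -/
theorem opNorm_le_of_hasCompactSupport {p q : ℝ≥0∞} [Fact (1 ≤ p)] [Fact (1 ≤ q)] (hp : p ≠ ∞)
    (L : Lp ℂ p (volume : Measure (Rn n)) →L[ℂ] Lp ℂ q (volume : Measure (Rn n)))
    {ε : ℝ} (hε : 0 ≤ ε)
    (h : ∀ (g : Rn n → ℂ), Continuous g → HasCompactSupport g →
      ∀ f : Lp ℂ p (volume : Measure (Rn n)), f =ᵐ[volume] g →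
      eLpNorm (L f) q volume ≤ ENNReal.ofReal ε * eLpNorm g p volume) : ‖L‖ ≤ ε := by
  refine L.opNorm_le_bound hε fun f => ?_
  refine (Lp.dense_hasCompactSupport_contDiff (E := Rn n) (F := ℂ) (μ := volume) hp).induction
    (P := fun f => ‖L f‖ ≤ ε * ‖f‖) ?_ ?_ f
  · rintro f ⟨g, hfg, hg, hg'⟩
    have := h g hg'.continuous hg f hfg
    rw [← eLpNorm_congr_ae hfg] at this
    rw [Lp.norm_def, Lp.norm_def]
    refine (ENNReal.toReal_mono ?_ this).trans (le_of_eq ?_)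
    · exact ENNReal.mul_ne_top ENNReal.ofReal_ne_top (Lp.eLpNorm_ne_top f)
    · rw [ENNReal.toReal_mul, ENNReal.toReal_ofReal hε]
  · exact isClosed_le (by fun_prop) (by fun_prop)

/-- Pointwise domination by a convolution gives an `Lᵖ → Lˢ` bound. -/
theorem eLpNorm_le_of_enorm_le_convolution {p u s : ℝ} (hp : 1 ≤ p) (hu : 1 ≤ u) (hs : 0 < s)
    (h : 1 / p + 1 / u = 1 + 1 / s) {a : Rn n → ℝ≥0∞} (ha : Measurable a) {g w : Rn n → ℂ}
    (hg : AEStronglyMeasurable g volume)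
    (hw : ∀ᵐ x, ‖w x‖ₑ ≤ ∫⁻ y, a (x - y) * ‖g y‖ₑ) :
    eLpNorm w (ENNReal.ofReal s) volume ≤
      (∫⁻ z, a z ^ u) ^ (1 / u) * eLpNorm g (ENNReal.ofReal p) volume := by
  have hp0 : 0 < p := by linarith
  rw [eLpNorm_eq_lintegral_rpow_enorm_toReal (by simpa using hs) ENNReal.ofReal_ne_top,
    eLpNorm_eq_lintegral_rpow_enorm_toReal (by simpa using hp0) ENNReal.ofReal_ne_top,
    ENNReal.toReal_ofReal hs.le, ENNReal.toReal_ofReal hp0.le]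
  have h1 : ∫⁻ x, ‖w x‖ₑ ^ s ≤ ∫⁻ x, (∫⁻ y, a (x - y) * ‖g y‖ₑ) ^ s := by
    refine lintegral_mono_ae ?_
    filter_upwards [hw] with x hx
    exact ENNReal.rpow_le_rpow hx hs.le
  have h2 := h1.trans (lintegral_convolution_rpow_le hp hu hs h ha hg.enorm)
  refine (ENNReal.rpow_le_rpow h2 (by positivity : 0 ≤ 1 / s)).trans (le_of_eq ?_)
  rw [ENNReal.mul_rpow_of_nonneg _ _ (by positivity), ← ENNReal.rpow_mul, ← ENNReal.rpow_mul]
  congr 2 <;> field_simp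

/-- Since `X` and `F` are at distance at least `ρ`, only the part of the majorant `h` outside the
ball of radius `ρ` enters. That part is integrable to a power `u > 1`, so Young's inequality applies
although `h` itself may be singular at the origin. -/
theorem OffDiagonalKernel.eLpNorm_indicator_le (hk : OffDiagonalKernel T k) {h : Rn n → ℝ≥0∞}
    (hh : Measurable h) (hdom : ∀ x y, ‖k x y‖ₑ ≤ h (x - y)) {X F : Set (Rn n)} (hF : IsCompact F)
    {ρ : ℝ} (hρ : 0 < ρ) (hdist : ∀ x ∈ X, ∀ y ∈ F, ρ ≤ ‖x - y‖) {g : Rn n → ℂ}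
    (hg : MemLp g ∞ volume) (hgF : ∀ x ∉ F, g x = 0) {p u s : ℝ} (hp : 1 ≤ p) (hu : 1 ≤ u)
    (hs : 0 < s) (hpus : 1 / p + 1 / u = 1 + 1 / s) :
    eLpNorm (X.indicator (T g)) (ENNReal.ofReal s) volume ≤
      (∫⁻ z in {z : Rn n | ρ ≤ ‖z‖}, h z ^ u) ^ (1 / u) *
        eLpNorm g (ENNReal.ofReal p) volume := by
  have hmeas : MeasurableSet {z : Rn n | ρ ≤ ‖z‖} := measurableSet_le measurable_const measurable_norm
  have hu0 : 0 < u := by linarith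
  have := eLpNorm_le_of_enorm_le_convolution (w := X.indicator (T g)) hp hu hs hpus
    (hh.indicator hmeas) hg.1 ?_
  · refine this.trans (le_of_eq ?_)
    congr 2
    rw [← lintegral_indicator hmeas]
    congr 1 with z
    by_cases hz : ρ ≤ ‖z‖ <;> simp [Set.indicator, hz, hu0]
  · filter_upwards [hk.rep F hF g hg hgF] with x hx
    by_cases hxX : x ∈ X
    · have hxF : x ∉ F := fun hxF => by
        have := hdist x hxX x hxF
        simp at this; linarith
      rw [Set.indicator_of_mem hxX, hx hxF]
      refine (enorm_integral_le_lintegral_enorm _).trans (lintegral_mono fun y => ?_)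
      by_cases hy : y ∈ F
      · rw [Set.indicator_of_mem (show x - y ∈ {z : Rn n | ρ ≤ ‖z‖} from hdist x hxX y hy),
          enorm_mul]
        gcongr
        exact hdom x y
      · simp [hgF y hy]
    · simp [hxX]

end CZCommutator

/-! ### Compact operators and smallness of the far part of the operator. -/

namespace CZCommutator

variable {n : ℕ} {T : (Rn n → ℂ) → (Rn n → ℂ)} {k : Rn n → Rn n → ℂ}

theorem isCompactOperator_of_forall_approx {E F : Type*} [NormedAddCommGroup E] [NormedSpace ℂ E]
    [NormedAddCommGroup F] [NormedSpace ℂ F] [CompleteSpace F] (L : E →L[ℂ] F)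
    (h : ∀ ε : ℝ, 0 < ε → ∃ L' : E →L[ℂ] F, IsCompactOperator L' ∧ ‖L - L'‖ ≤ ε) :
    IsCompactOperator L := by
  have hc := isClosed_setOfPred_isCompactOperator (σ₁₂ := RingHom.id ℂ) (M₁ := E) (M₂ := F)
  have : L ∈ closure {f : E →L[ℂ] F | IsCompactOperator f} := by
    rw [Metric.mem_closure_iff]
    intro ε hε
    obtain ⟨L', h1, h2⟩ := h (ε / 2) (by positivity)
    exact ⟨L', h1, by rw [dist_eq_norm]; linarith⟩
  rwa [hc.closure_eq] at this

theorem isCompactOperator_smulRight {E F : Type*} [NormedAddCommGroup E] [NormedSpace ℂ E]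
    [NormedAddCommGroup F] [NormedSpace ℂ F] (l : E →L[ℂ] ℂ) (v : F) :
    IsCompactOperator (l.smulRight v) := by
  have h : IsCompactOperator (ContinuousLinearMap.toSpanSingleton ℂ v) :=
    isCompactOperator_of_locallyCompactSpace_rng _
  exact h.comp_clm l

theorem isCompactOperator_sum {E F ι : Type*} [NormedAddCommGroup E] [NormedSpace ℂ E]
    [NormedAddCommGroup F] [NormedSpace ℂ F] (s : Finset ι) (L : ι → E →L[ℂ] F)
    (h : ∀ i ∈ s, IsCompactOperator (L i)) : IsCompactOperator ⇑(∑ i ∈ s, L i) := by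
  classical
  induction s using Finset.induction with
  | empty => simpa using isCompactOperator_zero
  | insert a s ha ih =>
    rw [Finset.sum_insert ha]
    exact (h a (by simp)).add (ih fun i hi => h i (by simp [hi]))

theorem coeFn_mulOp_toCLM_mulOp (hT : IsLpBounded T) {r₁ r₂ p s q : ℝ≥0∞} [Fact (1 ≤ r₁)]
    [Fact (1 ≤ r₂)] [Fact (1 ≤ p)] [Fact (1 ≤ s)] [Fact (1 ≤ q)] [ENNReal.HolderTriple r₁ p s]
    [ENNReal.HolderTriple r₂ s q] (h1 : 1 < s) (h2 : s < ∞) {a₁ a₂ : Rn n → ℂ}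
    (ha₁ : MemLp a₁ r₁ volume) (ha₂ : MemLp a₂ r₂ volume) {g : Rn n → ℂ}
    (f : Lp ℂ p (volume : Measure (Rn n))) (hfg : f =ᵐ[volume] g) :
    ((mulOp r₂ s q a₂ ha₂).comp ((hT.toCLM h1 h2).comp (mulOp r₁ p s a₁ ha₁)) f : Rn n → ℂ)
      =ᵐ[volume] fun x => a₂ x * T (fun y => a₁ y * g y) x := by
  have e1 : (mulOp r₁ p s a₁ ha₁ f : Rn n → ℂ) =ᵐ[volume] fun y => a₁ y * g y := by
    filter_upwards [coeFn_mulOp (q := s) ha₁ f, hfg] with x hx hx'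
    rw [hx, hx']
  have e2 := (hT.coeFn_toCLM h1 h2 (mulOp r₁ p s a₁ ha₁ f)).trans
    (hT.congr_ae h1 h2 (Lp.memLp _) e1)
  filter_upwards [coeFn_mulOp (q := q) ha₂ (hT.toCLM h1 h2 (mulOp r₁ p s a₁ ha₁ f)), e2] with x hx hx'
  simp only [ContinuousLinearMap.comp_apply]
  rw [hx, hx']

/-- Dominated convergence. The factor `M` makes room for the power of the volume that Hölder's
inequality produces on a compact set. -/
theorem exists_tail_small {h : Rn n → ℝ≥0∞} (hh : Measurable h) {u : ℝ} (hu : 1 ≤ u)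
    (hfin : ∫⁻ z in {z : Rn n | 1 ≤ ‖z‖}, h z ^ u < ∞) {M : ℝ≥0∞} (hM : M ≠ ∞) {ε : ℝ}
    (hε : 0 < ε) : ∃ ρ : ℝ, 1 ≤ ρ ∧
      (∫⁻ z in {z : Rn n | ρ ≤ ‖z‖}, h z ^ u) ^ (1 / u) * M ≤ ENNReal.ofReal ε := by
  have hu0 : 0 < u := by linarith
  have hmeas : ∀ ρ : ℝ, MeasurableSet {z : Rn n | ρ ≤ ‖z‖} := fun ρ =>
    measurableSet_le measurable_const measurable_norm
  have key : Tendsto (fun N : ℕ => ∫⁻ z in {z : Rn n | ((N : ℝ) + 1) ≤ ‖z‖}, h z ^ u) atTop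
      (𝓝 (∫⁻ _ : Rn n, 0)) := by
    simp only [← lintegral_indicator (hmeas _)]
    refine tendsto_lintegral_of_dominated_convergence
      ({z : Rn n | 1 ≤ ‖z‖}.indicator fun z => h z ^ u) ?_ ?_ ?_ ?_
    · exact fun N => (hh.pow_const u).indicator (hmeas _)
    · intro N
      refine ae_of_all _ fun z => Set.indicator_le_indicator_of_subset (fun z hz => ?_)
        (fun _ => zero_le) z
      simp only [Set.mem_ofPred_eq] at hz ⊢
      have : (0 : ℝ) ≤ N := N.cast_nonneg
      linarith
    · rw [lintegral_indicator (hmeas 1)]; exact hfin.ne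
    · refine ae_of_all _ fun z => tendsto_const_nhds.congr' ?_
      filter_upwards [eventually_ge_atTop ⌈‖z‖⌉₊] with N hN
      rw [Set.indicator_of_notMem]
      have := Nat.ceil_le.1 hN
      simp only [Set.mem_ofPred_eq, not_le]
      linarith
  have h2 := ((ENNReal.continuous_rpow_const (y := 1 / u)).tendsto _).comp key
  have h3 : Tendsto (fun N : ℕ => (∫⁻ z in {z : Rn n | ((N : ℝ) + 1) ≤ ‖z‖}, h z ^ u) ^ (1 / u) * M)
      atTop (𝓝 0) := by
    have := ENNReal.Tendsto.mul_const h2 (b := M) (Or.inr hM)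
    simpa [Function.comp_def, hu0] using this
  have h4 := (ENNReal.tendsto_nhds_zero.1 h3) (ENNReal.ofReal ε) (by simpa using hε)
  obtain ⟨N, hN⟩ := h4.exists
  exact ⟨N + 1, by have : (0 : ℝ) ≤ N := N.cast_nonneg
                   linarith, hN⟩

/-- An exponent `u ∈ (1,v]` close enough to `1` for two applications of Young's inequality. -/
theorem exists_young_exponent {p q v : ℝ} (hp : 1 < p) (hq : 1 < q) (hv : 1 < v) :
    ∃ u : ℝ, 1 < u ∧ u ≤ v ∧ u ≤ q ∧ 1 < 1 / p + 1 / u := by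
  -- `p / (p - 1)` is the conjugate exponent; staying below it keeps the target exponent in Young's
  -- inequality finite.
  have hP : 1 < p / (p - 1) := by rw [lt_div_iff₀ (by linarith)]; linarith
  obtain ⟨w, hw1, hw2⟩ := exists_between hP
  refine ⟨min w (min v q), by simp [hw1, hv, hq], by simp, by simp, ?_⟩
  have hm : 0 < min w (min v q) := by
    have : 1 < min w (min v q) := by simp [hw1, hv, hq]
    linarith
  have h1 : 1 / (p / (p - 1)) < 1 / min w (min v q) :=
    one_div_lt_one_div_of_lt hm ((min_le_left _ _).trans_lt hw2)
  have h2 : 1 / (p / (p - 1)) = 1 - 1 / p := by field_simp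
  linarith

section

variable {p q r : ℝ≥0∞} [Fact (1 ≤ r)] [Fact (1 ≤ p)] [Fact (1 ≤ q)] [ENNReal.HolderTriple r p q]

theorem memLp_top_of_continuous {g : Rn n → ℂ} (hg : Continuous g) (hg' : HasCompactSupport g) :
    MemLp g ∞ volume :=
  hg.memLp_of_hasCompactSupport hg'

theorem eLpNorm_indicator_le_rpow {A : Set (Rn n)} (hA : MeasurableSet A) {g : Rn n → ℂ}
    (hg : AEStronglyMeasurable g volume) {s t : ℝ≥0∞} (hst : s ≤ t) :
    eLpNorm (A.indicator g) s volume ≤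
      eLpNorm (A.indicator g) t volume * volume A ^ (1 / s.toReal - 1 / t.toReal) := by
  rw [eLpNorm_indicator_eq_eLpNorm_restrict hA, eLpNorm_indicator_eq_eLpNorm_restrict hA]
  refine (eLpNorm_le_eLpNorm_mul_rpow_measure_univ hst hg.restrict).trans ?_
  rw [Measure.restrict_apply_univ]

/-- A kernel of size `|z|⁻ⁿ` is not integrable at infinity, only its powers `u > 1` are, so Young's
inequality necessarily raises the exponent, from `p` to some `s`. This is harmless because the
output is restricted to `F`, where Hölder's inequality leads back down to `q`. -/
theorem OffDiagonalKernel.exists_tail_left (hk : OffDiagonalKernel T k) (hT : IsLpBounded T)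
    (hq : 1 < q) (hqp : q < p) (hp : p < ∞) {F : Set (Rn n)} (hF : IsCompact F) {ε : ℝ}
    (hε : 0 < ε) : ∃ R : ℝ, ∀ (G : Set (Rn n)) (hG : MeasurableSet G), (∀ y ∈ G, R < ‖y‖) →
      ‖(mulOp r p q (ind F) (memLp_ind hF.measurableSet hF.measure_lt_top.ne r)).comp
        ((hT.toCLM (hq.trans hqp) hp).comp (mulOp ∞ p p (ind G) (memLp_ind_top hG)))‖ ≤ ε := by
  obtain ⟨h, hh, hdom, v, hv, hfin⟩ := hk.dominated
  have hqr : 1 < q.toReal := by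
    simpa using ENNReal.toReal_strict_mono (hqp.trans hp).ne hq
  have hpr : 1 < p.toReal := by
    simpa using ENNReal.toReal_strict_mono hp.ne (hq.trans hqp)
  have hqpr : q.toReal < p.toReal := ENNReal.toReal_strict_mono hp.ne hqp
  obtain ⟨u, hu1, huv, huq, hup⟩ := exists_young_exponent hpr hqr hv
  set s : ℝ := 1 / (1 / p.toReal + 1 / u - 1) with hs
  have hden : 0 < 1 / p.toReal + 1 / u - 1 := by linarith
  have hs0 : 0 < s := by positivity
  have hsp : p.toReal ≤ s := by
    rw [hs, le_div_iff₀ hden]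
    have : 1 / u ≤ 1 := by rw [div_le_one (by linarith)]; exact hu1.le
    have h3 : p.toReal * (1 / p.toReal) = 1 := by field_simp
    nlinarith
  have hyoung : 1 / p.toReal + 1 / u = 1 + 1 / s := by rw [hs]; field_simp; ring
  have hqs : q ≤ ENNReal.ofReal s := by
    rw [ENNReal.le_ofReal_iff_toReal_le (hqp.trans hp).ne hs0.le]
    linarith
  have hMfin : volume F ^ (1 / q.toReal - 1 / (ENNReal.ofReal s).toReal) ≠ ∞ := by
    refine ENNReal.rpow_ne_top_of_nonneg ?_ hF.measure_lt_top.ne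
    rw [ENNReal.toReal_ofReal hs0.le, sub_nonneg]
    exact one_div_le_one_div_of_le (by linarith) (by linarith)
  obtain ⟨ρ, hρ, hρε⟩ := exists_tail_small hh hu1.le (hfin u hu1 huv) hMfin hε
  obtain ⟨R₀, hR₀⟩ := hF.isBounded.exists_norm_le
  refine ⟨R₀ + ρ, fun G hG hGR => ?_⟩
  refine opNorm_le_of_hasCompactSupport hp.ne _ hε.le fun g hg hgc f hfg => ?_
  rw [eLpNorm_congr_ae (coeFn_mulOp_toCLM_mulOp hT _ hp _ _ f hfg)]
  rw [ind_mul G g, ind_mul F]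
  have hgG : MemLp (G.indicator g) p volume := (hg.memLp_of_hasCompactSupport hgc).indicator hG
  refine (eLpNorm_indicator_le_rpow hF.measurableSet (hT.memLp (hq.trans hqp) hp hgG).1
    hqs).trans ?_
  -- `G` need not be bounded, while the kernel representation asks for a compact set carrying the
  -- function; `g` has compact support, which supplies one.
  set F' : Set (Rn n) := tsupport g ∩ {y | R₀ + ρ ≤ ‖y‖}
  have hF' : IsCompact F' := IsCompact.inter_right hgc (isClosed_le continuous_const continuous_norm)
  have key := hk.eLpNorm_indicator_le hh hdom (X := F) hF' (ρ := ρ) (by linarith)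
    (fun x hx y hy => by
      have h1 := hR₀ x hx
      have h2 : R₀ + ρ ≤ ‖y‖ := hy.2
      have h3 := norm_sub_norm_le y x
      rw [norm_sub_rev] at h3
      linarith) (g := G.indicator g)
    ((memLp_top_of_continuous hg hgc).indicator hG)
    (fun x hx => by
      by_cases hxG : x ∈ G
      · rw [Set.indicator_of_mem hxG]
        by_contra hne
        exact hx ⟨subset_tsupport g hne, (hGR x hxG).le⟩
      · simp [hxG]) hpr.le hu1.le hs0 hyoung
  rw [ENNReal.ofReal_toReal hp.ne] at key
  calc _ ≤ (∫⁻ z in {z : Rn n | ρ ≤ ‖z‖}, h z ^ u) ^ (1 / u) * eLpNorm (G.indicator g) p volume *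
        volume F ^ (1 / q.toReal - 1 / (ENNReal.ofReal s).toReal) := by gcongr
    _ = (∫⁻ z in {z : Rn n | ρ ≤ ‖z‖}, h z ^ u) ^ (1 / u) *
        volume F ^ (1 / q.toReal - 1 / (ENNReal.ofReal s).toReal) *
          eLpNorm (G.indicator g) p volume := by ring
    _ ≤ _ := by
      gcongr
      exact MeasureTheory.eLpNorm_indicator_le g

/-- Here the input lives on `F`, so the order is reversed: Hölder's inequality on `F` lowers `p` to
some `s ≤ q`, and Young's inequality then raises `s` to `q`. -/
theorem OffDiagonalKernel.exists_tail_right (hk : OffDiagonalKernel T k) (hT : IsLpBounded T)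
    (hq : 1 < q) (hqp : q < p) (hp : p < ∞) {F : Set (Rn n)} (hF : IsCompact F) {ε : ℝ}
    (hε : 0 < ε) : ∃ R : ℝ, ∀ (G : Set (Rn n)) (hG : MeasurableSet G), (∀ y ∈ G, R < ‖y‖) →
      ‖(mulOp ∞ q q (ind G) (memLp_ind_top hG)).comp
        ((hT.toCLM hq (hqp.trans hp)).comp
          (mulOp r p q (ind F) (memLp_ind hF.measurableSet hF.measure_lt_top.ne r)))‖ ≤ ε := by
  obtain ⟨h, hh, hdom, v, hv, hfin⟩ := hk.dominated
  have hqr : 1 < q.toReal := by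
    simpa using ENNReal.toReal_strict_mono (hqp.trans hp).ne hq
  have hpr : 1 < p.toReal := by
    simpa using ENNReal.toReal_strict_mono hp.ne (hq.trans hqp)
  have hqpr : q.toReal < p.toReal := ENNReal.toReal_strict_mono hp.ne hqp
  obtain ⟨u, hu1, huv, huq, hup⟩ := exists_young_exponent hpr hqr hv
  set s : ℝ := 1 / (1 / q.toReal + 1 - 1 / u) with hs
  have hu1' : 1 / u ≤ 1 := by rw [div_le_one (by linarith)]; exact hu1.le
  have hq0 : 0 < 1 / q.toReal := by positivity
  have hden : 0 < 1 / q.toReal + 1 - 1 / u := by linarith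
  have hs0 : 0 < s := by positivity
  -- This is where the choice `u ≤ q` is used.
  have hs1 : 1 ≤ s := by
    rw [hs, le_div_iff₀ hden]
    have := one_div_le_one_div_of_le (by linarith) huq
    linarith
  have hsq : s ≤ q.toReal := by
    rw [hs, div_le_iff₀ hden]
    have h3 : q.toReal * (1 / q.toReal) = 1 := by field_simp
    nlinarith
  have hyoung : 1 / s + 1 / u = 1 + 1 / q.toReal := by rw [hs]; field_simp; ring
  have hsp : ENNReal.ofReal s ≤ p := by
    refine ENNReal.ofReal_le_of_le_toReal ?_
    linarith
  have hMfin : volume F ^ (1 / (ENNReal.ofReal s).toReal - 1 / p.toReal) ≠ ∞ := by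
    refine ENNReal.rpow_ne_top_of_nonneg ?_ hF.measure_lt_top.ne
    rw [ENNReal.toReal_ofReal hs0.le, sub_nonneg]
    exact one_div_le_one_div_of_le (by linarith) (by linarith)
  obtain ⟨ρ, hρ, hρε⟩ := exists_tail_small hh hu1.le (hfin u hu1 huv) hMfin hε
  obtain ⟨R₀, hR₀⟩ := hF.isBounded.exists_norm_le
  refine ⟨R₀ + ρ, fun G hG hGR => ?_⟩
  refine opNorm_le_of_hasCompactSupport hp.ne _ hε.le fun g hg hgc f hfg => ?_
  rw [eLpNorm_congr_ae (coeFn_mulOp_toCLM_mulOp hT _ (hqp.trans hp) _ _ f hfg)]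
  rw [ind_mul F g, ind_mul G]
  have key := hk.eLpNorm_indicator_le hh hdom (X := G) hF (ρ := ρ) (by linarith)
    (fun x hx y hy => by
      have h1 := hR₀ y hy
      have h2 := hGR x hx
      have h3 := norm_sub_norm_le x y
      linarith) (g := F.indicator g)
    ((memLp_top_of_continuous hg hgc).indicator hF.measurableSet)
    (fun x hx => by simp [hx]) hs1 hu1.le (by linarith) hyoung
  rw [ENNReal.ofReal_toReal (hqp.trans hp).ne] at key
  refine key.trans ?_
  have h2 := eLpNorm_indicator_le_rpow hF.measurableSet hg.aestronglyMeasurable hsp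
  calc _ ≤ (∫⁻ z in {z : Rn n | ρ ≤ ‖z‖}, h z ^ u) ^ (1 / u) * (eLpNorm (F.indicator g) p volume *
        volume F ^ (1 / (ENNReal.ofReal s).toReal - 1 / p.toReal)) := by gcongr
    _ = (∫⁻ z in {z : Rn n | ρ ≤ ‖z‖}, h z ^ u) ^ (1 / u) *
        volume F ^ (1 / (ENNReal.ofReal s).toReal - 1 / p.toReal) *
          eLpNorm (F.indicator g) p volume := by ring
    _ ≤ _ := by
      gcongr
      exact MeasureTheory.eLpNorm_indicator_le g

end

end CZCommutator

/-! ### Compactness between disjoint compact sets, by finite rank approximation. -/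

namespace CZCommutator

variable {n : ℕ} {T : (Rn n → ℂ) → (Rn n → ℂ)} {k : Rn n → Rn n → ℂ}

/-- Integrability of `f` need not be assumed: if the right side is finite then `f = (f - g) + g` is
integrable, and otherwise there is nothing to prove. -/
theorem enorm_integral_sub_integral_le {α : Type*} [MeasurableSpace α] {μ : Measure α}
    {f g : α → ℂ} (hf : AEStronglyMeasurable f μ) (hg : Integrable g μ) :
    ‖∫ x, f x ∂μ - ∫ x, g x ∂μ‖ₑ ≤ ∫⁻ x, ‖f x - g x‖ₑ ∂μ := by
  by_cases h : ∫⁻ x, ‖f x - g x‖ₑ ∂μ = ∞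
  · simp [h]
  have h1 : Integrable (fun x => f x - g x) μ :=
    ⟨hf.sub hg.1, lt_top_iff_ne_top.2 h⟩
  have h2 : Integrable f μ := by
    have := h1.add hg
    refine this.congr (ae_of_all _ fun x => by simp)
  rw [← integral_sub h2 hg]
  exact enorm_integral_le_lintegral_enorm _

/-- A finite measurable discretization of a compact set. -/
theorem exists_simpleFunc_dist_lt {F : Set (Rn n)} (hF : IsCompact F) (hne : F.Nonempty) {δ : ℝ}
    (hδ : 0 < δ) : ∃ π : SimpleFunc (Rn n) (Rn n), (∀ x, π x ∈ F) ∧ ∀ x ∈ F, dist (π x) x < δ := by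
  obtain ⟨x₀, hx₀⟩ := hne
  obtain ⟨t, ht, htf, hcov⟩ := hF.finite_cover_balls hδ
  -- `SimpleFunc.nearestPt` wants an infinite sequence; the finite net is listed and then padded
  -- with `x₀`, so that every value stays in `F`.
  obtain ⟨N, e, he⟩ : ∃ (N : ℕ) (e : ℕ → Rn n), (∀ i, e i ∈ F) ∧ ∀ x ∈ t, ∃ i ≤ N, e i = x := by
    classical
    obtain ⟨l, hl⟩ := htf.toFinset.exists_list_nodup_eq
    refine ⟨l.length, fun i => l.getD i x₀, fun i => ?_, fun x hx => ?_⟩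
    · by_cases hi : i < l.length
      · have : l[i] ∈ htf.toFinset := by rw [← hl.2]; simp
        simpa [hi] using ht (htf.mem_toFinset.1 this)
      · simpa [hi] using hx₀
    · have : x ∈ l := by
        have : x ∈ htf.toFinset := by simpa using hx
        rw [← hl.2] at this
        simpa using this
      obtain ⟨i, hi, hix⟩ := List.getElem_of_mem this
      exact ⟨i, hi.le, by simp [hi, hix]⟩
  refine ⟨SimpleFunc.nearestPt e N, fun x => ?_, fun x hx => ?_⟩
  · rw [SimpleFunc.nearestPt, SimpleFunc.map_apply]
    exact he.1 _
  · obtain ⟨y, hy, hxy⟩ := Set.mem_iUnion₂.1 (hcov hx)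
    obtain ⟨i, hi, rfl⟩ := he.2 y hy
    have := SimpleFunc.edist_nearestPt_le e x hi
    rw [edist_dist, edist_dist] at this
    have := (ENNReal.ofReal_le_ofReal_iff dist_nonneg).1 this
    rw [Metric.mem_ball, dist_comm] at hxy
    linarith

section

variable {p q r : ℝ≥0∞} [Fact (1 ≤ r)] [Fact (1 ≤ p)] [Fact (1 ≤ q)] [ENNReal.HolderTriple r p q]

/-- The finite rank operator with the kernel `1_F(x) 1_G(y) k'(π x, y)`. -/
theorem exists_finite_rank {F G : Set (Rn n)} (hF : IsCompact F) (hG : IsCompact G)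
    {k' : Rn n → Rn n → ℂ} (hk'm : Measurable (Function.uncurry k'))
    (hk' : ContinuousOn (Function.uncurry k') (F ×ˢ G)) (π : SimpleFunc (Rn n) (Rn n))
    (hπ : ∀ x, π x ∈ F) :
    ∃ L : Lp ℂ p (volume : Measure (Rn n)) →L[ℂ] Lp ℂ q (volume : Measure (Rn n)),
      IsCompactOperator L ∧ ∀ (f : Lp ℂ p (volume : Measure (Rn n))) (g : Rn n → ℂ),
        f =ᵐ[volume] g →
        L f =ᵐ[volume] F.indicator fun x => ∫ y, k' (π x) y * G.indicator g y := by
  classical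
  let p' := ENNReal.conjExponent p
  have hconj : ENNReal.HolderConjugate p' p := by
    have : ENNReal.HolderConjugate p p' := ENNReal.HolderConjugate.conjExponent Fact.out
    exact this.symm
  have : Fact (1 ≤ p') := ⟨hconj.one_le⟩
  have hmem : ∀ c : F, MemLp (G.indicator (k' c)) p' volume := by
    intro c
    have hc : ContinuousOn (k' c) G :=
      hk'.comp (f := fun y => ((c : Rn n), y)) (by fun_prop) (fun y hy => ⟨c.2, hy⟩)
    obtain ⟨M, hM⟩ := hG.exists_bound_of_continuousOn hc
    have hm : Measurable (k' c) := hk'm.comp (measurable_const.prodMk measurable_id)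
    rw [memLp_indicator_iff_restrict hG.measurableSet]
    have : IsFiniteMeasure (volume.restrict G) := ⟨by simpa using hG.measure_lt_top⟩
    refine MemLp.of_bound hm.aestronglyMeasurable M ?_
    rw [ae_restrict_iff' hG.measurableSet]
    exact ae_of_all _ hM
  -- Since `π` takes finitely many values, the operator is a finite sum of such functionals times
  -- indicators of the fibres of `π` in `F`.
  let l : F → Lp ℂ p (volume : Measure (Rn n)) →L[ℂ] ℂ := fun c =>
    (ContinuousLinearMap.mul ℂ ℂ).lpPairing volume p' p (hmem c).toLp
  have hl : ∀ (c : F) (f : Lp ℂ p (volume : Measure (Rn n))) (g : Rn n → ℂ), f =ᵐ[volume] g →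
      l c f = ∫ y, k' c y * G.indicator g y := by
    intro c f g hfg
    simp only [l]
    rw [ContinuousLinearMap.lpPairing_eq_integral]
    refine integral_congr_ae ?_
    filter_upwards [(hmem c).coeFn_toLp, hfg] with y hy hy'
    rw [hy, hy']
    by_cases hyG : y ∈ G <;> simp [hyG]
  have hS : ∀ c, MeasurableSet (F ∩ π ⁻¹' {c}) := fun c =>
    hF.measurableSet.inter (π.measurableSet_preimage _)
  have hSf : ∀ c, volume (F ∩ π ⁻¹' {c}) ≠ ∞ := fun c =>
    ((measure_mono Set.inter_subset_left).trans_lt hF.measure_lt_top).ne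
  have hrange : ∀ c ∈ π.range, c ∈ F := by
    intro c hc
    obtain ⟨x, rfl⟩ := SimpleFunc.mem_range.1 hc
    exact hπ x
  let L : Lp ℂ p (volume : Measure (Rn n)) →L[ℂ] Lp ℂ q (volume : Measure (Rn n)) :=
    ∑ c ∈ π.range.attach, (l ⟨c.1, hrange c.1 c.2⟩).smulRight (memLp_ind (hS c.1) (hSf c.1) q).toLp
  refine ⟨L, isCompactOperator_sum _ _ fun c _ => isCompactOperator_smulRight _ _, ?_⟩
  intro f g hfg
  have e1 : L f = ∑ c ∈ π.range.attach,
      (l ⟨c.1, hrange c.1 c.2⟩ f) • (memLp_ind (hS c.1) (hSf c.1) q).toLp := by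
    simp [L]
  have e2 : ∀ᵐ x, ∀ c ∈ π.range.attach,
      ((l ⟨c.1, hrange c.1 c.2⟩ f) • (memLp_ind (hS c.1) (hSf c.1) q).toLp :
        Lp ℂ q (volume : Measure (Rn n))) x = (l ⟨c.1, hrange c.1 c.2⟩ f) * ind (F ∩ π ⁻¹' {c.1}) x := by
    rw [eventually_all_finset]
    intro c _
    filter_upwards [Lp.coeFn_smul (l ⟨c.1, hrange c.1 c.2⟩ f) (memLp_ind (hS c.1) (hSf c.1) q).toLp,
      (memLp_ind (hS c.1) (hSf c.1) q).coeFn_toLp] with x hx hx'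
    rw [hx, Pi.smul_apply, hx', smul_eq_mul]
  rw [e1]
  filter_upwards [Lp.coeFn_fun_finsetSum π.range.attach
    (fun c => (l ⟨c.1, hrange c.1 c.2⟩ f) • (memLp_ind (hS c.1) (hSf c.1) q).toLp), e2]
    with x hx hx2
  rw [hx, Finset.sum_congr rfl hx2]
  by_cases hxF : x ∈ F
  · rw [Set.indicator_of_mem hxF, Finset.sum_eq_single ⟨π x, π.mem_range_self x⟩]
    · rw [hl _ f g hfg]; simp [ind, hxF]
    · rintro ⟨c, hc⟩ _ hne
      have : x ∉ π ⁻¹' {c} := fun h => hne (by simpa using Eq.symm h)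
      simp only [ind]
      rw [Set.indicator_of_notMem (fun h => this h.2), mul_zero]
    · intro h
      exact absurd (Finset.mem_attach _ _) h
  · rw [Set.indicator_of_notMem hxF]
    refine Finset.sum_eq_zero fun c _ => ?_
    simp only [ind]
    rw [Set.indicator_of_notMem (fun h => hxF h.1), mul_zero]

-- Replacing `k` by a continuous `k'`, and then `k' x y` by `k' (π x) y`, costs an error dominated
-- by convolution with an integrable function of small mass. Young's inequality with `u = 1` bounds
-- it on `L^q`, and Hölder's inequality on `G` passes from `Lᵖ` to `L^q`. What is left has finite
-- rank.
set_option maxHeartbeats 1000000 in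
theorem OffDiagonalKernel.isCompactOperator_of_disjoint (hk : OffDiagonalKernel T k)
    (hT : IsLpBounded T) (hq : 1 < q) (hqp : q < p) (hp : p < ∞) {F G : Set (Rn n)}
    (hF : IsCompact F) (hG : IsCompact G) (hFG : Disjoint F G) :
    IsCompactOperator
      ((mulOp r p q (ind F) (memLp_ind hF.measurableSet hF.measure_lt_top.ne r)).comp
        ((hT.toCLM (hq.trans hqp) hp).comp
          (mulOp ∞ p p (ind G) (memLp_ind_top hG.measurableSet)))) := by
  refine isCompactOperator_of_forall_approx _ fun ε hε => ?_
  -- The discretization needs a point of `F`.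
  rcases F.eq_empty_or_nonempty with hFe | hFne
  · refine ⟨0, isCompactOperator_zero, ?_⟩
    refine opNorm_le_of_hasCompactSupport hp.ne _ hε.le fun g hg hgc f hfg => ?_
    rw [sub_zero, eLpNorm_congr_ae (coeFn_mulOp_toCLM_mulOp hT _ hp _ _ f hfg), ind_mul F]
    simp [hFe]
  have hq' : q ≠ ∞ := (hqp.trans hp).ne
  have hqr : 1 < q.toReal := by simpa using ENNReal.toReal_strict_mono hq' hq
  have hqpr : q.toReal < p.toReal := ENNReal.toReal_strict_mono hp.ne hqp
  set M := volume G ^ (1 / q.toReal - 1 / p.toReal) with hMdef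
  have hM : M ≠ ∞ := by
    refine ENNReal.rpow_ne_top_of_nonneg ?_ hG.measure_lt_top.ne
    rw [sub_nonneg]
    exact one_div_le_one_div_of_le (by linarith) hqpr.le
  obtain ⟨R, hR⟩ := (hF.isBounded.sub hG.isBounded).exists_norm_le
  obtain ⟨η, hη, hη'⟩ : ∃ η : NNReal, 0 < η ∧ (η + η : ℝ≥0∞) * M ≤ ENNReal.ofReal ε := by
    have h0 : Tendsto (fun η : NNReal => (η + η : ℝ≥0∞) * M) (𝓝[>] 0) (𝓝 0) := by
      have : Continuous fun η : NNReal => (η + η : ℝ≥0∞) * M :=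
        (ENNReal.continuous_mul_const hM).comp
          (ENNReal.continuous_coe.add ENNReal.continuous_coe)
      have h1 := this.tendsto 0
      simp only [ENNReal.coe_zero, add_zero, zero_mul] at h1
      exact h1.mono_left nhdsWithin_le_nhds
    have h1 := ENNReal.tendsto_nhds_zero.1 h0 (ENNReal.ofReal ε) (by simpa using hε)
    obtain ⟨η, h2, h3⟩ := (h1.and self_mem_nhdsWithin).exists
    exact ⟨η, h3, h2⟩
  obtain ⟨k', h', hk'm, hk'c, hh', hh'i, hkk'⟩ :=
    hk.approx F G hF hG hFG η (by simpa using hη.ne')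
  -- the error allowed in the discretization
  obtain ⟨e, he, heB⟩ : ∃ e : ℝ, 0 < e ∧
      ENNReal.ofReal e * volume (Metric.closedBall (0 : Rn n) R) ≤ η := by
    have hV : volume (Metric.closedBall (0 : Rn n) R) ≠ ∞ := measure_closedBall_lt_top.ne
    refine ⟨η / ((volume (Metric.closedBall (0 : Rn n) R)).toReal + 1), by positivity, ?_⟩
    nth_rewrite 2 [← ENNReal.ofReal_toReal hV]
    rw [← ENNReal.ofReal_mul (by positivity), ← ENNReal.ofReal_coe_nnreal]
    refine ENNReal.ofReal_le_ofReal ?_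
    rw [div_mul_eq_mul_div, div_le_iff₀ (by positivity)]
    have : (0 : ℝ) ≤ η := η.2
    nlinarith
  have huc := (hF.prod hG).uniformContinuousOn_of_continuous hk'c
  obtain ⟨δ, hδ, hδ'⟩ := Metric.uniformContinuousOn_iff.1 huc e he
  obtain ⟨π, hπF, hπ⟩ := exists_simpleFunc_dist_lt hF hFne hδ
  obtain ⟨L', hL'c, hL'⟩ := exists_finite_rank (p := p) (q := q) hF hG hk'm hk'c π hπF
  refine ⟨L', hL'c, ?_⟩
  refine opNorm_le_of_hasCompactSupport hp.ne _ hε.le fun g hg hgc f hfg => ?_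
  -- The first summand pays for the passage from `k` to `k'`. The second pays for the
  -- discretization: a uniform error `e`, which matters only for `z` in `F - G` and hence in a ball
  -- of radius `R`.
  set a : Rn n → ℝ≥0∞ := fun z => h' z +
    (Metric.closedBall (0 : Rn n) R).indicator (fun _ => ENNReal.ofReal e) z with ha
  have ham : Measurable a :=
    hh'.add (measurable_const.indicator measurableSet_closedBall)
  have haint : ∫⁻ z, a z ≤ η + η := by
    rw [ha, lintegral_add_left hh', lintegral_indicator_const measurableSet_closedBall]
    exact add_le_add hh'i heB
  have hgG : MemLp (G.indicator g) ∞ volume :=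
    (memLp_top_of_continuous hg hgc).indicator hG.measurableSet
  have key := eLpNorm_le_of_enorm_le_convolution (n := n) (p := q.toReal) (u := 1) (s := q.toReal)
    hqr.le le_rfl (by linarith) (by ring) ham (g := G.indicator g) hgG.1
    (w := (((mulOp r p q (ind F) (memLp_ind hF.measurableSet hF.measure_lt_top.ne r)).comp
        ((hT.toCLM (hq.trans hqp) hp).comp
          (mulOp ∞ p p (ind G) (memLp_ind_top hG.measurableSet))) - L') f :
        Lp ℂ q (volume : Measure (Rn n)))) ?_
  · rw [ENNReal.ofReal_toReal hq'] at key
    refine key.trans ?_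
    simp only [ENNReal.rpow_one, div_one]
    have h2 := eLpNorm_indicator_le_rpow hG.measurableSet hg.aestronglyMeasurable hqp.le
    calc _ ≤ (η + η) * (eLpNorm (G.indicator g) p volume * M) := by gcongr
      _ = (η + η) * M * eLpNorm (G.indicator g) p volume := by ring
      _ ≤ _ := by
        gcongr
        exact MeasureTheory.eLpNorm_indicator_le g
  · have hLf := coeFn_mulOp_toCLM_mulOp (q := q) hT (hq.trans hqp) hp (memLp_ind_top hG.measurableSet)
      (memLp_ind hF.measurableSet hF.measure_lt_top.ne r) f hfg
    rw [ind_mul G g, ind_mul F] at hLf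
    rw [sub_apply]
    filter_upwards [Lp.coeFn_sub ((mulOp r p q (ind F)
        (memLp_ind hF.measurableSet hF.measure_lt_top.ne r)).comp
        ((hT.toCLM (hq.trans hqp) hp).comp
          (mulOp ∞ p p (ind G) (memLp_ind_top hG.measurableSet))) f) (L' f), hLf, hL' f g hfg,
      hk.rep G hG (G.indicator g) hgG (fun x hx => by simp [hx])] with x hx1 hx2 hx3 hx4
    rw [hx1, Pi.sub_apply, hx2, hx3]
    by_cases hxF : x ∈ F
    · have hxG : x ∉ G := fun h => Set.disjoint_left.1 hFG hxF h
      rw [Set.indicator_of_mem hxF, Set.indicator_of_mem hxF, hx4 hxG]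
      have hcx : ContinuousOn (k' (π x)) G :=
        hk'c.comp (f := fun y => (π x, y)) (by fun_prop) (fun y hy => ⟨hπF x, hy⟩)
      have hint : Integrable (fun y => k' (π x) y * G.indicator g y) := by
        have : (fun y => k' (π x) y * G.indicator g y) =
            G.indicator (fun y => k' (π x) y * g y) := by
          ext y; by_cases hy : y ∈ G <;> simp [hy]
        rw [this, integrable_indicator_iff hG.measurableSet]
        exact (hcx.mul hg.continuousOn).integrableOn_compact hG
      refine (enorm_integral_sub_integral_le ?_ hint).trans (lintegral_mono fun y => ?_)
      · have : Measurable (k x) := hk.measurable.comp (measurable_const.prodMk measurable_id)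
        exact this.aestronglyMeasurable.mul hgG.1
      · by_cases hy : y ∈ G
        · rw [← sub_mul, enorm_mul]
          gcongr
          have hd : ‖k' x y - k' (π x) y‖ₑ ≤ ENNReal.ofReal e := by
            have := hδ' (x, y) ⟨hxF, hy⟩ (π x, y) ⟨hπF x, hy⟩ (by
              rw [Prod.dist_eq]
              simpa [dist_comm, hδ] using hπ x hxF)
            rw [dist_eq_norm] at this
            rw [← ofReal_norm]
            exact ENNReal.ofReal_le_ofReal this.le
          have hmem : x - y ∈ Metric.closedBall (0 : Rn n) R := by
            rw [mem_closedBall_zero_iff]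
            exact hR _ (Set.sub_mem_sub hxF hy)
          rw [ha]
          simp only
          rw [Set.indicator_of_mem hmem]
          calc ‖k x y - k' (π x) y‖ₑ = ‖(k x y - k' x y) + (k' x y - k' (π x) y)‖ₑ := by
                congr 1; ring
            _ ≤ _ := (enorm_add_le _ _).trans (add_le_add (hkk' x hxF y hy) hd)
        · simp [hy]
    · simp [hxF]

end

end CZCommutator

/-! ### Compactness of the commutator with a function in `Lʳ`. -/

namespace CZCommutator

variable {n : ℕ} {T : (Rn n → ℂ) → (Rn n → ℂ)} {k : Rn n → Rn n → ℂ}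

/-- `r = ∞` would force `p = q`. Finiteness of `r` is what makes indicators of small sets small and
simple functions dense. -/
theorem holderTriple_ne_top {p q r : ℝ≥0∞} [ENNReal.HolderTriple r p q] (hqp : q < p) : r ≠ ∞ := by
  rintro rfl
  have h := ENNReal.HolderTriple.inv_add_inv_eq_inv (p := ∞) (q := p) (r := q)
  simp only [ENNReal.inv_top, zero_add, inv_inj] at h
  exact hqp.ne h.symm

section

variable {p q r : ℝ≥0∞} [Fact (1 ≤ r)] [Fact (1 ≤ p)] [Fact (1 ≤ q)] [ENNReal.HolderTriple r p q]

/-- The commutator of `T` with multiplication by a function `a ∈ Lʳ`, from `Lᵖ` to `L^q`. -/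
noncomputable def commOp (r p q : ℝ≥0∞) [Fact (1 ≤ r)] [Fact (1 ≤ p)] [Fact (1 ≤ q)]
    [ENNReal.HolderTriple r p q] (hT : IsLpBounded T) (hq : 1 < q) (hq' : q < ∞) (hp : 1 < p)
    (hp' : p < ∞) (a : Lp ℂ r (volume : Measure (Rn n))) :
    Lp ℂ p (volume : Measure (Rn n)) →L[ℂ] Lp ℂ q (volume : Measure (Rn n)) :=
  ((ContinuousLinearMap.mul ℂ ℂ).holderL volume r p q a).comp (hT.toCLM hp hp') -
    (hT.toCLM hq hq').comp ((ContinuousLinearMap.mul ℂ ℂ).holderL volume r p q a)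

theorem continuous_commOp (hT : IsLpBounded T) (hq : 1 < q) (hq' : q < ∞) (hp : 1 < p)
    (hp' : p < ∞) : Continuous (commOp (T := T) r p q hT hq hq' hp hp') := by
  unfold commOp
  fun_prop

theorem coeFn_commOp (hT : IsLpBounded T) (hq : 1 < q) (hq' : q < ∞) (hp : 1 < p)
    (hp' : p < ∞) {a : Rn n → ℂ} (ha : MemLp a r volume)
    (f : Lp ℂ p (volume : Measure (Rn n))) :
    (commOp r p q hT hq hq' hp hp' ha.toLp f : Rn n → ℂ) =ᵐ[volume] commutator a T f := by
  have e0 := coeFn_mulOp (q := q) ha f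
  have e1 := coeFn_mulOp (q := q) ha (hT.toCLM hp hp' f)
  have e2 := (hT.coeFn_toCLM hq hq' (mulOp r p q a ha f)).trans
    (hT.congr_ae hq hq' (Lp.memLp _) e0)
  have e3 := hT.coeFn_toCLM hp hp' f
  have e4 := Lp.coeFn_sub (mulOp r p q a ha (hT.toCLM hp hp' f))
    (hT.toCLM hq hq' (mulOp r p q a ha f))
  filter_upwards [e1, e2, e3, e4] with x h1 h2 h3 h4
  calc _ = (mulOp r p q a ha (hT.toCLM hp hp' f) - hT.toCLM hq hq' (mulOp r p q a ha f) :
        Lp ℂ q (volume : Measure (Rn n))) x := rfl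
    _ = _ := by rw [h4, Pi.sub_apply, h1, h2, h3]; rfl

-- The diagonal block `1_F T 1_F` cancels in the commutator, so only blocks between `F` and its
-- complement survive. The complement is split into `U \ F` (small measure), `G` (compact, disjoint
-- from `F`) and `H` (far away); the blocks with `G` are compact, the four others have small norm.
set_option maxHeartbeats 1000000 in
theorem OffDiagonalKernel.isCompactOperator_commOp_ind (hk : OffDiagonalKernel T k)
    (hT : IsLpBounded T) (hq : 1 < q) (hqp : q < p) (hp : p < ∞) {F : Set (Rn n)}
    (hF : IsCompact F) :
    IsCompactOperator (commOp r p q hT hq (hqp.trans hp) (hq.trans hqp) hp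
      (memLp_ind hF.measurableSet hF.measure_lt_top.ne r).toLp) := by
  have hp1 : 1 < p := hq.trans hqp
  have hq' : q < ∞ := hqp.trans hp
  have hr : r ≠ ∞ := holderTriple_ne_top hqp
  refine isCompactOperator_of_forall_approx _ fun ε hε => ?_
  set Np := ‖hT.toCLM hp1 hp‖ with hNp
  set Nq := ‖hT.toCLM hq hq'‖ with hNq
  -- a set of small measure around the boundary of `F`
  set e : ℝ := ε / 4 / (Np + Nq + 1) with he
  have he0 : 0 < e := by positivity
  obtain ⟨η, hη, hη'⟩ := exists_eLpNorm_indicator_le (μ := (volume : Measure (Rn n))) hr (1 : ℂ)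
    (ε := ENNReal.ofReal e) (by simpa using he0)
  obtain ⟨U, hFU, hU, hUm⟩ := F.exists_isOpen_lt_add (μ := (volume : Measure (Rn n)))
    hF.measure_lt_top.ne (ε := η) (by simpa using hη.ne')
  have hB : volume (U \ F) ≤ η := by
    rw [measure_sdiff hFU hF.measurableSet.nullMeasurableSet hF.measure_lt_top.ne]
    exact tsub_le_iff_left.2 hUm.le
  have hBf : volume (U \ F) ≠ ∞ := (hB.trans_lt ENNReal.coe_lt_top).ne
  have hBm : MeasurableSet (U \ F) := hU.measurableSet.diff hF.measurableSet
  obtain ⟨R₁, hR₁⟩ := hk.exists_tail_left (r := r) hT hq hqp hp hF (ε := ε / 4) (by positivity)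
  obtain ⟨R₂, hR₂⟩ := hk.exists_tail_right (r := r) hT hq hqp hp hF (ε := ε / 4) (by positivity)
  set R := max R₁ R₂
  set G : Set (Rn n) := Metric.closedBall 0 R \ U with hGdef
  set H : Set (Rn n) := (Metric.closedBall 0 R)ᶜ \ U with hHdef
  have hG : IsCompact G := (isCompact_closedBall 0 R).diff hU
  have hHm : MeasurableSet H := measurableSet_closedBall.compl.diff hU.measurableSet
  have hHR : ∀ y ∈ H, R < ‖y‖ := fun y hy => by simpa using hy.1
  have hFG : Disjoint F G := Set.disjoint_left.2 fun x hx hx' => hx'.2 (hFU hx)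
  have hMF := memLp_ind hF.measurableSet hF.measure_lt_top.ne r
  set L₁ := (mulOp r p q (ind F) hMF).comp
        ((hT.toCLM hp1 hp).comp (mulOp ∞ p p (ind G) (memLp_ind_top hG.measurableSet)))
  set L₂ := (mulOp r p q (ind G) (memLp_ind hG.measurableSet hG.measure_lt_top.ne r)).comp
        ((hT.toCLM hp1 hp).comp (mulOp ∞ p p (ind F) (memLp_ind_top hF.measurableSet)))
  set B₁ := (mulOp ∞ q q (ind F) (memLp_ind_top hF.measurableSet)).comp
        ((hT.toCLM hq hq').comp (mulOp r p q (ind (U \ F)) (memLp_ind hBm hBf r)))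
  set B₂ := (mulOp r p q (ind (U \ F)) (memLp_ind hBm hBf r)).comp
        ((hT.toCLM hp1 hp).comp (mulOp ∞ p p (ind F) (memLp_ind_top hF.measurableSet)))
  set H₁ := (mulOp r p q (ind F) hMF).comp
        ((hT.toCLM hp1 hp).comp (mulOp ∞ p p (ind H) (memLp_ind_top hHm)))
  set H₂ := (mulOp ∞ q q (ind H) (memLp_ind_top hHm)).comp
        ((hT.toCLM hq hq').comp (mulOp r p q (ind F) hMF))
  have hsmall : ‖mulOp r p q (ind (U \ F)) (memLp_ind hBm hBf r)‖ ≤ e :=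
    (norm_mulOp_le _).trans (ENNReal.toReal_le_of_le_ofReal he0.le (hη' _ hB))
  have hNp0 : 0 ≤ Np := norm_nonneg _
  have hNq0 : 0 ≤ Nq := norm_nonneg _
  -- One choice of `e` serves both blocks over `U \ F`, in which `T` acts on `L^q` and on `Lᵖ`
  -- respectively; the `+ 1` keeps the denominator positive.
  have heN : e * (Np + Nq + 1) = ε / 4 := by rw [he]; field_simp
  have hB₁ : ‖B₁‖ ≤ ε / 4 := by
    refine (ContinuousLinearMap.opNorm_comp_le _ _).trans ?_
    refine (mul_le_of_le_one_left (norm_nonneg _)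
      (norm_mulOp_ind_top_le hF.measurableSet)).trans ?_
    refine (ContinuousLinearMap.opNorm_comp_le _ _).trans ?_
    have := mul_le_mul_of_nonneg_left hsmall hNq0
    nlinarith
  have hB₂ : ‖B₂‖ ≤ ε / 4 := by
    refine (ContinuousLinearMap.opNorm_comp_le _ _).trans ?_
    have h1 : ‖(hT.toCLM hp1 hp).comp (mulOp ∞ p p (ind F) (memLp_ind_top hF.measurableSet))‖
        ≤ Np := (ContinuousLinearMap.opNorm_comp_le _ _).trans
          (mul_le_of_le_one_right hNp0 (norm_mulOp_ind_top_le hF.measurableSet))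
    have := mul_le_mul hsmall h1 (norm_nonneg _) he0.le
    nlinarith
  have hH₁ : ‖H₁‖ ≤ ε / 4 := hR₁ H hHm fun y hy => (le_max_left _ _).trans_lt (hHR y hy)
  have hH₂ : ‖H₂‖ ≤ ε / 4 := hR₂ H hHm fun y hy => (le_max_right _ _).trans_lt (hHR y hy)
  refine ⟨L₁ - L₂, (hk.isCompactOperator_of_disjoint hT hq hqp hp hF hG hFG).sub
    (hk.isCompactOperator_of_disjoint hT hq hqp hp hG hF hFG.symm), ?_⟩
  have hdec : commOp r p q hT hq hq' hp1 hp hMF.toLp - (L₁ - L₂) = B₁ - B₂ + (H₁ - H₂) := by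
    rw [sub_eq_iff_eq_add]
    ext1 f
    apply Lp.ext
    have hf := Lp.memLp f
    have hGm := hG.measurableSet
    have hFm := hF.measurableSet
    have c1 := coeFn_commOp hT hq hq' hp1 hp hMF f
    have c2 := coeFn_mulOp_toCLM_mulOp (q := q) hT hp1 hp (memLp_ind_top hGm) hMF f
      (EventuallyEq.refl _ _)
    have c3 := coeFn_mulOp_toCLM_mulOp (q := q) hT hp1 hp (memLp_ind_top hFm)
      (memLp_ind hGm hG.measure_lt_top.ne r) f (EventuallyEq.refl _ _)
    have c4 := coeFn_mulOp_toCLM_mulOp (q := q) hT hq hq' (memLp_ind hBm hBf r)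
      (memLp_ind_top hFm) f (EventuallyEq.refl _ _)
    have c5 := coeFn_mulOp_toCLM_mulOp (q := q) hT hp1 hp (memLp_ind_top hFm)
      (memLp_ind hBm hBf r) f (EventuallyEq.refl _ _)
    have c6 := coeFn_mulOp_toCLM_mulOp (q := q) hT hp1 hp (memLp_ind_top hHm) hMF f
      (EventuallyEq.refl _ _)
    have c7 := coeFn_mulOp_toCLM_mulOp (q := q) hT hq hq' hMF
      (memLp_ind_top hHm) f (EventuallyEq.refl _ _)
    -- decompose `T f` according to the partition `F, U \ F, G, H`
    have hsplit : T f =ᵐ[volume] T (F.indicator f) + T ((U \ F).indicator f) +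
        (T (G.indicator f) + T (H.indicator f)) := by
      have e0 : (f : Rn n → ℂ) = (F.indicator f + (U \ F).indicator f) +
          (G.indicator f + H.indicator f) := by
        ext x
        by_cases h1 : x ∈ F
        · have h2 : x ∈ U := hFU h1
          simp [h1, h2, hGdef, hHdef]
        · by_cases h2 : x ∈ U
          · simp [h1, h2, hGdef, hHdef]
          · by_cases h3 : x ∈ Metric.closedBall (0 : Rn n) R
            · rw [Pi.add_apply, Pi.add_apply, Pi.add_apply, Set.indicator_of_notMem h1,
                Set.indicator_of_notMem (fun h => h2 h.1), Set.indicator_of_mem (show x ∈ G from ⟨h3, h2⟩),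
                Set.indicator_of_notMem (fun h => h.1 h3)]
              simp
            · rw [Pi.add_apply, Pi.add_apply, Pi.add_apply, Set.indicator_of_notMem h1,
                Set.indicator_of_notMem (fun h => h2 h.1), Set.indicator_of_notMem (fun h => h3 h.1),
                Set.indicator_of_mem (show x ∈ H from ⟨h3, h2⟩)]
              simp
      have a1 := hT.map_add p hp1 hp _ _ ((hf.indicator hFm).add (hf.indicator hBm))
        ((hf.indicator hGm).add (hf.indicator hHm))
      have a2 := hT.map_add p hp1 hp _ _ (hf.indicator hFm) (hf.indicator hBm)
      have a3 := hT.map_add p hp1 hp _ _ (hf.indicator hGm) (hf.indicator hHm)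
      rw [← e0] at a1
      exact a1.trans (a2.add a3)
    have s1 := Lp.coeFn_add (B₁ f - B₂ f + (H₁ f - H₂ f)) (L₁ f - L₂ f)
    have s2 := Lp.coeFn_add (B₁ f - B₂ f) (H₁ f - H₂ f)
    have s3 := Lp.coeFn_sub (B₁ f) (B₂ f)
    have s4 := Lp.coeFn_sub (H₁ f) (H₂ f)
    have s5 := Lp.coeFn_sub (L₁ f) (L₂ f)
    have hrhs : (B₁ - B₂ + (H₁ - H₂) + (L₁ - L₂)) f = B₁ f - B₂ f + (H₁ f - H₂ f) + (L₁ f - L₂ f) :=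
      rfl
    rw [hrhs]
    filter_upwards [c1, c2, c3, c4, c5, c6, c7, hsplit, s1, s2, s3, s4, s5]
      with x c1 c2 c3 c4 c5 c6 c7 hsplit s1 s2 s3 s4 s5
    rw [c1, s1, Pi.add_apply, s2, Pi.add_apply, s3, s4, s5, Pi.sub_apply, Pi.sub_apply, Pi.sub_apply,
      c2, c3, c4, c5, c6, c7]
    simp only [commutator, ind_mul]
    rw [hsplit]
    simp only [Pi.add_apply]
    have hsum : ind F x + ind (U \ F) x + ind G x + ind H x = (1 : ℂ) := by
      simp only [ind]
      by_cases h1 : x ∈ F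
      · have h2 : x ∈ U := hFU h1
        simp [h1, h2, hGdef, hHdef]
      · by_cases h2 : x ∈ U
        · simp [h1, h2, hGdef, hHdef]
        · by_cases h3 : x ∈ Metric.closedBall (0 : Rn n) R
          · rw [Set.indicator_of_notMem h1,
              Set.indicator_of_notMem (fun h => h2 h.1), Set.indicator_of_mem (show x ∈ G from ⟨h3, h2⟩),
              Set.indicator_of_notMem (fun h => h.1 h3)]
            simp
          · rw [Set.indicator_of_notMem h1,
              Set.indicator_of_notMem (fun h => h2 h.1), Set.indicator_of_notMem (fun h => h3 h.1),
              Set.indicator_of_mem (show x ∈ H from ⟨h3, h2⟩)]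
            simp
    -- After expansion the two sides differ by `T (1_F f)` times the sum of the four indicators
    -- minus one.
    linear_combination (T (F.indicator f) x) * hsum
  rw [hdec]
  calc ‖B₁ - B₂ + (H₁ - H₂)‖ ≤ ‖B₁‖ + ‖B₂‖ + (‖H₁‖ + ‖H₂‖) :=
        (norm_add_le _ _).trans (add_le_add (norm_sub_le _ _) (norm_sub_le _ _))
    _ ≤ ε := by linarith

/-- The functions whose commutator is compact form a closed linear subspace of `Lʳ`. It contains the
indicators of compact sets, hence by inner regularity those of all sets of finite measure, and these
span a dense subspace. -/
theorem OffDiagonalKernel.isCompactOperator_commOp (hk : OffDiagonalKernel T k)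
    (hT : IsLpBounded T) (hq : 1 < q) (hqp : q < p) (hp : p < ∞)
    (a : Lp ℂ r (volume : Measure (Rn n))) :
    IsCompactOperator (commOp r p q hT hq (hqp.trans hp) (hq.trans hqp) hp a) := by
  have hr : r ≠ ∞ := holderTriple_ne_top hqp
  have hcl : IsClosed {a : Lp ℂ r (volume : Measure (Rn n)) |
      IsCompactOperator (commOp r p q hT hq (hqp.trans hp) (hq.trans hqp) hp a)} :=
    (isClosed_setOfPred_isCompactOperator (σ₁₂ := RingHom.id ℂ)
      (M₁ := Lp ℂ p (volume : Measure (Rn n))) (M₂ := Lp ℂ q (volume : Measure (Rn n)))).preimage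
      (continuous_commOp hT hq (hqp.trans hp) (hq.trans hqp) hp)
  have hadd : ∀ a b : Lp ℂ r (volume : Measure (Rn n)),
      commOp r p q hT hq (hqp.trans hp) (hq.trans hqp) hp (a + b) =
      commOp r p q hT hq (hqp.trans hp) (hq.trans hqp) hp a +
        commOp r p q hT hq (hqp.trans hp) (hq.trans hqp) hp b := by
    intro a b
    simp only [commOp, map_add, ContinuousLinearMap.add_comp, ContinuousLinearMap.comp_add]
    abel
  have hsmul : ∀ (c : ℂ) (a : Lp ℂ r (volume : Measure (Rn n))),
      commOp r p q hT hq (hqp.trans hp) (hq.trans hqp) hp (c • a) =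
      c • commOp r p q hT hq (hqp.trans hp) (hq.trans hqp) hp a := by
    intro c a
    simp only [commOp, map_smul, ContinuousLinearMap.smul_comp, ContinuousLinearMap.comp_smul,
      smul_sub]
  refine Lp.induction hr _ ?_ ?_ hcl a
  · intro c s hs hsμ
    rw [Lp.simpleFunc.coe_indicatorConst]
    have hcs : indicatorConstLp r hs hsμ.ne c = c • (memLp_ind hs hsμ.ne r).toLp := by
      rw [indicatorConstLp, ← MemLp.toLp_const_smul]
      refine MemLp.toLp_congr _ _ (ae_of_all _ fun x => ?_)
      by_cases hx : x ∈ s <;> simp [ind, hx]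
    rw [hcs, hsmul]
    refine IsCompactOperator.smul (S := ℂ) ?_ c
    suffices (memLp_ind hs hsμ.ne r).toLp ∈ closure {a : Lp ℂ r (volume : Measure (Rn n)) |
      IsCompactOperator (commOp r p q hT hq (hqp.trans hp) (hq.trans hqp) hp a)} by
      rwa [hcl.closure_eq] at this
    rw [Metric.mem_closure_iff]
    intro ε hε
    obtain ⟨η, hη, hη'⟩ := exists_eLpNorm_indicator_le (μ := (volume : Measure (Rn n))) hr (1 : ℂ)
      (ε := ENNReal.ofReal (ε / 2)) (by simpa using hε)
    obtain ⟨F, hFs, hF, -, hFμ⟩ := hs.exists_isCompact_isClosed_sdiff_lt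
      (μ := (volume : Measure (Rn n))) hsμ.ne (ε := η) (by simpa using hη.ne')
    refine ⟨_, hk.isCompactOperator_commOp_ind hT hq hqp hp hF, ?_⟩
    rw [dist_eq_norm, ← MemLp.toLp_sub, Lp.norm_toLp]
    have : ind s - ind F = (s \ F).indicator fun _ => (1 : ℂ) := by
      rw [Set.indicator_sdiff hFs]; rfl
    rw [this]
    refine (ENNReal.toReal_le_of_le_ofReal (by positivity) (hη' _ hFμ.le)).trans_lt (by linarith)
  · intro f g hf hg _ h1 h2
    rw [hadd]
    exact h1.add h2

/-- If `b` lies in `Lʳ` modulo constants, then the commutator is compact. -/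
theorem OffDiagonalKernel.commutatorCompact (hk : OffDiagonalKernel T k)
    (hT : IsLpBounded T) (hq : 1 < q) (hqp : q < p) (hp : p < ∞) {b : Rn n → ℂ}
    (hb : LocallyIntegrable b volume) (hbr : MemLpModConst b r) : CommutatorCompact b T p q := by
  obtain ⟨c, hc⟩ := iInf_lt_iff.1 hbr.2
  have hq' := hqp.trans hp
  have hp1 := hq.trans hqp
  set a : Rn n → ℂ := fun x => b x - c with ha_def
  have ha : MemLp a r volume := ⟨hb.aestronglyMeasurable.sub aestronglyMeasurable_const, hc⟩
  refine ⟨commOp r p q hT hq hq' hp1 hp ha.toLp, ?_, hk.isCompactOperator_commOp hT hq hqp hp _⟩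
  rintro f ⟨s, hs, hs', hbf⟩
  refine (coeFn_commOp hT hq hq' hp1 hp ha f).trans ?_
  have haf : MemLp (fun y => a y * f y) q volume :=
    (Lp.memLp (mulOp r p q a ha f)).ae_eq (coeFn_mulOp ha f)
  have hcf : MemLp (c • (f : Rn n → ℂ)) p volume := (Lp.memLp f).const_smul c
  have hsum : (fun y => b y * f y) = (fun y => a y * f y) + c • (f : Rn n → ℂ) := by
    ext y; simp [ha_def, sub_mul]
  -- The products with `f` of `b - c`, of `c` and of `b` lie in `L^q`, `Lᵖ` and `Lˢ` respectively,
  -- so additivity within a single space would not suffice.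
  have h1 := hT.map_add_of_memLp hq hq' hp1 hp hs hs' haf hcf (hsum ▸ hbf)
  rw [← hsum] at h1
  filter_upwards [h1, hT.map_smul p hp1 hp c f (Lp.memLp f)] with x hx hx'
  simp only [commutator]
  rw [hx, Pi.add_apply, hx']
  simp only [ha_def, Pi.smul_apply, smul_eq_mul]
  ring

end

end CZCommutator

/-! ### Signs for bilinear forms and norms of sums over geometric levels. -/

namespace CZCommutator

variable {n : ℕ}

/-- Signs that make a bilinear form on sums dominate the diagonal sum. -/
theorem exists_signs {V W ι : Type*} [NormedAddCommGroup V] [NormedSpace ℂ V]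
    [NormedAddCommGroup W] [NormedSpace ℂ W] (B : V →L[ℂ] W →L[ℂ] ℂ) (s : Finset ι)
    (ψ : ι → V) (φ : ι → W) :
    ∃ ε : ι → ℂ, (∀ i, ‖ε i‖ = 1) ∧
      ∑ i ∈ s, (B (ψ i) (φ i)).re ≤ (B (∑ i ∈ s, ε i • ψ i) (∑ i ∈ s, ε i • φ i)).re := by
  classical
  induction s using Finset.induction with
  | empty => exact ⟨fun _ => 1, by simp, by simp⟩
  | insert a s ha ih =>
    obtain ⟨ε, hε, h⟩ := ih
    set u := ∑ i ∈ s, ε i • ψ i with hu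
    set v := ∑ i ∈ s, ε i • φ i with hv
    -- The new index gets a sign `e = ±1` that makes the cross terms nonnegative in real part. The
    -- same sign multiplies both functions and the form is bilinear, so the diagonal term is only
    -- multiplied by `e * e = 1`.
    obtain ⟨e, he, he2, hcross⟩ : ∃ e : ℂ, ‖e‖ = 1 ∧ e * e = 1 ∧
        0 ≤ (e * (B u (φ a) + B (ψ a) v)).re := by
      rcases le_total 0 (B u (φ a) + B (ψ a) v).re with h0 | h0
      · exact ⟨1, by simp, by simp, by simpa using h0⟩
      · refine ⟨-1, by simp, by simp, ?_⟩
        rw [neg_one_mul, Complex.neg_re]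
        linarith
    refine ⟨Function.update ε a e, fun i => ?_, ?_⟩
    · by_cases hi : i = a
      · simp [hi, he]
      · simp [hi, hε]
    · have hupd : ∀ i ∈ s, Function.update ε a e i = ε i := fun i hi =>
        Function.update_of_ne (by rintro rfl; exact ha hi) _ _
      rw [Finset.sum_insert ha, Finset.sum_insert ha, Finset.sum_insert ha, Function.update_self,
        Finset.sum_congr rfl (g := fun i => ε i • ψ i) (fun i hi => by rw [hupd i hi]),
        Finset.sum_congr rfl (g := fun i => ε i • φ i) (fun i hi => by rw [hupd i hi]), ← hu, ← hv]
      have : B (e • ψ a + u) (e • φ a + v) =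
          B (ψ a) (φ a) + (e * (B u (φ a) + B (ψ a) v) + B u v) := by
        simp only [map_add, map_smul, add_apply, smul_apply, smul_eq_mul]
        linear_combination (B (ψ a) (φ a)) * he2
      rw [this, Complex.add_re, Complex.add_re]
      linarith

/-- With distinct exponents the sum is at most a constant times its largest term, and the power of
that term is one of the summands on the right. -/
theorem sum_geometric_rpow_le {ι : Type*} (J : Finset ι) (κ : ι → ℕ) (hκ : Set.InjOn κ J) {τ c P : ℝ}
    (hτ : 1 < τ) (hc : 0 ≤ c) (hP : 0 < P) :
    (∑ i ∈ J, c * τ ^ κ i) ^ P ≤ (τ / (τ - 1)) ^ P * ∑ i ∈ J, (c * τ ^ κ i) ^ P := by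
  classical
  have hτ1 : 0 < τ - 1 := by linarith
  rcases J.eq_empty_or_nonempty with rfl | hJ
  · simp [Real.zero_rpow hP.ne']
  obtain ⟨m, hm, hmax⟩ := J.exists_max_image κ hJ
  have h1 : ∑ i ∈ J, τ ^ κ i ≤ ∑ j ∈ Finset.range (κ m + 1), τ ^ j := by
    rw [← Finset.sum_image (f := fun j => τ ^ j) hκ]
    refine Finset.sum_le_sum_of_subset_of_nonneg ?_ (fun _ _ _ => by positivity)
    intro j hj
    obtain ⟨i, hi, rfl⟩ := Finset.mem_image.1 hj
    exact Finset.mem_range.2 (Nat.lt_succ_of_le (hmax i hi))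
  have h2 : ∑ j ∈ Finset.range (κ m + 1), τ ^ j ≤ τ / (τ - 1) * τ ^ κ m := by
    rw [geom_sum_eq hτ.ne', div_mul_eq_mul_div]
    gcongr
    rw [pow_succ]; linarith
  have h3 : ∑ i ∈ J, c * τ ^ κ i ≤ τ / (τ - 1) * (c * τ ^ κ m) := by
    rw [← Finset.mul_sum]
    nlinarith [mul_le_mul_of_nonneg_left (h1.trans h2) hc]
  calc (∑ i ∈ J, c * τ ^ κ i) ^ P ≤ (τ / (τ - 1) * (c * τ ^ κ m)) ^ P := by
        refine Real.rpow_le_rpow (Finset.sum_nonneg fun i _ => by positivity) h3 hP.le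
    _ = (τ / (τ - 1)) ^ P * (c * τ ^ κ m) ^ P := by
        rw [Real.mul_rpow (by positivity) (by positivity)]
    _ ≤ _ := by
        gcongr
        exact Finset.single_le_sum (f := fun i => (c * τ ^ κ i) ^ P)
          (fun i _ => by positivity) hm

/-- The `Lᵖ` norm of sums adapted to a family of sets that are disjoint on each level, with
coefficients that grow geometrically with the level. -/
theorem eLpNorm_sum_levels_le {ι : Type*} (s : Finset ι) (E : ι → Set (Rn n))
    (hE : ∀ i, MeasurableSet (E i)) (hEf : ∀ i, volume (E i) ≠ ∞) (κ : ι → ℕ)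
    (hdisj : ∀ i ∈ s, ∀ j ∈ s, i ≠ j → κ i = κ j → Disjoint (E i) (E j)) {h c₀ R : ℝ}
    (hh : 0 < h) (hc₀ : 1 < c₀) (hR : 0 < R) {p : ℝ≥0∞} (hp0 : p ≠ 0) (hp : p ≠ ∞)
    (w : ι → Rn n → ℂ) (hw : ∀ i x, ‖w i x‖ ≤ 1) (hw0 : ∀ i, ∀ x ∉ E i, w i x = 0)
    (ε : ι → ℂ) (hε : ∀ i, ‖ε i‖ = 1) :
    eLpNorm (fun x => ∑ i ∈ s, ε i * ((((h * c₀ ^ κ i) ^ (R / p.toReal) : ℝ) : ℂ) * w i x)) p volume ≤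
      ENNReal.ofReal (c₀ ^ (R / p.toReal) / (c₀ ^ (R / p.toReal) - 1) *
        (∑ i ∈ s, (h * c₀ ^ κ i) ^ R * volume.real (E i)) ^ (1 / p.toReal)) := by
  classical
  have hP : 0 < p.toReal := ENNReal.toReal_pos hp0 hp
  set P := p.toReal
  set τ := c₀ ^ (R / P) with hτdef
  have hτ : 1 < τ := Real.one_lt_rpow hc₀ (by positivity)
  have hτ1 : 0 < τ - 1 := by linarith
  have hcoef : ∀ i, (h * c₀ ^ κ i) ^ (R / P) = h ^ (R / P) * τ ^ κ i := by
    intro i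
    rw [Real.mul_rpow hh.le (by positivity), hτdef, ← Real.rpow_natCast, ← Real.rpow_natCast,
      ← Real.rpow_mul (by linarith), ← Real.rpow_mul (by linarith), mul_comm (R / P)]
  have hcoef' : ∀ i, (h ^ (R / P) * τ ^ κ i) ^ P = (h * c₀ ^ κ i) ^ R := by
    intro i
    rw [← hcoef, ← Real.rpow_mul (by positivity), div_mul_cancel₀ _ hP.ne']
  set D := τ / (τ - 1)
  have hD : 0 < D := by positivity
  have hpt : ∀ x, ‖∑ i ∈ s, ε i * ((((h * c₀ ^ κ i) ^ (R / P) : ℝ) : ℂ) * w i x)‖ₑ ^ P ≤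
      ∑ i ∈ s, (E i).indicator (fun _ => ENNReal.ofReal (D ^ P * (h * c₀ ^ κ i) ^ R)) x := by
    intro x
    set J := s.filter fun i => x ∈ E i with hJ
    have h1 : ‖∑ i ∈ s, ε i * ((((h * c₀ ^ κ i) ^ (R / P) : ℝ) : ℂ) * w i x)‖ ≤
        ∑ i ∈ J, h ^ (R / P) * τ ^ κ i := by
      rw [hJ, Finset.sum_filter]
      refine (norm_sum_le _ _).trans (Finset.sum_le_sum fun i _ => ?_)
      by_cases hx : x ∈ E i
      · rw [if_pos hx, norm_mul, hε, one_mul, norm_mul, Complex.norm_real, ← hcoef,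
          Real.norm_of_nonneg (by positivity)]
        exact mul_le_of_le_one_right (by positivity) (hw i x)
      · simp [hx, hw0 i x hx]
    -- At a fixed point at most one set of each level is active, so the sum there is geometric.
    have hinj : Set.InjOn κ J := by
      intro i hi j hj hij
      by_contra hne
      simp only [hJ, Finset.coe_filter, Set.mem_ofPred_eq] at hi hj
      exact Set.disjoint_left.1 (hdisj i hi.1 j hj.1 hne hij) hi.2 hj.2
    have h2 := sum_geometric_rpow_le J κ hinj hτ (by positivity : 0 ≤ h ^ (R / P)) hP
    simp only [hcoef'] at h2
    rw [← ofReal_norm, ENNReal.ofReal_rpow_of_nonneg (norm_nonneg _) hP.le]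
    calc _ ≤ ENNReal.ofReal (D ^ P * ∑ i ∈ J, (h * c₀ ^ κ i) ^ R) :=
          ENNReal.ofReal_le_ofReal ((Real.rpow_le_rpow (norm_nonneg _) h1 hP.le).trans h2)
      _ = ∑ i ∈ J, ENNReal.ofReal (D ^ P * (h * c₀ ^ κ i) ^ R) := by
          rw [Finset.mul_sum, ENNReal.ofReal_sum_of_nonneg (fun i _ => by positivity)]
      _ = _ := by
          rw [hJ, Finset.sum_filter]
          refine Finset.sum_congr rfl fun i _ => ?_
          by_cases hx : x ∈ E i <;> simp [hx]
  rw [eLpNorm_eq_lintegral_rpow_enorm_toReal hp0 hp]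
  have h3 : ∫⁻ x, ‖∑ i ∈ s, ε i * ((((h * c₀ ^ κ i) ^ (R / P) : ℝ) : ℂ) * w i x)‖ₑ ^ P ≤
      ENNReal.ofReal (D ^ P * ∑ i ∈ s, (h * c₀ ^ κ i) ^ R * volume.real (E i)) := by
    refine (lintegral_mono hpt).trans ?_
    rw [lintegral_finsetSum _ fun i _ => measurable_const.indicator (hE i), Finset.mul_sum,
      ENNReal.ofReal_sum_of_nonneg (fun i _ => by positivity)]
    refine Finset.sum_le_sum fun i _ => ?_
    rw [lintegral_indicator_const (hE i), ← mul_assoc, ENNReal.ofReal_mul (q := volume.real (E i))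
      (by positivity), Measure.real, ENNReal.ofReal_toReal (hEf i)]
  refine (ENNReal.rpow_le_rpow h3 (by positivity)).trans (le_of_eq ?_)
  rw [ENNReal.ofReal_rpow_of_nonneg (by positivity) (by positivity),
    Real.mul_rpow (by positivity) (by positivity), ← Real.rpow_mul hD.le,
    mul_one_div_cancel hP.ne', Real.rpow_one]

end CZCommutator

/-! ### From test functions to a bound for sums over levels. -/

namespace CZCommutator

variable {n : ℕ}

/-- The integral over a closed ball of the deviation of `b` from its average. -/
noncomputable def oscBall (b : Rn n → ℂ) (c : Rn n) (ρ : ℝ) : ℝ :=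
  ∫ x in Metric.closedBall c ρ, ‖b x - ⨍ y in Metric.closedBall c ρ, b y‖

/-- The oscillation of `b` on every ball is controlled by testing `S` on bounded functions
supported in a dilation of the ball. -/
def HasTestFunctions {p q : ℝ≥0∞} [Fact (1 ≤ p)] [Fact (1 ≤ q)] (b : Rn n → ℂ)
    (S : Lp ℂ p (volume : Measure (Rn n)) →L[ℂ] Lp ℂ q (volume : Measure (Rn n)))
    (C A : ℝ) : Prop :=
  ∀ (c : Rn n) (ρ : ℝ), 0 < ρ → ∃ ψ φ : Rn n → ℂ, Measurable ψ ∧ Measurable φ ∧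
    (∀ x, ‖ψ x‖ ≤ 1) ∧ (∀ x, ‖φ x‖ ≤ 1) ∧
    (∀ x ∉ Metric.closedBall c (A * ρ), ψ x = 0) ∧ (∀ x ∉ Metric.closedBall c (A * ρ), φ x = 0) ∧
    ∀ f : Lp ℂ p (volume : Measure (Rn n)), f =ᵐ[volume] ψ →
      oscBall b c ρ ≤ C * (∫ x, S f x * φ x).re

theorem memLp_of_bounded_of_support {w : Rn n → ℂ} (hw : Measurable w) (h1 : ∀ x, ‖w x‖ ≤ 1)
    {E : Set (Rn n)} (hE : MeasurableSet E) (hEf : volume E ≠ ∞) (h0 : ∀ x ∉ E, w x = 0)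
    (s : ℝ≥0∞) : MemLp w s volume := by
  have : w = E.indicator w := by
    ext x; by_cases hx : x ∈ E
    · simp [hx]
    · simp [hx, h0 x hx]
  rw [this, memLp_indicator_iff_restrict hE]
  have : IsFiniteMeasure (volume.restrict E) := ⟨by simpa using hEf.lt_top⟩
  exact MemLp.of_bound hw.aestronglyMeasurable 1 (ae_of_all _ h1)

theorem volume_real_closedBall (c : Rn n) {ρ : ℝ} (hρ : 0 ≤ ρ) :
    volume.real (Metric.closedBall c ρ) = ρ ^ n * volume.real (Metric.closedBall (0 : Rn n) 1) := by
  rw [Measure.real, Measure.addHaar_closedBall' _ _ hρ, ENNReal.toReal_mul,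
    ENNReal.toReal_ofReal (by positivity)]
  simp [Measure.real]

theorem coeFn_sum_smul_toLp {ι : Type*} {p : ℝ≥0∞} [Fact (1 ≤ p)] (s : Finset ι) (ε a : ι → ℂ)
    {w : ι → Rn n → ℂ} (hw : ∀ i, MemLp (w i) p volume) :
    (∑ i ∈ s, ε i • a i • (hw i).toLp : Lp ℂ p (volume : Measure (Rn n))) =ᵐ[volume]
      fun x => ∑ i ∈ s, ε i * (a i * w i x) := by
  have e2 : ∀ᵐ x, ∀ i ∈ s, (ε i • a i • (hw i).toLp : Lp ℂ p (volume : Measure (Rn n))) x =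
      ε i * (a i * w i x) := by
    rw [eventually_all_finset]
    intro i _
    filter_upwards [Lp.coeFn_smul (ε i) (a i • (hw i).toLp), Lp.coeFn_smul (a i) (hw i).toLp,
      (hw i).coeFn_toLp] with x h1 h2 h3
    rw [h1, Pi.smul_apply, h2, Pi.smul_apply, h3, smul_eq_mul, smul_eq_mul]
  filter_upwards [Lp.coeFn_fun_finsetSum s (fun i => ε i • a i • (hw i).toLp), e2] with x h1 h2
  rw [h1, Finset.sum_congr rfl h2]

theorem le_rpow_of_le_mul_rpow {X M R : ℝ} (hX : 0 ≤ X) (hM : 0 ≤ M) (hR : 0 < R)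
    (h : X ≤ M * X ^ (1 - 1 / R)) : X ≤ M ^ R := by
  rcases hX.eq_or_lt with h0 | hpos
  · rw [← h0]; positivity
  · have h1 : X ^ (1 / R) ≤ M := by
      have h2 : X ^ (1 / R) * X ^ (1 - 1 / R) = X := by
        rw [← Real.rpow_add hpos]; simp
      refine le_of_mul_le_mul_right ?_ (Real.rpow_pos_of_pos hpos (1 - 1 / R))
      rw [h2]; exact h
    calc X = (X ^ (1 / R)) ^ R := by
          rw [← Real.rpow_mul hX, one_div_mul_cancel hR.ne', Real.rpow_one]
      _ ≤ M ^ R := Real.rpow_le_rpow (by positivity) h1 hR.le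

-- Duality. If `X` is the sum to be bounded, the oscillation hypothesis bounds `X` by the diagonal
-- terms of a bilinear form on `Lᵖ × L^{q'}`; after a choice of signs, the combined functions have
-- norms of order `X^(1/p)` and `X^(1/q')`. As `1/p + 1/q' = 1 - 1/r`, this reads `X ≤ M₀
-- X^(1-1/r)`. Since `X` is a finite sum, it can be divided out, and the bound depends neither on
-- the family nor on `h`.
set_option maxHeartbeats 1000000 in
theorem sum_levels_le {p q r : ℝ≥0∞} [Fact (1 ≤ p)] [Fact (1 ≤ q)] [ENNReal.HolderTriple r p q]
    (hq : 1 < q) (hqp : q < p) (hp : p < ∞) {b : Rn n → ℂ}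
    {S : Lp ℂ p (volume : Measure (Rn n)) →L[ℂ] Lp ℂ q (volume : Measure (Rn n))}
    {C A : ℝ} (hC : 0 ≤ C) (hA : 0 ≤ A) (hS : HasTestFunctions b S C A) {c₀ C' : ℝ} (hc₀ : 1 < c₀)
    (hC' : 0 ≤ C') : ∃ M : ℝ, ∀ {ι : Type} (s : Finset ι) (c : ι → Rn n) (ρ : ι → ℝ) (κ : ι → ℕ)
      (h : ℝ), 0 < h → (∀ i, 0 < ρ i) →
      (∀ i ∈ s, ∀ j ∈ s, i ≠ j → κ i = κ j →
        Disjoint (Metric.closedBall (c i) (A * ρ i)) (Metric.closedBall (c j) (A * ρ j))) →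
      (∀ i ∈ s, h * c₀ ^ κ i * ρ i ^ n ≤ C' * oscBall b (c i) (ρ i)) →
      ∑ i ∈ s, (h * c₀ ^ κ i) ^ r.toReal * ρ i ^ n ≤ M := by
  classical
  have hr : r ≠ ∞ := holderTriple_ne_top hqp
  have hq' : q ≠ ∞ := (hqp.trans hp).ne
  have hQ : 1 < q.toReal := by simpa using ENNReal.toReal_strict_mono hq' hq
  have hQP : q.toReal < p.toReal := ENNReal.toReal_strict_mono hp.ne hqp
  have hr0 : r ≠ 0 := by
    rintro rfl
    have := ENNReal.HolderTriple.inv_add_inv_eq_inv (p := 0) (q := p) (r := q)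
    simp at this
    exact (zero_lt_one.trans hq).ne' (ENNReal.inv_eq_top.1 this.symm)
  have hR : 0 < r.toReal := ENNReal.toReal_pos hr0 hr
  have hPQR : 1 / r.toReal + 1 / p.toReal = 1 / q.toReal := by
    have := ENNReal.HolderTriple.inv_add_inv_eq_inv (p := r) (q := p) (r := q)
    have := congrArg ENNReal.toReal this
    rw [ENNReal.toReal_add (by simpa using hr0)
      (by simpa using (zero_lt_one.trans (hq.trans hqp)).ne')] at this
    simpa [ENNReal.toReal_inv] using this
  let q' := ENNReal.conjExponent q
  have hconj : ENNReal.HolderConjugate q q' := ENNReal.HolderConjugate.conjExponent hq.le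
  have hq'1 : Fact (1 ≤ q') := ⟨hconj.symm.one_le⟩
  have hQ' : q.toReal.HolderConjugate q'.toReal :=
    (ENNReal.HolderConjugate.toReal_iff hQ).2 hconj
  have hq'0 : q' ≠ 0 := (zero_lt_one.trans_le hq'1.out).ne'
  have hq't : q' ≠ ∞ := by
    intro h
    have := hQ'.symm.pos
    rw [h] at this
    simp at this
  set R := r.toReal
  set P := p.toReal
  set Q' := q'.toReal
  have hP0 : 0 < P := by linarith
  have hQ'0 : 0 < Q' := hQ'.symm.pos
  have hsum1 : 1 / P + 1 / Q' = 1 - 1 / R := by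
    have := hQ'.inv_add_inv_eq_one
    simp only [one_div] at hPQR ⊢
    linarith
  set B : Lp ℂ p (volume : Measure (Rn n)) →L[ℂ] Lp ℂ q' (volume : Measure (Rn n)) →L[ℂ] ℂ :=
    ((ContinuousLinearMap.mul ℂ ℂ).lpPairing volume q q').comp S
  set D₁ := c₀ ^ (R / P) / (c₀ ^ (R / P) - 1)
  set D₂ := c₀ ^ (R / Q') / (c₀ ^ (R / Q') - 1)
  have hD : ∀ t : ℝ, 0 < t → 0 ≤ c₀ ^ (R / t) / (c₀ ^ (R / t) - 1) := by
    intro t ht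
    have : 1 < c₀ ^ (R / t) := Real.one_lt_rpow hc₀ (by positivity)
    exact div_nonneg (by linarith) (by linarith)
  set V := A ^ n * volume.real (Metric.closedBall (0 : Rn n) 1)
  have hV : 0 ≤ V := by positivity
  set M₀ := C' * C * (‖B‖ * (D₁ * D₂ * V ^ (1 - 1 / R))) with hM₀
  have hM₀0 : 0 ≤ M₀ := by
    have := hD P hP0
    have := hD Q' hQ'0
    positivity
  refine ⟨M₀ ^ R, fun {ι} s c ρ κ h hh hρ hdisj hosc => ?_⟩
  choose ψ φ hψm hφm hψ1 hφ1 hψ0 hφ0 htest using fun i => hS (c i) (ρ i) (hρ i)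
  set E : ι → Set (Rn n) := fun i => Metric.closedBall (c i) (A * ρ i)
  have hEm : ∀ i, MeasurableSet (E i) := fun i => measurableSet_closedBall
  have hEf : ∀ i, volume (E i) ≠ ∞ := fun i => measure_closedBall_lt_top.ne
  have hψ : ∀ i, MemLp (ψ i) p volume := fun i =>
    memLp_of_bounded_of_support (hψm i) (hψ1 i) (hEm i) (hEf i) (hψ0 i) p
  have hφ : ∀ i, MemLp (φ i) q' volume := fun i =>
    memLp_of_bounded_of_support (hφm i) (hφ1 i) (hEm i) (hEf i) (hφ0 i) q'
  set H : ι → ℝ := fun i => h * c₀ ^ κ i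
  have hH : ∀ i, 0 < H i := fun i => by positivity
  set α : ι → ℝ := fun i => H i ^ (R / P)
  set β : ι → ℝ := fun i => H i ^ (R / Q')
  -- The weight `H^(R-1)` is distributed over the two functions so that each norm, raised to its own
  -- power, produces `H^R`.
  have hαβ : ∀ i, α i * β i = H i ^ (R - 1) := fun i => by
    rw [← Real.rpow_add (hH i)]
    congr 1
    have : R / P + R / Q' = R * (1 / P + 1 / Q') := by ring
    rw [this, hsum1]
    field_simp
  set X := ∑ i ∈ s, H i ^ R * ρ i ^ n with hX
  have hX0 : 0 ≤ X := Finset.sum_nonneg fun i _ => by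
    have := hH i; have := hρ i; positivity
  have hXV : ∑ i ∈ s, H i ^ R * volume.real (E i) = V * X := by
    rw [hX, Finset.mul_sum]
    refine Finset.sum_congr rfl fun i _ => ?_
    rw [volume_real_closedBall _ (mul_nonneg hA (hρ i).le), mul_pow]
    ring
  obtain ⟨ε, hε, hsign⟩ := exists_signs B s (fun i => (α i : ℂ) • (hψ i).toLp)
    (fun i => (β i : ℂ) • (hφ i).toLp)
  have hn1 : ‖∑ i ∈ s, ε i • (α i : ℂ) • (hψ i).toLp‖ ≤ D₁ * (V * X) ^ (1 / P) := by
    rw [Lp.norm_def, eLpNorm_congr_ae (coeFn_sum_smul_toLp s ε (fun i => (α i : ℂ)) hψ)]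
    refine ENNReal.toReal_le_of_le_ofReal (mul_nonneg (hD P hP0) (by positivity)) ?_
    rw [← hXV]
    exact eLpNorm_sum_levels_le s E hEm hEf κ hdisj hh hc₀ hR
      (zero_lt_one.trans (hq.trans hqp)).ne' hp.ne ψ hψ1 hψ0 ε hε
  have hn2 : ‖∑ i ∈ s, ε i • (β i : ℂ) • (hφ i).toLp‖ ≤ D₂ * (V * X) ^ (1 / Q') := by
    rw [Lp.norm_def, eLpNorm_congr_ae (coeFn_sum_smul_toLp s ε (fun i => (β i : ℂ)) hφ)]
    refine ENNReal.toReal_le_of_le_ofReal (mul_nonneg (hD Q' hQ'0) (by positivity)) ?_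
    rw [← hXV]
    exact eLpNorm_sum_levels_le s E hEm hEf κ hdisj hh hc₀ hR hq'0 hq't φ hφ1 hφ0 ε hε
  have hB : ∀ i, (B ((α i : ℂ) • (hψ i).toLp) ((β i : ℂ) • (hφ i).toLp)).re =
      α i * β i * (∫ x, S (hψ i).toLp x * φ i x).re := by
    intro i
    have : B (hψ i).toLp (hφ i).toLp = ∫ x, S (hψ i).toLp x * φ i x := by
      simp only [B, ContinuousLinearMap.comp_apply]
      rw [ContinuousLinearMap.lpPairing_eq_integral]
      refine integral_congr_ae ?_
      filter_upwards [(hφ i).coeFn_toLp] with x hx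
      rw [hx]; rfl
    simp only [map_smul, smul_apply, smul_eq_mul, this]
    rw [← mul_assoc, ← Complex.ofReal_mul, Complex.re_ofReal_mul]
    ring
  have hmain : X ≤ M₀ * X ^ (1 - 1 / R) := by
    calc X = ∑ i ∈ s, H i ^ (R - 1) * (H i * ρ i ^ n) := by
          refine Finset.sum_congr rfl fun i _ => ?_
          rw [← mul_assoc, ← Real.rpow_add_one (hH i).ne']
          simp
      _ ≤ ∑ i ∈ s, C' * C * (B ((α i : ℂ) • (hψ i).toLp) ((β i : ℂ) • (hφ i).toLp)).re := by
          refine Finset.sum_le_sum fun i hi => ?_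
          rw [hB, hαβ]
          have h1 := htest i (hψ i).toLp (hψ i).coeFn_toLp
          have h2 := (hosc i hi).trans (mul_le_mul_of_nonneg_left h1 hC')
          have := mul_le_mul_of_nonneg_left h2 (Real.rpow_nonneg (hH i).le (R - 1))
          linarith
      _ ≤ C' * C * (‖B‖ * (D₁ * (V * X) ^ (1 / P)) * (D₂ * (V * X) ^ (1 / Q'))) := by
          rw [← Finset.mul_sum]
          refine mul_le_mul_of_nonneg_left (hsign.trans ?_) (by positivity)
          refine (Complex.re_le_norm _).trans ((B.le_opNorm₂ _ _).trans ?_)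
          have hD₁ : 0 ≤ D₁ := hD P hP0
          exact mul_le_mul (mul_le_mul_of_nonneg_left hn1 B.opNorm_nonneg) hn2 (norm_nonneg _)
            (by positivity)
      _ = C' * C * (‖B‖ * (D₁ * D₂ * ((V * X) ^ (1 / P) * (V * X) ^ (1 / Q')))) := by ring
      _ = M₀ * X ^ (1 - 1 / R) := by
          rw [← Real.rpow_add_of_nonneg (by positivity) (by positivity) (by positivity), hsum1,
            Real.mul_rpow hV hX0, hM₀]
          ring
  exact le_rpow_of_le_mul_rpow hX0 hM₀0 hR hmain

end CZCommutator

/-! ### Dyadic cubes. -/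

namespace CZCommutator

variable {n : ℕ}

/-- The index of the dyadic subcube of generation `j` of `[-L,L)ⁿ` (and its translates) that
contains `x`. -/
noncomputable def cubeIdx (L : ℝ) (j : ℕ) (x : Rn n) : Fin n → ℤ :=
  fun i => ⌊2 ^ j * (x i + L) / (2 * L)⌋

/-- The dyadic cube of generation `j` that contains `x`. -/
def cube (L : ℝ) (j : ℕ) (x : Rn n) : Set (Rn n) := {y | cubeIdx L j y = cubeIdx L j x}

/-- The side length of the dyadic cubes of generation `j`. -/
noncomputable def side (L : ℝ) (j : ℕ) : ℝ := 2 * L / 2 ^ j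

theorem side_pos {L : ℝ} (hL : 0 < L) (j : ℕ) : 0 < side L j := by
  unfold side; positivity

theorem mem_cube_self (L : ℝ) (j : ℕ) (x : Rn n) : x ∈ cube L j x := rfl

theorem cube_eq_of_mem {L : ℝ} {j : ℕ} {x y : Rn n} (h : y ∈ cube L j x) :
    cube L j y = cube L j x := by
  ext z
  simp only [cube, Set.mem_ofPred_eq] at h ⊢
  rw [h]

theorem cube_succ_subset (L : ℝ) (j : ℕ) (x : Rn n) : cube L (j + 1) x ⊆ cube L j x := by
  intro y hy
  -- The index of the parent is the integer quotient by two: `⌊t / 2⌋ = ⌊t⌋ / 2`.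
  have key : ∀ z : Rn n, ∀ i, cubeIdx L j z i = cubeIdx L (j + 1) z i / 2 := by
    intro z i
    simp only [cubeIdx]
    have : (2 : ℝ) ^ j * (z i + L) / (2 * L) = 2 ^ (j + 1) * (z i + L) / (2 * L) / ((2 : ℕ) : ℝ) := by
      rw [pow_succ]; push_cast; ring
    rw [this, Int.floor_div_natCast]
    rfl
  simp only [cube, Set.mem_ofPred_eq] at hy ⊢
  ext i
  rw [key, key, hy]

theorem cube_subset_of_le (L : ℝ) {i j : ℕ} (h : i ≤ j) (x : Rn n) : cube L j x ⊆ cube L i x := by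
  induction j, h using Nat.le_induction with
  | base => exact subset_rfl
  | succ k _ ih => exact (cube_succ_subset L k x).trans ih

theorem measurable_cubeIdx (L : ℝ) (j : ℕ) : Measurable (cubeIdx (n := n) L j) := by
  refine measurable_pi_iff.2 fun i => Int.measurable_floor.comp ?_
  fun_prop

theorem measurableSet_cube (L : ℝ) (j : ℕ) (x : Rn n) : MeasurableSet (cube L j x) :=
  measurable_cubeIdx L j (measurableSet_singleton (cubeIdx L j x))

theorem mem_cube_iff {L : ℝ} (hL : 0 < L) {j : ℕ} {x y : Rn n} :
    y ∈ cube L j x ↔ ∀ i, y i ∈ Set.Ico (cubeIdx L j x i * side L j - L)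
      ((cubeIdx L j x i + 1) * side L j - L) := by
  have hs := side_pos hL j
  have e : ∀ t : ℝ, 2 ^ j * (t + L) / (2 * L) = (t + L) / side L j := by
    intro t; unfold side; field_simp
  simp only [cube, Set.mem_ofPred_eq, funext_iff]
  refine forall_congr' fun i => ?_
  conv_lhs => lhs; rw [cubeIdx]
  rw [Int.floor_eq_iff, e, le_div_iff₀ hs, div_lt_iff₀ hs, Set.mem_Ico]
  constructor <;> rintro ⟨h1, h2⟩ <;> constructor <;> linarith

theorem volume_cube {L : ℝ} (hL : 0 < L) (j : ℕ) (x : Rn n) :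
    volume (cube L j x) = ENNReal.ofReal (side L j ^ n) := by
  have hs := side_pos hL j
  set S : Set (Fin n → ℝ) := Set.pi Set.univ fun i => Set.Ico (cubeIdx L j x i * side L j - L)
      ((cubeIdx L j x i + 1) * side L j - L)
  have h1 : cube L j x = (fun y : Rn n => (WithLp.ofLp y : Fin n → ℝ)) ⁻¹' S := by
    ext y
    rw [mem_cube_iff hL]
    simp [S]
  have h2 : MeasurableSet S := MeasurableSet.univ_pi fun i => measurableSet_Ico
  rw [h1, (PiLp.volume_preserving_ofLp (Fin n)).measure_preimage h2.nullMeasurableSet,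
    Real.volume_pi_Ico]
  simp only [sub_sub_sub_cancel_right, add_mul, one_mul, add_sub_cancel_left]
  rw [Finset.prod_const, ENNReal.ofReal_pow hs.le]
  simp

theorem cube_subset_closedBall {L : ℝ} (hL : 0 < L) (j : ℕ) (x : Rn n) :
    cube L j x ⊆ Metric.closedBall x (n * side L j) := by
  intro y hy
  have hs := side_pos hL j
  have hx := (mem_cube_iff hL).1 (mem_cube_self L j x)
  have hy := (mem_cube_iff hL).1 hy
  rw [Metric.mem_closedBall, EuclideanSpace.dist_eq]
  refine Real.sqrt_le_iff.2 ⟨by positivity, ?_⟩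
  have : ∀ i, dist (y i) (x i) ^ 2 ≤ side L j ^ 2 := by
    intro i
    have h1 := hx i
    have h2 := hy i
    refine pow_le_pow_left₀ dist_nonneg ?_ 2
    rw [Real.dist_eq, abs_le]
    constructor <;> linarith [h1.1, h1.2, h2.1, h2.2]
  calc ∑ i, dist (y i) (x i) ^ 2 ≤ ∑ _i : Fin n, side L j ^ 2 := Finset.sum_le_sum fun i _ => this i
    _ = n * side L j ^ 2 := by simp
    -- The radius uses `n` instead of `√n`, since `n ≤ n ^ 2` and constants are irrelevant.
    _ ≤ (n * side L j) ^ 2 := by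
      rw [mul_pow]
      gcongr
      rcases Nat.eq_zero_or_pos n with rfl | h
      · simp
      · have : (1 : ℝ) ≤ n := by exact_mod_cast h
        nlinarith

theorem tendsto_side (L : ℝ) : Tendsto (side L) atTop (𝓝 0) := by
  have : side L = fun j => 2 * L * (1 / 2 : ℝ) ^ j := by
    ext j; simp [side, div_eq_mul_inv]
  rw [this]
  simpa using (tendsto_pow_atTop_nhds_zero_of_lt_one (r := (1 / 2 : ℝ)) (by norm_num)
    (by norm_num)).const_mul (2 * L)

/-- Inequalities between measures of stopping cubes can be summed. -/
theorem measure_le_of_stopping {L : ℝ} {W : Set (Rn n)} {st : Rn n → ℕ}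
    (hW : ∀ x ∈ W, cube L (st x) x ⊆ W) (hst : ∀ x ∈ W, ∀ y ∈ cube L (st x) x, st y = st x)
    {μ₁ μ₂ : Measure (Rn n)} (h : ∀ x ∈ W, μ₁ (cube L (st x) x) ≤ μ₂ (cube L (st x) x)) :
    μ₁ W ≤ μ₂ W := by
  -- The label of the stopping cube of a point takes values in a countable type, and each nonempty
  -- fibre in `W` is exactly one stopping cube. This gives a countable measurable partition of `W`.
  let f : Rn n → ℕ × (Fin n → ℤ) := fun x => (st x, cubeIdx L (st x) x)
  let D : ℕ × (Fin n → ℤ) → Set (Rn n) := fun v => {x ∈ W | f x = v}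
  have hD : ∀ v, D v = ∅ ∨ ∃ x ∈ W, D v = cube L (st x) x := by
    intro v
    rcases (D v).eq_empty_or_nonempty with h0 | ⟨x, hxW, hxv⟩
    · exact Or.inl h0
    · refine Or.inr ⟨x, hxW, Set.ext fun y => ⟨?_, fun hy => ⟨hW x hxW hy, ?_⟩⟩⟩
      · rintro ⟨hyW, hyv⟩
        have h1 : f y = f x := hyv.trans hxv.symm
        have h2 : st y = st x := congrArg Prod.fst h1
        have h3 := congrArg Prod.snd h1
        simp only [f, h2] at h3
        exact h3
      · have h1 := hst x hxW y hy
        rw [← hxv]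
        simp only [f, h1]
        rw [show cubeIdx L (st x) y = cubeIdx L (st x) x from hy]
  have hDm : ∀ v, MeasurableSet (D v) := fun v => by
    rcases hD v with h0 | ⟨x, _, h0⟩ <;> rw [h0]
    · exact MeasurableSet.empty
    · exact measurableSet_cube _ _ _
  have hdisj : Pairwise (Function.onFun Disjoint D) := fun v w hvw =>
    Set.disjoint_left.2 fun x hx hx' => hvw (hx.2.symm.trans hx'.2)
  have hWD : W = ⋃ v, D v := by
    ext x
    simp [D]
  rw [hWD, measure_iUnion hdisj hDm, measure_iUnion hdisj hDm]
  refine ENNReal.tsum_le_tsum fun v => ?_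
  rcases hD v with h0 | ⟨x, hx, h0⟩ <;> rw [h0]
  · simp
  · exact h x hx

end CZCommutator

/-! ### Stopping cubes and the good-λ inequality. -/

namespace CZCommutator

variable {n : ℕ}

/-- The average of `‖g‖` over the dyadic cube of generation `j` that contains `x` exceeds `h`. -/
def AvgGT (g : Rn n → ℂ) (L h : ℝ) (j : ℕ) (x : Rn n) : Prop :=
  ENNReal.ofReal (h * side L j ^ n) < ∫⁻ y in cube L j x, ‖g y‖ₑ

/-- The points of `[-L,L)ⁿ` where the dyadic maximal function of `g` exceeds `h`. -/
def levelSet (g : Rn n → ℂ) (L h : ℝ) : Set (Rn n) := {x ∈ cube L 0 0 | ∃ j, AvgGT g L h j x}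

/-- The generation of the largest dyadic cube around `x` on which the average exceeds `h`. -/
noncomputable def stopGen (g : Rn n → ℂ) (L h : ℝ) (x : Rn n) : ℕ := sInf {j | AvgGT g L h j x}

/-- The stopping cube of `x` at height `h`. -/
noncomputable def stopCube (g : Rn n → ℂ) (L h : ℝ) (x : Rn n) : Set (Rn n) :=
  cube L (stopGen g L h x) x

/-- The part of the level set that is covered by stopping cubes with a large oscillation. -/
def badSet (g : Rn n → ℂ) (L h θ : ℝ) : Set (Rn n) :=
  {x ∈ levelSet g L h | ENNReal.ofReal (θ * 2 ^ n * h * side L (stopGen g L h x) ^ n) <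
    ∫⁻ y in stopCube g L h x, ‖g y - ⨍ z in stopCube g L h x, g z‖ₑ}

section

variable {g : Rn n → ℂ} {L h h' : ℝ}

theorem avgGT_congr {j : ℕ} {x y : Rn n} (hy : y ∈ cube L j x) :
    AvgGT g L h j y ↔ AvgGT g L h j x := by
  unfold AvgGT; rw [cube_eq_of_mem hy]

theorem AvgGT.mono {j : ℕ} {x : Rn n} (hL : 0 < L) (hh : h ≤ h') (H : AvgGT g L h' j x) :
    AvgGT g L h j x := by
  refine lt_of_le_of_lt (ENNReal.ofReal_le_ofReal ?_) H
  have := side_pos hL j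
  gcongr

theorem levelSet_mono (hL : 0 < L) (hh : h ≤ h') : levelSet g L h' ⊆ levelSet g L h :=
  fun _ hx => ⟨hx.1, hx.2.imp fun _ H => H.mono hL hh⟩

theorem avgGT_stopGen {x : Rn n} (hx : x ∈ levelSet g L h) : AvgGT g L h (stopGen g L h x) x :=
  Nat.sInf_mem (s := {j | AvgGT g L h j x}) hx.2

theorem stopGen_le {j : ℕ} {x : Rn n} (H : AvgGT g L h j x) : stopGen g L h x ≤ j :=
  Nat.sInf_le (s := {j | AvgGT g L h j x}) H

theorem mem_levelSet_of_mem_stopCube {x y : Rn n} (hx : x ∈ levelSet g L h)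
    (hy : y ∈ stopCube g L h x) : y ∈ levelSet g L h := by
  refine ⟨?_, _, (avgGT_congr hy).2 (avgGT_stopGen hx)⟩
  have h1 := cube_subset_of_le L (Nat.zero_le _) x hy
  rwa [cube_eq_of_mem hx.1] at h1

theorem stopGen_eq_of_mem_stopCube {x y : Rn n} (hx : x ∈ levelSet g L h)
    (hy : y ∈ stopCube g L h x) : stopGen g L h y = stopGen g L h x := by
  apply le_antisymm
  · exact stopGen_le ((avgGT_congr hy).2 (avgGT_stopGen hx))
  · by_contra hlt
    push Not at hlt
    have h1 := avgGT_stopGen (mem_levelSet_of_mem_stopCube hx hy)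
    have h2 : AvgGT g L h (stopGen g L h y) x := by
      refine (avgGT_congr ?_).1 h1
      exact cube_subset_of_le L hlt.le x hy
    exact absurd (stopGen_le h2) (not_le.2 hlt)

theorem stopCube_eq_of_mem {x y : Rn n} (hx : x ∈ levelSet g L h)
    (hy : y ∈ stopCube g L h x) : stopCube g L h y = stopCube g L h x := by
  unfold stopCube
  rw [stopGen_eq_of_mem_stopCube hx hy]
  exact cube_eq_of_mem hy

theorem stopCube_subset (hL : 0 < L) (hh : h ≤ h') {x : Rn n} (hx : x ∈ levelSet g L h') :
    stopCube g L h' x ⊆ stopCube g L h x :=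
  cube_subset_of_le L (stopGen_le ((avgGT_stopGen hx).mono hL hh)) x

theorem measurableSet_levelSet : MeasurableSet (levelSet g L h) := by
  refine (measurableSet_cube L 0 0).inter ?_
  have : {x : Rn n | ∃ j, AvgGT g L h j x} = ⋃ j, {x | AvgGT g L h j x} := by ext; simp
  show MeasurableSet {x : Rn n | ∃ j, AvgGT g L h j x}
  rw [this]
  refine MeasurableSet.iUnion fun j => ?_
  -- The condition is constant on cubes of generation `j`, so the set is the preimage of a set of
  -- indices, and every such set is measurable.
  have : {x : Rn n | AvgGT g L h j x} = cubeIdx L j ⁻¹' (cubeIdx L j '' {x | AvgGT g L h j x}) := by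
    refine Set.Subset.antisymm (Set.subset_preimage_image _ _) ?_
    rintro y ⟨x, hx, hxy⟩
    exact (avgGT_congr (show y ∈ cube L j x from hxy.symm)).2 hx
  rw [this]
  exact measurable_cubeIdx L j MeasurableSet.of_discrete

theorem levelSet_subset : levelSet g L h ⊆ cube L 0 0 := fun _ hx => hx.1

/-- On the part of a higher level set in a stopping cube, the average is at least the height. -/
theorem ofReal_mul_volume_levelSet_inter_le (hL : 0 < L) (hh : h ≤ h') (hh'0 : 0 ≤ h') {x : Rn n}
    (hx : x ∈ levelSet g L h) :
    ENNReal.ofReal h' * volume (levelSet g L h' ∩ stopCube g L h x) ≤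
      ∫⁻ y in levelSet g L h' ∩ stopCube g L h x, ‖g y‖ₑ := by
  have hm : MeasurableSet (levelSet g L h' ∩ stopCube g L h x) :=
    measurableSet_levelSet.inter (measurableSet_cube _ _ _)
  -- The stopping cubes at the higher level `h'` are nested in those at level `h`, so they partition
  -- the intersection; on each of them the inequality is the stopping condition.
  have := measure_le_of_stopping (L := L) (W := levelSet g L h' ∩ stopCube g L h x)
    (st := stopGen g L h') (μ₁ := ENNReal.ofReal h' • volume)
    (μ₂ := volume.withDensity fun y => ‖g y‖ₑ) ?_ ?_ ?_
  · rwa [withDensity_apply _ hm] at this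
  · rintro z ⟨hz, hz'⟩ y hy
    refine ⟨mem_levelSet_of_mem_stopCube hz hy, ?_⟩
    rw [← stopCube_eq_of_mem hx hz']
    exact stopCube_subset hL hh hz hy
  · rintro z ⟨hz, _⟩ y hy
    exact stopGen_eq_of_mem_stopCube hz hy
  · rintro z ⟨hz, _⟩
    rw [withDensity_apply _ (measurableSet_cube _ _ _)]
    refine le_trans (le_of_eq ?_) (avgGT_stopGen hz).le
    rw [Measure.smul_apply, smul_eq_mul, volume_cube hL, ← ENNReal.ofReal_mul hh'0]

end

theorem integrableOn_cube {g : Rn n → ℂ} {L : ℝ} (hL : 0 < L) (hg : LocallyIntegrable g volume)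
    (j : ℕ) (x : Rn n) : IntegrableOn g (cube L j x) volume :=
  (hg.integrableOn_isCompact (isCompact_closedBall x (n * side L j))).mono_set
    (cube_subset_closedBall hL j x)

section

variable {g : Rn n → ℂ} {L h : ℝ}

/-- The average over a stopping cube is controlled by the average over its parent. -/
theorem enorm_average_stopCube_le (hL : 0 < L) (hh : 0 < h) {x : Rn n} (hx : x ∈ levelSet g L h)
    (h0 : ¬ AvgGT g L h 0 x) :
    ‖⨍ z in stopCube g L h x, g z‖ₑ ≤ ENNReal.ofReal (2 ^ n * h) := by
  set j := stopGen g L h x with hj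
  have hj0 : j ≠ 0 := by
    intro h1
    have := avgGT_stopGen hx
    rw [← hj, h1] at this
    exact h0 this
  obtain ⟨i, hi⟩ := Nat.exists_eq_succ_of_ne_zero hj0
  -- By minimality the parent was not selected; it exists because the root cube was not selected
  -- either. Its volume is `2 ^ n` times larger, which gives the factor in the bound.
  have hni : ¬ AvgGT g L h i x := fun H => by
    have := stopGen_le H
    omega
  have hle : ∫⁻ y in stopCube g L h x, ‖g y‖ₑ ≤ ENNReal.ofReal (2 ^ n * h * side L j ^ n) := by
    have h1 : ∫⁻ y in cube L i x, ‖g y‖ₑ ≤ ENNReal.ofReal (h * side L i ^ n) := not_lt.1 hni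
    have h2 : side L i = 2 * side L j := by
      rw [hi]; unfold side; rw [Nat.succ_eq_add_one, pow_succ]; field_simp
    calc ∫⁻ y in stopCube g L h x, ‖g y‖ₑ ≤ ∫⁻ y in cube L i x, ‖g y‖ₑ :=
          lintegral_mono_set (cube_subset_of_le L (by omega) x)
      _ ≤ _ := h1
      _ = _ := by rw [h2, mul_pow]; ring_nf
  have hs := side_pos hL j
  have hvol : volume.real (stopCube g L h x) = side L j ^ n := by
    rw [Measure.real, stopCube, volume_cube hL, ENNReal.toReal_ofReal (by positivity)]
  rw [setAverage_eq, hvol, enorm_smul]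
  have h3 : ‖(side L j ^ n)⁻¹‖ₑ = ENNReal.ofReal ((side L j ^ n)⁻¹) := by
    rw [Real.enorm_eq_ofReal (by positivity)]
  rw [h3]
  calc _ ≤ ENNReal.ofReal ((side L j ^ n)⁻¹) * ENNReal.ofReal (2 ^ n * h * side L j ^ n) := by
        gcongr
        exact (enorm_integral_le_lintegral_enorm _).trans hle
    _ = _ := by
        rw [← ENNReal.ofReal_mul (by positivity)]
        congr 1
        field_simp

/-- In a stopping cube with small oscillation, the next level set occupies a small portion. -/
theorem volume_levelSet_inter_stopCube_le (hL : 0 < L) (hh : 0 < h)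
    {θ : ℝ} (hθ : 0 ≤ θ) {x : Rn n}
    (hx : x ∈ levelSet g L h) (hxb : x ∉ badSet g L h θ) (h0 : ¬ AvgGT g L h 0 x) :
    volume (levelSet g L (h * 2 ^ (n + 1)) ∩ stopCube g L h x) ≤
      ENNReal.ofReal θ * volume (stopCube g L h x) := by
  set E := levelSet g L (h * 2 ^ (n + 1)) ∩ stopCube g L h x with hE
  set m := ⨍ z in stopCube g L h x, g z with hm
  have hpow : (1 : ℝ) ≤ 2 ^ (n + 1) := one_le_pow₀ (by norm_num)
  have hsm : MeasurableSet (stopCube g L h x) := measurableSet_cube _ _ _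
  have hEm : MeasurableSet E := measurableSet_levelSet.inter hsm
  have hs := side_pos hL (stopGen g L h x)
  have hvol : volume (stopCube g L h x) = ENNReal.ofReal (side L (stopGen g L h x) ^ n) := by
    rw [stopCube, volume_cube hL]
  have hEf : volume E ≠ ∞ := by
    refine ((measure_mono Set.inter_subset_right).trans_lt ?_).ne
    rw [hvol]; exact ENNReal.ofReal_lt_top
  have h1 := ofReal_mul_volume_levelSet_inter_le (g := g) (h' := h * 2 ^ (n + 1)) hL
    (by nlinarith) (by positivity) hx
  rw [← hE] at h1
  have hbad : ∫⁻ y in stopCube g L h x, ‖g y - m‖ₑ ≤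
      ENNReal.ofReal (θ * 2 ^ n * h * side L (stopGen g L h x) ^ n) := by
    by_contra hlt
    exact hxb ⟨hx, not_le.1 hlt⟩
  have h2 : ∫⁻ y in E, ‖g y‖ₑ ≤ ENNReal.ofReal (θ * 2 ^ n * h * side L (stopGen g L h x) ^ n) +
      ENNReal.ofReal (2 ^ n * h) * volume E := by
    calc ∫⁻ y in E, ‖g y‖ₑ ≤ ∫⁻ y in E, (‖g y - m‖ₑ + ENNReal.ofReal (2 ^ n * h)) := by
          refine lintegral_mono fun y => ?_
          calc ‖g y‖ₑ = ‖(g y - m) + m‖ₑ := by rw [sub_add_cancel]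
            _ ≤ ‖g y - m‖ₑ + ‖m‖ₑ := enorm_add_le _ _
            _ ≤ _ := by
              gcongr
              exact enorm_average_stopCube_le hL hh hx h0
      _ = (∫⁻ y in E, ‖g y - m‖ₑ) + ENNReal.ofReal (2 ^ n * h) * volume E := by
          rw [lintegral_add_right _ measurable_const, setLIntegral_const]
      _ ≤ _ := by
          gcongr
          exact (lintegral_mono_set Set.inter_subset_right).trans hbad
  have h3 := h1.trans h2
  rw [hvol]
  have hEr : volume E = ENNReal.ofReal (volume E).toReal := (ENNReal.ofReal_toReal hEf).symm
  rw [hEr] at h3 ⊢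
  set v := (volume E).toReal
  have hv : 0 ≤ v := ENNReal.toReal_nonneg
  rw [← ENNReal.ofReal_mul (by positivity), ← ENNReal.ofReal_mul (by positivity),
    ← ENNReal.ofReal_add (by positivity) (by positivity),
    ENNReal.ofReal_le_ofReal_iff (by positivity)] at h3
  rw [← ENNReal.ofReal_mul hθ]
  refine ENNReal.ofReal_le_ofReal ?_
  -- The next height is twice `2 ^ n * h`, the bound for the average over the stopping cube: half of
  -- the left side of `h3` absorbs the average, and the other half is left against the oscillation.
  have h4 : 2 ^ n * h * v ≤ 2 ^ n * h * (θ * side L (stopGen g L h x) ^ n) := by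
    rw [pow_succ] at h3
    nlinarith
  exact le_of_mul_le_mul_left h4 (by positivity)

/-- The good-λ inequality: stopping cubes of small oscillation keep only a fraction `θ` in the next
level set, and the bad ones are counted in full. The hypothesis on the root cube guarantees that
every stopping cube has a parent. -/
theorem volume_levelSet_le (hL : 0 < L) (hh : 0 < h)
    {θ : ℝ} (hθ : 0 ≤ θ) (h0 : ∀ x ∈ cube L 0 0, ¬ AvgGT g L h 0 x) :
    volume (levelSet g L (h * 2 ^ (n + 1))) ≤
      ENNReal.ofReal θ * volume (levelSet g L h) + volume (badSet g L h θ) := by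
  have hpow : (1 : ℝ) ≤ 2 ^ (n + 1) := one_le_pow₀ (by norm_num)
  set U' := levelSet g L (h * 2 ^ (n + 1))
  have hU' : U' ⊆ levelSet g L h := levelSet_mono hL (by nlinarith)
  have key : (volume.restrict U') (levelSet g L h \ badSet g L h θ) ≤
      (ENNReal.ofReal θ • volume) (levelSet g L h \ badSet g L h θ) := by
    refine measure_le_of_stopping (L := L) (st := stopGen g L h) ?_ ?_ ?_
    -- Being bad is a property of the stopping cube, so the good part is again a union of stopping
    -- cubes.
    · rintro x ⟨hx, hxb⟩ y hy
      have hy' := mem_levelSet_of_mem_stopCube hx hy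
      refine ⟨hy', fun hyb => hxb ⟨hx, ?_⟩⟩
      have := hyb.2
      rwa [stopCube_eq_of_mem hx hy, stopGen_eq_of_mem_stopCube hx hy] at this
    · rintro x ⟨hx, _⟩ y hy
      exact stopGen_eq_of_mem_stopCube hx hy
    · rintro x ⟨hx, hxb⟩
      rw [Measure.restrict_apply (measurableSet_cube _ _ _), Set.inter_comm]
      exact volume_levelSet_inter_stopCube_le hL hh hθ hx hxb (h0 x hx.1)
  calc volume U' ≤ volume ((levelSet g L h \ badSet g L h θ) ∩ U' ∪ badSet g L h θ) := by
        refine measure_mono fun x hx => ?_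
        by_cases hxb : x ∈ badSet g L h θ
        · exact Or.inr hxb
        · exact Or.inl ⟨⟨hU' hx, hxb⟩, hx⟩
    _ ≤ volume ((levelSet g L h \ badSet g L h θ) ∩ U') + volume (badSet g L h θ) :=
        measure_union_le _ _
    _ ≤ _ := by
        gcongr
        refine (Measure.le_restrict_apply _ _).trans (key.trans ?_)
        rw [Measure.smul_apply, smul_eq_mul]
        gcongr
        exact Set.sdiff_subset

end

end CZCommutator

/-! ### From bad cubes to disjoint balls, and Lebesgue differentiation. -/

namespace CZCommutator

variable {n : ℕ}

/-- The deviation from the average over `E` is at most twice the deviation from any constant. -/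
theorem lintegral_enorm_sub_average_le {f : Rn n → ℂ} {E : Set (Rn n)} (hE : volume E ≠ 0)
    (hEf : volume E ≠ ∞) (hf : IntegrableOn f E volume) (a : ℂ) :
    ∫⁻ y in E, ‖f y - ⨍ z in E, f z‖ₑ ≤ 2 * ∫⁻ y in E, ‖f y - a‖ₑ := by
  have hr : volume.real E ≠ 0 := (ENNReal.toReal_pos hE hEf).ne'
  have h1 : a - ⨍ z in E, f z = -((volume.real E)⁻¹ • ∫ z in E, (f z - a)) := by
    rw [integral_sub hf (integrableOn_const hEf), setAverage_eq, smul_sub, setIntegral_const,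
      smul_smul, inv_mul_cancel₀ hr, one_smul]
    ring
  have h2 : ‖a - ⨍ z in E, f z‖ₑ * volume E ≤ ∫⁻ y in E, ‖f y - a‖ₑ := by
    rw [h1, enorm_neg, enorm_smul, Real.enorm_eq_ofReal (by positivity)]
    calc _ ≤ ENNReal.ofReal (volume.real E)⁻¹ * (∫⁻ y in E, ‖f y - a‖ₑ) * volume E := by
          gcongr; exact enorm_integral_le_lintegral_enorm _
      _ = (ENNReal.ofReal (volume.real E)⁻¹ * volume E) * ∫⁻ y in E, ‖f y - a‖ₑ := by ring
      _ ≤ _ := by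
          rw [ENNReal.ofReal_inv_of_pos (show 0 < volume.real E from ENNReal.toReal_pos hE hEf),
            ofReal_measureReal hEf, ENNReal.inv_mul_cancel hE hEf, one_mul]
  calc _ ≤ ∫⁻ y in E, (‖f y - a‖ₑ + ‖a - ⨍ z in E, f z‖ₑ) := by
        refine lintegral_mono fun y => ?_
        refine le_trans (le_of_eq ?_) (enorm_add_le _ _)
        rw [sub_add_sub_cancel]
    _ = (∫⁻ y in E, ‖f y - a‖ₑ) + ‖a - ⨍ z in E, f z‖ₑ * volume E := by
        rw [lintegral_add_right _ measurable_const, setLIntegral_const]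
    _ ≤ _ := by rw [two_mul]; gcongr

/-- Subtracting a constant does not change the oscillation. The cube lies in a ball of radius `n *
side`; comparison with the average over that ball costs a factor two. -/
theorem lintegral_cube_sub_average_le {b : Rn n → ℂ} (hb : LocallyIntegrable b volume) {L : ℝ}
    (hL : 0 < L) (j : ℕ) (x : Rn n) (a : ℂ) :
    ∫⁻ y in cube L j x, ‖(b y - a) - ⨍ z in cube L j x, (b z - a)‖ₑ ≤
      ENNReal.ofReal (2 * oscBall b x (n * side L j)) := by
  have hs := side_pos hL j
  set m := ⨍ y in Metric.closedBall x (n * side L j), b y with hm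
  have hv : volume (cube L j x) ≠ 0 := by
    rw [volume_cube hL]; simpa using by positivity
  have hvf : volume (cube L j x) ≠ ∞ := by
    rw [volume_cube hL]; exact ENNReal.ofReal_ne_top
  have hbi := hb.integrableOn_isCompact (isCompact_closedBall x (n * side L j))
  have hint : IntegrableOn (fun y => b y - m) (Metric.closedBall x (n * side L j)) volume :=
    hbi.sub (integrableOn_const measure_closedBall_lt_top.ne)
  refine (lintegral_enorm_sub_average_le (f := fun y => b y - a) hv hvf
    ((integrableOn_cube hL hb j x).sub (integrableOn_const hvf)) (m - a)).trans ?_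
  rw [ENNReal.ofReal_mul (by norm_num), oscBall, ← hm,
    ofReal_integral_norm_eq_lintegral_enorm hint]
  simp only [sub_sub_sub_cancel_right, ENNReal.ofReal_ofNat]
  gcongr
  exact cube_subset_closedBall hL j x

theorem oscBall_nonneg (b : Rn n → ℂ) (c : Rn n) (ρ : ℝ) : 0 ≤ oscBall b c ρ :=
  integral_nonneg fun _ => norm_nonneg _

/-- Translates badness of a cube into the oscillation hypothesis for balls of radius `n * side`. The
factor `n ^ n` converts `side ^ n` into `ρ ^ n`, and `θ * 2 ^ n` comes from the threshold in
`badSet`. -/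
theorem le_oscBall_of_mem_badSet {b : Rn n → ℂ} (hb : LocallyIntegrable b volume) {L h θ : ℝ}
    (hL : 0 < L) (hθ : 0 < θ) {a : ℂ} {x : Rn n}
    (hx : x ∈ badSet (fun y => b y - a) L h θ) :
    h * (n * side L (stopGen (fun y => b y - a) L h x)) ^ n ≤ 2 * n ^ n / (θ * 2 ^ n) *
      oscBall b x (n * side L (stopGen (fun y => b y - a) L h x)) := by
  set s := side L (stopGen (fun y => b y - a) L h x)
  have h1 := (hx.2.le.trans (lintegral_cube_sub_average_le hb hL _ x a))
  rw [ENNReal.ofReal_le_ofReal_iff (by have := oscBall_nonneg b x (n * s); positivity)] at h1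
  rw [div_mul_eq_mul_div, le_div_iff₀ (by positivity), mul_pow]
  have h2 : (0 : ℝ) ≤ n ^ n := by positivity
  change θ * 2 ^ n * h * s ^ n ≤ 2 * oscBall b x (n * s) at h1
  nlinarith [mul_le_mul_of_nonneg_left h1 h2]

/-- A Vitali cover of the bad set. -/
theorem exists_vitali_badSet (hn : 0 < n) {g : Rn n → ℂ} {L h θ A : ℝ} (hL : 0 < L) (hA : 0 < A) :
    ∃ u ⊆ badSet g L h θ,
      (u.PairwiseDisjoint fun x => Metric.closedBall x (A * (n * side L (stopGen g L h x)))) ∧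
      volume (badSet g L h θ) ≤ ∑' x : u, ENNReal.ofReal ((5 * A) ^ n *
        volume.real (Metric.closedBall (0 : Rn n) 1) * (n * side L (stopGen g L h x)) ^ n) := by
  have hn' : (0 : ℝ) < n := by exact_mod_cast hn
  have hside : ∀ j, side L j ≤ side L 0 := fun j => by
    unfold side
    gcongr
    · norm_num
    · exact Nat.zero_le j
  obtain ⟨u, hu, hd, hc⟩ := Vitali.exists_disjoint_subfamily_covering_enlargement_closedBall
    (badSet g L h θ) (fun x : Rn n => x) (fun x => A * (n * side L (stopGen g L h x)))
    (A * (n * side L 0)) (fun x _ => by have := hside (stopGen g L h x); gcongr) 5 (by norm_num)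
  have hpos : ∀ x : Rn n, 0 < A * (n * side L (stopGen g L h x)) := fun x => by
    have := side_pos hL (stopGen g L h x); positivity
  -- The selected balls are pairwise disjoint with nonempty interior in a separable space.
  have hcount : u.Countable := by
    refine hd.countable_of_nonempty_interior fun x _ => ⟨x, ?_⟩
    exact Metric.ball_subset_interior_closedBall (Metric.mem_ball_self (hpos x))
  refine ⟨u, hu, hd, ?_⟩
  have := hcount.to_subtype
  calc volume (badSet g L h θ)
      ≤ volume (⋃ x : u, Metric.closedBall (x : Rn n) (5 * (A * (n * side L (stopGen g L h x))))) := by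
        refine measure_mono fun x hx => ?_
        obtain ⟨y, hy, hxy⟩ := hc x hx
        exact Set.mem_iUnion.2 ⟨⟨y, hy⟩, hxy (Metric.mem_closedBall_self (hpos x).le)⟩
    _ ≤ ∑' x : u, volume (Metric.closedBall (x : Rn n) (5 * (A * (n * side L (stopGen g L h x))))) :=
        measure_iUnion_le _
    _ = _ := by
        refine tsum_congr fun x => ?_
        rw [← ofReal_measureReal measure_closedBall_lt_top.ne,
          volume_real_closedBall _ (by have := hpos x; positivity)]
        congr 1; ring

/-- Almost every point where `‖g‖` exceeds `h` lies in the level set. -/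
theorem ae_mem_levelSet (hn : 0 < n) {g : Rn n → ℂ} (hg : LocallyIntegrable g volume) {L : ℝ}
    (hL : 0 < L) :
    ∀ᵐ x, x ∈ cube L 0 0 → ∀ h : ℝ, 0 ≤ h → h < ‖g x‖ → x ∈ levelSet g L h := by
  have hn' : (0 : ℝ) < n := by exact_mod_cast hn
  filter_upwards [IsUnifLocDoublingMeasure.ae_tendsto_average_norm_sub volume hg 1] with x hx hx0 h h0 hh
  refine ⟨hx0, ?_⟩
  set ω := volume.real (Metric.closedBall (0 : Rn n) 1)
  have hlim := hx (l := atTop) (fun _ : ℕ => x) (fun j => n * side L j)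
    (tendsto_nhdsWithin_iff.2 ⟨by simpa using (tendsto_side L).const_mul (n : ℝ),
      Eventually.of_forall fun j => by
        have := side_pos hL j
        exact Set.mem_Ioi.2 (by positivity)⟩)
    (Eventually.of_forall fun j => Metric.mem_closedBall_self (by
        have := side_pos hL j
        positivity))
  -- `n ^ n * ω` is the ratio of the volumes of the ball and of the cube inside it, so the deviation
  -- averaged over the cubes tends to zero as well.
  have hlim2 := hlim.const_mul (n ^ n * ω)
  rw [mul_zero] at hlim2
  obtain ⟨j, hj⟩ := ((tendsto_order.1 hlim2).2 (‖g x‖ - h) (by linarith)).exists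
  refine ⟨j, ?_⟩
  have hs := side_pos hL j
  have hsn : 0 < side L j ^ n := by positivity
  set B := Metric.closedBall x (n * side L j)
  have hgB := hg.integrableOn_isCompact (isCompact_closedBall x (n * side L j))
  have hgB' : IntegrableOn (fun y => g y - g x) B volume :=
    hgB.sub (integrableOn_const measure_closedBall_lt_top.ne)
  have hB : volume.real B = (n * side L j) ^ n * ω := volume_real_closedBall _ (by positivity)
  have hω : 0 < ω := ENNReal.toReal_pos (Metric.measure_closedBall_pos _ _ one_pos).ne'
    measure_closedBall_lt_top.ne
  have hgQ := integrableOn_cube hL hg j x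
  have hvQ : volume.real (cube L j x) = side L j ^ n := by
    rw [Measure.real, volume_cube hL, ENNReal.toReal_ofReal hsn.le]
  have hvf : volume (cube L j x) ≠ ∞ := by rw [volume_cube hL]; exact ENNReal.ofReal_ne_top
  have h1 : ∫ y in cube L j x, ‖g y - g x‖ < side L j ^ n * (‖g x‖ - h) := by
    calc ∫ y in cube L j x, ‖g y - g x‖ ≤ ∫ y in B, ‖g y - g x‖ :=
          setIntegral_mono_set hgB'.norm (ae_of_all _ fun _ => norm_nonneg _)
            (cube_subset_closedBall hL j x).eventuallyLE
      _ = side L j ^ n * (n ^ n * ω * ⨍ y in B, ‖g y - g x‖) := by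
          rw [setAverage_eq, hB, smul_eq_mul]
          field_simp
          rw [mul_pow]; ring
      _ < _ := by gcongr
  have h2 : side L j ^ n * ‖g x‖ ≤
      (∫ y in cube L j x, ‖g y‖) + ∫ y in cube L j x, ‖g y - g x‖ := by
    rw [← integral_add hgQ.norm ((hgB'.mono_set (cube_subset_closedBall hL j x)).norm), ← hvQ,
      ← smul_eq_mul, ← setIntegral_const]
    refine integral_mono (integrableOn_const hvf)
      (hgQ.norm.add ((hgB'.mono_set (cube_subset_closedBall hL j x)).norm)) fun y => ?_
    have := norm_sub_le (g y) (g y - g x)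
    simpa using this
  unfold AvgGT
  rw [← ofReal_integral_norm_eq_lintegral_enorm hgQ, ENNReal.ofReal_lt_ofReal_iff']
  have : h * side L j ^ n < ∫ y in cube L j x, ‖g y‖ := by nlinarith
  exact ⟨this, lt_of_le_of_lt (by positivity) this⟩

end CZCommutator

/-! ### Summation over the levels and absorption. -/

namespace CZCommutator

variable {n : ℕ}

/-- The sums over families of balls, disjoint at equal level, on which `b` oscillates by at least
the level are bounded by `M`. -/
def LevelSumBound (b : Rn n → ℂ) (A c₀ C' R M : ℝ) : Prop :=
  ∀ {ι : Type} (s : Finset ι) (c : ι → Rn n) (ρ : ι → ℝ) (κ : ι → ℕ)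
    (h : ℝ), 0 < h → (∀ i, 0 < ρ i) →
    (∀ i ∈ s, ∀ j ∈ s, i ≠ j → κ i = κ j →
      Disjoint (Metric.closedBall (c i) (A * ρ i)) (Metric.closedBall (c j) (A * ρ j))) →
    (∀ i ∈ s, h * c₀ ^ κ i * ρ i ^ n ≤ C' * oscBall b (c i) (ρ i)) →
    ∑ i ∈ s, (h * c₀ ^ κ i) ^ R * ρ i ^ n ≤ M

theorem LevelSumBound.nonneg {b : Rn n → ℂ} {A c₀ C' R M : ℝ} (H : LevelSumBound b A c₀ C' R M) :
    0 ≤ M := by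
  simpa using H (ι := Unit) ∅ (fun _ => 0) (fun _ => 1) (fun _ => 0) 1 one_pos
    (fun _ => one_pos) (by simp) (by simp)

/-- The Vitali families of all levels are pooled into one family indexed by pairs of a level and a
point. `LevelSumBound` asks for disjointness at equal level only, which is just what the separate
Vitali selections provide. -/
theorem LevelSumBound.tsum_badSet_le (hn : 0 < n) {b : Rn n → ℂ} (hb : LocallyIntegrable b volume)
    {A c₀ θ R M L h₀ : ℝ} (hA : 0 < A) (hc₀ : 0 < c₀) (hθ : 0 < θ)
    (H : LevelSumBound b A c₀ (2 * n ^ n / (θ * 2 ^ n)) R M) (hL : 0 < L) (hh₀ : 0 < h₀) (a : ℂ) :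
    ∑' k : ℕ, ENNReal.ofReal ((h₀ * c₀ ^ k) ^ R) *
      volume (badSet (fun y => b y - a) L (h₀ * c₀ ^ k) θ) ≤
      ENNReal.ofReal ((5 * A) ^ n * volume.real (Metric.closedBall (0 : Rn n) 1) * M) := by
  have hn' : (0 : ℝ) < n := by exact_mod_cast hn
  set g : Rn n → ℂ := fun y => b y - a
  set W := (5 * A) ^ n * volume.real (Metric.closedBall (0 : Rn n) 1)
  have hW : 0 ≤ W := by positivity
  choose u hu hd hv using fun k : ℕ =>
    exists_vitali_badSet hn (g := g) (L := L) (h := h₀ * c₀ ^ k) (θ := θ) (A := A) hL hA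
  let ρ : (Σ k, u k) → ℝ := fun i => n * side L (stopGen g L (h₀ * c₀ ^ i.1) i.2)
  have hρ : ∀ i, 0 < ρ i := fun i => by
    have := side_pos hL (stopGen g L (h₀ * c₀ ^ i.1) i.2)
    positivity
  calc _ ≤ ∑' k : ℕ, ENNReal.ofReal ((h₀ * c₀ ^ k) ^ R) *
        ∑' x : u k, ENNReal.ofReal (W * (ρ ⟨k, x⟩) ^ n) :=
        ENNReal.tsum_le_tsum fun k => by gcongr; exact hv k
    _ = ∑' i : (Σ k, u k), ENNReal.ofReal (W * ((h₀ * c₀ ^ i.1) ^ R * ρ i ^ n)) := by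
        rw [ENNReal.tsum_sigma']
        refine tsum_congr fun k => ?_
        rw [← ENNReal.tsum_mul_left]
        refine tsum_congr fun x => ?_
        rw [← ENNReal.ofReal_mul (by positivity)]
        congr 1; ring
    _ ≤ _ := by
        rw [ENNReal.tsum_eq_iSup_sum]
        refine iSup_le fun s => ?_
        rw [← ENNReal.ofReal_sum_of_nonneg (fun i _ => by have := hρ i; positivity),
          ← Finset.mul_sum]
        refine ENNReal.ofReal_le_ofReal (mul_le_mul_of_nonneg_left ?_ hW)
        refine H s (fun i => i.2) ρ (fun i => i.1) h₀ hh₀ hρ ?_ ?_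
        · rintro ⟨k, x⟩ _ ⟨l, y⟩ _ hij hkl
          obtain rfl : k = l := hkl
          refine hd k x.2 y.2 fun hxy => hij ?_
          rw [Subtype.ext hxy]
        · rintro ⟨k, x⟩ _
          exact le_oscBall_of_mem_badSet hb hL hθ (hu k x.2)

/-- Absorption: a recursive inequality with a small factor bounds a weighted sum. -/
theorem tsum_le_of_recursive {U V H : ℕ → ℝ≥0∞} {t G B : ℝ≥0∞} (hU : ∀ k, U k ≠ ∞)
    (hH : ∀ k, H k ≠ ∞) (hrec : ∀ k, U (k + 1) ≤ t * U k + V k) (hHs : ∀ k, H (k + 1) = G * H k)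
    (htG : G * t ≤ 2⁻¹) (hB : ∑' k, H k * V k ≤ B) :
    ∑' k, H k * U k ≤ 2 * (H 0 * U 0 + G * B) := by
  rw [ENNReal.tsum_eq_iSup_nat]
  refine iSup_le fun N => ?_
  set X := ∑ k ∈ Finset.range N, H k * U k
  -- Absorption subtracts half of `X`, which needs a finite quantity; this is why partial sums are
  -- treated.
  have hX : X ≠ ∞ := (ENNReal.sum_lt_top.2 fun k _ =>
    ENNReal.mul_lt_top (hH k).lt_top (hU k).lt_top).ne
  have h1 : ∑ k ∈ Finset.range (N + 1), H k * U k ≤ H 0 * U 0 + (2⁻¹ * X + G * B) := by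
    rw [Finset.sum_range_succ', add_comm]
    gcongr
    calc ∑ k ∈ Finset.range N, H (k + 1) * U (k + 1)
        ≤ ∑ k ∈ Finset.range N, ((G * t) * (H k * U k) + G * (H k * V k)) := by
          refine Finset.sum_le_sum fun k _ => ?_
          rw [hHs]
          calc G * H k * U (k + 1) ≤ G * H k * (t * U k + V k) := by gcongr; exact hrec k
            _ = _ := by ring
      _ = (G * t) * X + G * ∑ k ∈ Finset.range N, H k * V k := by
          rw [Finset.sum_add_distrib, ← Finset.mul_sum, ← Finset.mul_sum]
      _ ≤ _ := by
          gcongr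
          exact (ENNReal.sum_le_tsum _).trans hB
  have h2 : X ≤ 2⁻¹ * X + (H 0 * U 0 + G * B) := by
    refine le_trans (Finset.sum_le_sum_of_subset (Finset.range_mono (Nat.le_succ N)))
      (h1.trans (le_of_eq ?_))
    ring
  have hX2 : X = 2⁻¹ * X + 2⁻¹ * X := by
    rw [← add_mul, ENNReal.inv_two_add_inv_two, one_mul]
  have h3 : 2⁻¹ * X ≤ H 0 * U 0 + G * B := by
    refine (ENNReal.add_le_add_iff_left (a := 2⁻¹ * X) (ENNReal.mul_ne_top (by simp) hX)).1 ?_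
    rwa [← hX2]
  calc X = 2 * (2⁻¹ * X) := by
        rw [← mul_assoc, ENNReal.mul_inv_cancel (by simp) (by simp), one_mul]
    _ ≤ _ := by gcongr

/-- The `L^R` norm on the cube is controlled by the level sets. -/
theorem lintegral_cube_le_tsum (hn : 0 < n) {g : Rn n → ℂ} (hg : LocallyIntegrable g volume)
    {L h₀ c₀ R : ℝ} (hL : 0 < L) (hh₀ : 0 < h₀) (hc₀ : 1 < c₀) (hR : 0 < R) :
    ∫⁻ x in cube L 0 0, ‖g x‖ₑ ^ R ≤ ENNReal.ofReal (h₀ ^ R) * volume (cube (n := n) L 0 0) +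
      ∑' k : ℕ, ENNReal.ofReal ((h₀ * c₀ ^ (k + 1)) ^ R) * volume (levelSet g L (h₀ * c₀ ^ k)) := by
  have hc0 : 0 < c₀ := one_pos.trans hc₀
  calc ∫⁻ x in cube L 0 0, ‖g x‖ₑ ^ R
      ≤ ∫⁻ x in cube (n := n) L 0 0, (ENNReal.ofReal (h₀ ^ R) +
        ∑' k : ℕ, (levelSet g L (h₀ * c₀ ^ k)).indicator
          (fun _ => ENNReal.ofReal ((h₀ * c₀ ^ (k + 1)) ^ R)) x) := by
        refine lintegral_mono_ae ?_
        filter_upwards [ae_restrict_of_ae (ae_mem_levelSet hn hg hL),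
          ae_restrict_mem (measurableSet_cube L 0 0)] with x hx hx0
        rw [← ofReal_norm, ENNReal.ofReal_rpow_of_nonneg (norm_nonneg _) hR.le]
        rcases le_or_gt ‖g x‖ h₀ with h1 | h1
        · exact le_add_right (ENNReal.ofReal_le_ofReal (by gcongr))
        · refine le_add_left ?_
          have hex : ∃ k : ℕ, ‖g x‖ ≤ h₀ * c₀ ^ (k + 1) := by
            obtain ⟨k, hk⟩ := pow_unbounded_of_one_lt (‖g x‖ / h₀) hc₀
            refine ⟨k, ?_⟩
            rw [div_lt_iff₀ hh₀] at hk
            have : c₀ ^ k ≤ c₀ ^ (k + 1) := pow_le_pow_right₀ hc₀.le (Nat.le_succ k)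
            nlinarith
          classical
          -- The least such `k` places `‖g x‖` in `(h₀ c₀^k, h₀ c₀^(k+1)]`, so almost surely `x`
          -- lies in the level set of index `k`, and that single term already dominates `‖g x‖^R`.
          have hk := Nat.find_spec hex
          set k := Nat.find hex with hkdef
          have hlt : h₀ * c₀ ^ k < ‖g x‖ := by
            rcases Nat.eq_zero_or_pos k with h0 | hpos
            · rw [h0]; simpa using h1
            · have := Nat.find_min hex (m := k - 1) (by omega)
              rw [Nat.sub_add_cancel hpos] at this
              exact not_le.1 this
          refine le_trans ?_ (ENNReal.le_tsum k)
          rw [Set.indicator_of_mem (hx hx0 _ (by positivity) hlt)]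
          exact ENNReal.ofReal_le_ofReal (by gcongr)
    _ = _ := by
        rw [lintegral_add_left measurable_const, setLIntegral_const, lintegral_tsum]
        · congr 1
          refine tsum_congr fun k => ?_
          rw [lintegral_indicator measurableSet_levelSet, setLIntegral_const,
            Measure.restrict_apply measurableSet_levelSet,
            Set.inter_eq_left.2 levelSet_subset]
        · exact fun k => (measurable_const.indicator measurableSet_levelSet).aemeasurable

end CZCommutator

/-! ### Uniform bounds on cubes and passage to the whole space. -/

namespace CZCommutator

variable {n : ℕ}

/-- With `a` the mean over the cube, the stopping argument starts at a height `h₀` above the mean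
deviation, so that the root cube is never selected. The cost of the starting height is bounded by
the level sum of a single ball, and the higher levels by the recursive good-λ inequality. None of
the constants depends on `L`. -/
theorem exists_lintegral_cube_le (hn : 0 < n) {b : Rn n → ℂ} (hb : LocallyIntegrable b volume)
    {A R : ℝ} (hA : 0 < A) (hR : 0 < R)
    (H : ∀ C' : ℝ, 0 ≤ C' → ∃ M, LevelSumBound b A (2 ^ (n + 1)) C' R M) :
    ∃ M : ℝ≥0∞, M ≠ ∞ ∧ ∀ L : ℝ, 0 < L → ∃ a : ℂ, ∫⁻ x in cube L 0 0, ‖b x - a‖ₑ ^ R ≤ M := by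
  have hn' : (1 : ℝ) ≤ n := by exact_mod_cast hn
  set c₀ : ℝ := 2 ^ (n + 1) with hc₀def
  have hc₀ : 1 < c₀ := one_lt_pow₀ (by norm_num) (by omega)
  have hc0 : 0 < c₀ := by positivity
  -- One level up, the weight grows by `c₀ ^ R`; this `θ` makes the recursion contract by exactly
  -- one half.
  set θ : ℝ := (2 * c₀ ^ R)⁻¹ with hθdef
  have hcR : 0 < c₀ ^ R := by positivity
  have hθ : 0 < θ := by positivity
  obtain ⟨M₁, hM₁⟩ := H (2 * n ^ n / (θ * 2 ^ n)) (by positivity)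
  obtain ⟨M₂, hM₂⟩ := H (2 * n ^ n) (by positivity)
  set W := (5 * A) ^ n * volume.real (Metric.closedBall (0 : Rn n) 1) * M₁ with hW
  set D : ℝ≥0∞ := ENNReal.ofReal (max M₂ 1)
  set G : ℝ≥0∞ := ENNReal.ofReal (c₀ ^ R)
  refine ⟨D + G * (2 * (D + G * ENNReal.ofReal W)), ?_, fun L hL => ?_⟩
  · refine ENNReal.add_ne_top.2 ⟨ENNReal.ofReal_ne_top, ENNReal.mul_ne_top ENNReal.ofReal_ne_top
      (ENNReal.mul_ne_top (by simp) (ENNReal.add_ne_top.2 ⟨ENNReal.ofReal_ne_top,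
        ENNReal.mul_ne_top ENNReal.ofReal_ne_top ENNReal.ofReal_ne_top⟩))⟩
  set a : ℂ := ⨍ z in cube L 0 0, b z with ha
  refine ⟨a, ?_⟩
  set g : Rn n → ℂ := fun y => b y - a with hgdef
  have hg : LocallyIntegrable g volume := hb.sub (locallyIntegrable_const a)
  set s := side L 0 with hsdef
  have hs : 0 < s := side_pos hL 0
  have hsn : 0 < s ^ n := by positivity
  have hgQ := integrableOn_cube hL hg 0 0
  set I := ∫ y in cube L 0 0, ‖g y‖ with hI
  have hI0 : 0 ≤ I := integral_nonneg fun _ => norm_nonneg _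
  have hIl : ENNReal.ofReal I = ∫⁻ y in cube L 0 0, ‖g y‖ₑ :=
    ofReal_integral_norm_eq_lintegral_enorm hgQ
  have hIosc : I ≤ 2 * oscBall b 0 (n * s) := by
    have := lintegral_cube_sub_average_le hb hL 0 0 0
    simp only [sub_zero] at this
    rw [← ha, ← hIl, ENNReal.ofReal_le_ofReal_iff (by
      have := oscBall_nonneg b 0 (n * s); positivity)] at this
    exact this
  set m := I / s ^ n with hm
  have hm0 : 0 ≤ m := by positivity
  have hmR : m ^ R * s ^ n ≤ M₂ := by
    rcases hm0.eq_or_lt with h0 | hpos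
    · rw [← h0, Real.zero_rpow hR.ne', zero_mul]; exact hM₂.nonneg
    -- A family of one ball, around the whole cube, at level zero.
    have h1 := hM₂ (ι := Unit) {()} (fun _ => 0) (fun _ => n * s) (fun _ => 0) m hpos
      (fun _ => by positivity) (by simp) (by
        intro i _
        rw [pow_zero, mul_one, mul_pow, hm]
        have : (0 : ℝ) ≤ n ^ n := by positivity
        have h2 := mul_le_mul_of_nonneg_left hIosc this
        calc I / s ^ n * (n ^ n * s ^ n) = n ^ n * I := by field_simp
          _ ≤ _ := by linarith)
    simp only [Finset.sum_singleton, pow_zero, mul_one, mul_pow] at h1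
    refine le_trans ?_ h1
    have h3 : (1 : ℝ) ≤ n ^ n := one_le_pow₀ hn'
    have h4 : 0 ≤ m ^ R * s ^ n := by positivity
    nlinarith
  -- The second entry keeps `h₀` positive when `b` is almost everywhere constant on the cube; it is
  -- chosen so that its `R`-th power times the volume equals one.
  set h₀ := max m ((s ^ n) ^ (-R⁻¹)) with hh₀def
  have hh₀ : 0 < h₀ := lt_max_of_lt_right (by positivity)
  have hh₀R : h₀ ^ R * s ^ n ≤ max M₂ 1 := by
    rcases max_choice m ((s ^ n) ^ (-R⁻¹)) with h1 | h1
    · rw [hh₀def, h1]; exact hmR.trans (le_max_left _ _)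
    · rw [hh₀def, h1, ← Real.rpow_mul hsn.le, neg_mul, inv_mul_cancel₀ hR.ne', Real.rpow_neg_one,
        inv_mul_cancel₀ hsn.ne']
      exact le_max_right _ _
  have hQD : ENNReal.ofReal (h₀ ^ R) * volume (cube (n := n) L 0 0) ≤ D := by
    rw [volume_cube hL, ← ENNReal.ofReal_mul (by positivity)]
    exact ENNReal.ofReal_le_ofReal hh₀R
  have havg : ∀ k : ℕ, ∀ x ∈ cube (n := n) L 0 0, ¬ AvgGT g L (h₀ * c₀ ^ k) 0 x := by
    intro k x hx
    unfold AvgGT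
    rw [cube_eq_of_mem hx, ← hIl, not_lt]
    refine ENNReal.ofReal_le_ofReal ?_
    have h1 : m ≤ h₀ * c₀ ^ k :=
      (le_max_left _ _).trans (le_mul_of_one_le_right hh₀.le (one_le_pow₀ hc₀.le))
    calc I = m * s ^ n := by rw [hm]; field_simp
      _ ≤ _ := by gcongr
  have habs := tsum_le_of_recursive
    (U := fun k => volume (levelSet g L (h₀ * c₀ ^ k)))
    (V := fun k => volume (badSet g L (h₀ * c₀ ^ k) θ))
    (H := fun k => ENNReal.ofReal ((h₀ * c₀ ^ k) ^ R)) (t := ENNReal.ofReal θ) (G := G)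
    (B := ENNReal.ofReal W)
    (fun k => ((measure_mono levelSet_subset).trans_lt (by
      rw [volume_cube hL]; exact ENNReal.ofReal_lt_top)).ne)
    (fun k => ENNReal.ofReal_ne_top)
    (fun k => by
      have := volume_levelSet_le (g := g) (h := h₀ * c₀ ^ k) hL (by positivity) hθ.le (havg k)
      rwa [mul_assoc, ← hc₀def, ← pow_succ] at this)
    (fun k => by
      rw [← ENNReal.ofReal_mul hcR.le, ← Real.mul_rpow hc0.le (by positivity)]
      congr 2; ring)
    (by
      rw [← ENNReal.ofReal_mul hcR.le, hθdef, mul_inv, mul_comm, mul_assoc,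
        inv_mul_cancel₀ hcR.ne', mul_one, ENNReal.ofReal_inv_of_pos (by norm_num)]
      simp)
    (hM₁.tsum_badSet_le hn hb hA hc0 hθ hL hh₀ a)
  refine (lintegral_cube_le_tsum hn hg hL hh₀ hc₀ hR).trans (add_le_add hQD ?_)
  calc _ = G * ∑' k : ℕ, ENNReal.ofReal ((h₀ * c₀ ^ k) ^ R) *
        volume (levelSet g L (h₀ * c₀ ^ k)) := by
        rw [← ENNReal.tsum_mul_left]
        refine tsum_congr fun k => ?_
        rw [← mul_assoc, ← ENNReal.ofReal_mul hcR.le, ← Real.mul_rpow hc0.le (by positivity)]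
        congr 3; ring
    _ ≤ _ := by
        gcongr
        refine habs.trans ?_
        gcongr
        rw [pow_zero, mul_one]
        exact le_trans (by gcongr; exact levelSet_subset) hQD

theorem mem_cube_zero_iff {L : ℝ} (hL : 0 < L) {x : Rn n} :
    x ∈ cube L 0 0 ↔ ∀ i, -L ≤ x i ∧ x i < L := by
  have h0 : ∀ i, cubeIdx L 0 (0 : Rn n) i = 0 := by
    intro i
    simp only [cubeIdx, pow_zero, one_mul, PiLp.zero_apply, zero_add]
    rw [Int.floor_eq_iff]
    have : L / (2 * L) = 1 / 2 := by field_simp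
    rw [this]; norm_num
  rw [mem_cube_iff hL]
  refine forall_congr' fun i => ?_
  rw [h0, side, Set.mem_Ico]
  have : ((0 : ℤ) + 1 : ℝ) * (2 * L / 2 ^ 0) - L = L := by push_cast; ring
  rw [this]
  simp

/-- On a fixed cube `b` is close in `Lʳ` both to `a 0` and to `a N`, so the constants stay bounded.
Along a convergent subsequence Fatou's lemma, applied on the growing cubes, gives the estimate with
the limit constant. -/
theorem memLpModConst_of_cubes {b : Rn n → ℂ} (hb : LocallyIntegrable b volume) {r : ℝ≥0∞}
    (hr1 : 1 ≤ r) (hr : r ≠ ∞) {M : ℝ≥0∞} (hM : M ≠ ∞)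
    (H : ∀ L : ℝ, 0 < L → ∃ a : ℂ, ∫⁻ x in cube L 0 0, ‖b x - a‖ₑ ^ r.toReal ≤ M) :
    MemLpModConst b r := by
  have hr0 : r ≠ 0 := (zero_lt_one.trans_le hr1).ne'
  have hR : 0 < r.toReal := ENNReal.toReal_pos hr0 hr
  choose a ha using fun N : ℕ => H (N + 1) (by positivity)
  have hbm : AEStronglyMeasurable b volume := hb.aestronglyMeasurable
  have hsub : ∀ {N K : ℕ}, N ≤ K → cube (n := n) (N + 1) 0 0 ⊆ cube (K + 1) 0 0 := by
    intro N K hNK x hx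
    rw [mem_cube_zero_iff (by positivity)] at hx ⊢
    have : (N : ℝ) ≤ K := by exact_mod_cast hNK
    exact fun i => ⟨by linarith [(hx i).1], by linarith [(hx i).2]⟩
  set Q := cube (n := n) ((0 : ℕ) + 1) 0 0 with hQ
  have hQv : volume Q = ENNReal.ofReal (side ((0 : ℕ) + 1) 0 ^ n) := volume_cube (by norm_num) 0 0
  have hQ0 : volume Q ≠ 0 := by
    rw [hQv]
    have := side_pos (L := (0 : ℕ) + 1) (by norm_num) 0
    exact (ENNReal.ofReal_pos.2 (by positivity)).ne'
  have hQf : volume Q ≠ ∞ := by rw [hQv]; exact ENNReal.ofReal_ne_top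
  have hnorm : ∀ N, eLpNorm (fun x => b x - a N) r (volume.restrict Q) ≤ M ^ (1 / r.toReal) := by
    intro N
    rw [eLpNorm_eq_lintegral_rpow_enorm_toReal hr0 hr]
    gcongr
    exact (lintegral_mono_set (hsub (Nat.zero_le N))).trans (ha N)
  have hconst : ∀ N, ‖a N - a 0‖ₑ ≤ 2 * M ^ (1 / r.toReal) / volume Q ^ (1 / r.toReal) := by
    intro N
    rw [ENNReal.le_div_iff_mul_le (by left; simp [hQ0, hQf])
      (by left; simp [hQ0, hQf])]
    have h1 : eLpNorm (fun _ : Rn n => a N - a 0) r (volume.restrict Q) ≤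
        eLpNorm (fun x => b x - a 0) r (volume.restrict Q) +
        eLpNorm (fun x => b x - a N) r (volume.restrict Q) := by
      refine le_trans (le_of_eq ?_) (eLpNorm_sub_le
        ((hbm.sub aestronglyMeasurable_const).restrict)
        ((hbm.sub aestronglyMeasurable_const).restrict) hr1)
      congr 1
      ext x
      simp
    rw [eLpNorm_const _ hr0 (by simpa using hQ0), Measure.restrict_apply_univ] at h1
    refine h1.trans ?_
    rw [two_mul]
    exact add_le_add (hnorm 0) (hnorm N)
  obtain ⟨c, -, φ, hφ, hlim⟩ := tendsto_subseq_of_bounded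
    (s := Metric.closedBall (a 0) (2 * M ^ (1 / r.toReal) / volume Q ^ (1 / r.toReal)).toReal)
    Metric.isBounded_closedBall (x := a) (fun N => by
      rw [Metric.mem_closedBall, dist_eq_norm, ← toReal_enorm]
      refine ENNReal.toReal_mono ?_ (hconst N)
      refine ENNReal.div_ne_top (ENNReal.mul_ne_top (by simp)
        (ENNReal.rpow_ne_top_of_nonneg (by positivity) hM)) ?_
      simp [hQ0, hQf])
  have hfatou : ∫⁻ x, ‖b x - c‖ₑ ^ r.toReal ≤ M := by
    calc ∫⁻ x, ‖b x - c‖ₑ ^ r.toReal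
        ≤ ∫⁻ x, liminf (fun N => (cube (φ N + 1) 0 0).indicator
            (fun x => ‖b x - a (φ N)‖ₑ ^ r.toReal) x) atTop := by
          refine lintegral_mono fun x => ?_
          refine le_of_eq (Tendsto.liminf_eq ?_).symm
          have h1 : Tendsto (fun N => ‖b x - a (φ N)‖ₑ ^ r.toReal) atTop
              (𝓝 (‖b x - c‖ₑ ^ r.toReal)) :=
            ((tendsto_const_nhds.sub hlim).enorm).ennrpow_const _
          refine h1.congr' ?_
          have h2 : ∀ᶠ N : ℕ in atTop, ‖x‖ < N := by
            obtain ⟨K, hK⟩ := exists_nat_gt ‖x‖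
            filter_upwards [eventually_ge_atTop K] with N hN
            exact hK.trans_le (by exact_mod_cast hN)
          filter_upwards [hφ.tendsto_atTop.eventually h2] with N hN
          rw [Set.indicator_of_mem]
          rw [mem_cube_zero_iff (by positivity)]
          intro i
          have h3 : |x i| ≤ ‖x‖ := PiLp.norm_apply_le x i
          have h4 := abs_le.1 h3
          exact ⟨by linarith, by linarith⟩
      _ ≤ liminf (fun N => ∫⁻ x, (cube (φ N + 1) 0 0).indicator
            (fun x => ‖b x - a (φ N)‖ₑ ^ r.toReal) x) atTop := by
          refine lintegral_liminf_le' fun N => ?_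
          exact (((hbm.sub aestronglyMeasurable_const).enorm).pow_const _).indicator
            (measurableSet_cube _ _ _)
      _ ≤ M := by
          refine liminf_le_of_frequently_le' (Frequently.of_forall fun N => ?_)
          rw [lintegral_indicator (measurableSet_cube _ _ _)]
          exact ha (φ N)
  have hmem : MemLp (fun x => b x - c) r volume := by
    refine ⟨hbm.sub aestronglyMeasurable_const, ?_⟩
    rw [eLpNorm_eq_lintegral_rpow_enorm_toReal hr0 hr]
    exact ENNReal.rpow_lt_top_of_nonneg (by positivity) (hfatou.trans_lt hM.lt_top).ne
  refine ⟨fun x ρ => ?_, (iInf_le _ c).trans_lt hmem.2⟩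
  have : IsFiniteMeasure (volume.restrict (Metric.ball x ρ)) :=
    ⟨by simpa using measure_ball_lt_top⟩
  have h1 := (hmem.restrict (Metric.ball x ρ)).add (memLp_const c)
  refine h1.ae_eq (ae_of_all _ fun y => ?_)
  simp

/-- A commutator that controls the oscillations of `b` through test functions forces `b` into
`Lʳ` modulo constants. -/
theorem HasTestFunctions.memLpModConst (hn : 0 < n) {p q r : ℝ≥0∞} [Fact (1 ≤ p)] [Fact (1 ≤ q)]
    [ENNReal.HolderTriple r p q] (hr1 : 1 ≤ r) (hq : 1 < q) (hqp : q < p) (hp : p < ∞)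
    {b : Rn n → ℂ} (hb : LocallyIntegrable b volume)
    {S : Lp ℂ p (volume : Measure (Rn n)) →L[ℂ] Lp ℂ q (volume : Measure (Rn n))}
    {C A : ℝ} (hC : 0 ≤ C) (hA : 0 < A) (hS : HasTestFunctions b S C A) : MemLpModConst b r := by
  have hr : r ≠ ∞ := holderTriple_ne_top hqp
  have hR : 0 < r.toReal := ENNReal.toReal_pos (zero_lt_one.trans_le hr1).ne' hr
  obtain ⟨M, hM, H⟩ := exists_lintegral_cube_le (R := r.toReal) hn hb hA hR fun C' hC' =>
    sum_levels_le (r := r) hq hqp hp hC hA.le hS (one_lt_pow₀ (by norm_num) (by omega)) hC'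
  exact memLpModConst_of_cubes hb hr1 hr hM H

end CZCommutator

/-! ### Kernels close to a constant and the bilinear form of the commutator. -/

namespace CZCommutator

variable {n : ℕ}

/-- The kernel `k` deviates from the constant `K₀` on `G × F` by at most `E`, in mean over either
variable. -/
structure NearConst (k : Rn n → Rn n → ℂ) (F G : Set (Rn n)) (K₀ : ℂ) (E : ℝ≥0∞) : Prop where
  left : ∀ x ∈ G, ∫⁻ y in F, ‖k x y - K₀‖ₑ ≤ E
  right : ∀ y ∈ F, ∫⁻ x in G, ‖k x y - K₀‖ₑ ≤ E

section

variable {k : Rn n → Rn n → ℂ} {F G : Set (Rn n)} {K₀ : ℂ} {E : ℝ≥0∞}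

theorem NearConst.lintegral_fst_le (hk : Measurable (Function.uncurry k)) (hN : NearConst k F G K₀ E)
    (hG : MeasurableSet G) {u : Rn n → ℝ≥0∞} (hu : Measurable u) :
    ∫⁻ z, u z.1 * ‖k z.1 z.2 - K₀‖ₑ ∂((volume.restrict G).prod (volume.restrict F)) ≤
      E * ∫⁻ x in G, u x := by
  have hm : Measurable fun z : Rn n × Rn n => ‖k z.1 z.2 - K₀‖ₑ :=
    (hk.sub measurable_const).enorm
  have hum : Measurable fun z : Rn n × Rn n => u z.1 * ‖k z.1 z.2 - K₀‖ₑ :=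
    (hu.comp measurable_fst).mul hm
  rw [lintegral_prod _ hum.aemeasurable,
    ← lintegral_const_mul _ hu]
  refine setLIntegral_mono' hG fun x hx => ?_
  have hm' : Measurable fun y => ‖k x y - K₀‖ₑ := hm.comp measurable_prodMk_left
  change ∫⁻ y in F, u x * ‖k x y - K₀‖ₑ ≤ _
  rw [lintegral_const_mul _ hm', mul_comm]
  gcongr
  exact hN.left x hx

theorem NearConst.lintegral_snd_le (hk : Measurable (Function.uncurry k)) (hN : NearConst k F G K₀ E)
    (hF : MeasurableSet F) {u : Rn n → ℝ≥0∞} (hu : Measurable u) :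
    ∫⁻ z, u z.2 * ‖k z.1 z.2 - K₀‖ₑ ∂((volume.restrict G).prod (volume.restrict F)) ≤
      E * ∫⁻ y in F, u y := by
  have hm : Measurable fun z : Rn n × Rn n => ‖k z.1 z.2 - K₀‖ₑ :=
    (hk.sub measurable_const).enorm
  have hum : Measurable fun z : Rn n × Rn n => u z.2 * ‖k z.1 z.2 - K₀‖ₑ :=
    (hu.comp measurable_snd).mul hm
  rw [lintegral_prod_symm _ hum.aemeasurable,
    ← lintegral_const_mul _ hu]
  refine setLIntegral_mono' hF fun y hy => ?_
  have hm' : Measurable fun x => ‖k x y - K₀‖ₑ := hm.comp measurable_prodMk_right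
  change ∫⁻ x in G, u y * ‖k x y - K₀‖ₑ ≤ _
  rw [lintegral_const_mul _ hm', mul_comm]
  gcongr
  exact hN.right y hy

/-- The error made by replacing the kernel by a constant. -/
theorem NearConst.lintegral_sub_mul_le (hk : Measurable (Function.uncurry k))
    (hN : NearConst k F G K₀ E) (hF : MeasurableSet F) (hG : MeasurableSet G) {b : Rn n → ℂ}
    (hb : Measurable b) (α β : ℂ) :
    ∫⁻ z, ‖(b z.1 - b z.2) * (k z.1 z.2 - K₀)‖ₑ ∂((volume.restrict G).prod (volume.restrict F)) ≤
      E * ((∫⁻ x in G, ‖b x - α‖ₑ) + ‖α - β‖ₑ * volume G + ∫⁻ y in F, ‖b y - β‖ₑ) := by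
  have hm : Measurable fun z : Rn n × Rn n => ‖k z.1 z.2 - K₀‖ₑ :=
    (hk.sub measurable_const).enorm
  have h1 : Measurable fun x => ‖b x - α‖ₑ + ‖α - β‖ₑ :=
    (hb.sub measurable_const).enorm.add measurable_const
  have h2 : Measurable fun x => ‖b x - β‖ₑ := (hb.sub measurable_const).enorm
  calc _ ≤ ∫⁻ z, ((‖b z.1 - α‖ₑ + ‖α - β‖ₑ) * ‖k z.1 z.2 - K₀‖ₑ +
        ‖b z.2 - β‖ₑ * ‖k z.1 z.2 - K₀‖ₑ) ∂((volume.restrict G).prod (volume.restrict F)) := by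
        refine lintegral_mono fun z => ?_
        rw [enorm_mul, ← add_mul]
        gcongr
        calc ‖b z.1 - b z.2‖ₑ = ‖(b z.1 - α) + (α - β) + (β - b z.2)‖ₑ := by congr 1; ring
          _ ≤ _ := (enorm_add_le _ _).trans (add_le_add (enorm_add_le _ _) (by
              rw [← enorm_neg, neg_sub]))
    _ ≤ _ := by
        have h3 : Measurable fun z : Rn n × Rn n =>
            (‖b z.1 - α‖ₑ + ‖α - β‖ₑ) * ‖k z.1 z.2 - K₀‖ₑ := (h1.comp measurable_fst).mul hm
        rw [lintegral_add_left h3, mul_add]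
        refine add_le_add ((hN.lintegral_fst_le hk hG h1).trans (le_of_eq ?_))
          (hN.lintegral_snd_le hk hF h2)
        rw [lintegral_add_right _ measurable_const, setLIntegral_const]

theorem integrable_sub_prod {b : Rn n → ℂ} (hbF : IntegrableOn b F volume)
    (hbG : IntegrableOn b G volume) (hFf : volume F ≠ ∞) (hGf : volume G ≠ ∞) :
    Integrable (fun z : Rn n × Rn n => b z.1 - b z.2)
      ((volume.restrict G).prod (volume.restrict F)) := by
  have : IsFiniteMeasure (volume.restrict F) := ⟨by simpa using hFf.lt_top⟩
  have : IsFiniteMeasure (volume.restrict G) := ⟨by simpa using hGf.lt_top⟩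
  exact (Integrable.comp_fst hbG _).sub (Integrable.comp_snd hbF _)

theorem NearConst.integrable_sub_mul (hk : Measurable (Function.uncurry k))
    (hN : NearConst k F G K₀ E) (hE : E ≠ ∞) (hF : MeasurableSet F) (hG : MeasurableSet G)
    {b : Rn n → ℂ}
    (hb : Measurable b) (hbF : IntegrableOn b F volume) (hbG : IntegrableOn b G volume) :
    Integrable (fun z : Rn n × Rn n => (b z.1 - b z.2) * (k z.1 z.2 - K₀))
      ((volume.restrict G).prod (volume.restrict F)) := by
  refine ⟨?_, ?_⟩
  · exact (((hb.comp measurable_fst).sub (hb.comp measurable_snd)).mul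
      (hk.sub measurable_const)).aestronglyMeasurable
  · refine (hN.lintegral_sub_mul_le hk hF hG hb 0 0).trans_lt ?_
    refine ENNReal.mul_lt_top hE.lt_top ?_
    simp only [sub_zero, enorm_zero, zero_mul, add_zero]
    exact ENNReal.add_lt_top.2 ⟨hbG.2, hbF.2⟩

/-- No integrability of the kernel is assumed: its deviation from `K₀` is controlled by `NearConst`,
and the constant part only needs `b` integrable on two sets of finite measure. -/
theorem NearConst.integrable_kernel (hk : Measurable (Function.uncurry k))
    (hN : NearConst k F G K₀ E) (hE : E ≠ ∞) (hF : MeasurableSet F) (hG : MeasurableSet G)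
    (hFf : volume F ≠ ∞) (hGf : volume G ≠ ∞) {b : Rn n → ℂ}
    (hb : Measurable b) (hbF : IntegrableOn b F volume) (hbG : IntegrableOn b G volume) :
    Integrable (fun z : Rn n × Rn n => (b z.1 - b z.2) * k z.1 z.2)
      ((volume.restrict G).prod (volume.restrict F)) := by
  refine ((hN.integrable_sub_mul hk hE hF hG hb hbF hbG).add
    ((integrable_sub_prod hbF hbG hFf hGf).mul_const K₀)).congr (ae_of_all _ fun z => ?_)
  simp only [Pi.add_apply]
  ring

/-- The representation of the commutator by the kernel, tested on bounded functions with
disjoint supports, where `b` is bounded on the support of the input. -/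
theorem integral_commutator_mul_eq_of_bounded {T : (Rn n → ℂ) → (Rn n → ℂ)} {p q : ℝ≥0∞}
    [Fact (1 ≤ p)] [Fact (1 ≤ q)] (hp1 : 1 < p) (hp : p < ∞)
    {S : Lp ℂ p (volume : Measure (Rn n)) →L[ℂ] Lp ℂ q (volume : Measure (Rn n))}
    {b : Rn n → ℂ} (hT : IsLpBounded T) (hkT : OffDiagonalKernel T k) (hS : ExtendsCommutator b T S)
    (hN : NearConst k F G K₀ E) (hE : E ≠ ∞) (hF : IsCompact F) (hG : IsCompact G)
    (hFG : Disjoint F G) (hb : Measurable b) (hbl : LocallyIntegrable b volume) {ψ φ : Rn n → ℂ}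
    (hψ : Measurable ψ) (hφ : Measurable φ) (hψ1 : ∀ x, ‖ψ x‖ ≤ 1) (hφ1 : ∀ x, ‖φ x‖ ≤ 1)
    (hψF : ∀ x ∉ F, ψ x = 0) (hφG : ∀ x ∉ G, φ x = 0) {N : ℝ} (hbψ : ∀ x, ‖b x * ψ x‖ ≤ N)
    {f : Lp ℂ p (volume : Measure (Rn n))} (hf : f =ᵐ[volume] ψ) :
    ∫ x, S f x * φ x = ∫ z, (b z.1 - b z.2) * k z.1 z.2 * (ψ z.2 * φ z.1)
      ∂((volume.restrict G).prod (volume.restrict F)) := by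
  have hkm := hkT.measurable
  have hFf := hF.measure_lt_top (μ := (volume : Measure (Rn n)))
  have hGf := hG.measure_lt_top (μ := (volume : Measure (Rn n)))
  have hψp : MemLp ψ p volume :=
    memLp_of_bounded_of_support hψ hψ1 hF.measurableSet hFf.ne hψF p
  have hbψt : MemLp (fun y => b y * ψ y) ∞ volume :=
    memLp_top_of_bound (hb.mul hψ).aestronglyMeasurable N (ae_of_all _ hbψ)
  have hψt : MemLp ψ ∞ volume :=
    memLp_top_of_bound hψ.aestronglyMeasurable 1 (ae_of_all _ hψ1)
  have hbψF : ∀ x ∉ F, b x * ψ x = 0 := fun x hx => by rw [hψF x hx, mul_zero]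
  have hbψp : MemLp (fun y => b y * ψ y) p volume := by
    have h1 : (fun y => b y * ψ y) = F.indicator (fun y => b y * ψ y) := by
      ext x; by_cases hx : x ∈ F
      · simp [hx]
      · simp [hx, hψF x hx]
    rw [h1, memLp_indicator_iff_restrict hF.measurableSet]
    have : IsFiniteMeasure (volume.restrict F) := ⟨by simpa using hFf⟩
    exact MemLp.of_bound (hb.mul hψ).aestronglyMeasurable N (ae_of_all _ hbψ)
  have hbf : (fun y => b y * f y) =ᵐ[volume] fun y => b y * ψ y := by
    filter_upwards [hf] with y hy; rw [hy]
  -- As `b ψ` is bounded with compact support, the exponent `s = p` is admissible in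
  -- `ExtendsCommutator`.
  have hSf := hS f ⟨p, hp1, hp, hbψp.ae_eq hbf.symm⟩
  have hTf := hT.congr_ae hp1 hp (Lp.memLp f) hf
  have hTbf := hT.congr_ae hp1 hp (hbψp.ae_eq hbf.symm) hbf
  have hr1 := hkT.rep F hF ψ hψt hψF
  have hr2 := hkT.rep F hF _ hbψt hbψF
  have hpt : ∀ᵐ x, S f x * φ x =
      G.indicator (fun x => ∫ y in F, (b x - b y) * k x y * (ψ y * φ x)) x := by
    filter_upwards [hSf, hTf, hTbf, hr1, hr2] with x h1 h2 h3 h4 h5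
    by_cases hx : x ∈ G
    · have hxF : x ∉ F := fun h => Set.disjoint_left.1 hFG h hx
      rw [Set.indicator_of_mem hx, h1, commutator, h2, h3, h4 hxF, h5 hxF]
      have hki : IntegrableOn (fun y => k x y) F volume := by
        have hi : IntegrableOn (fun y => k x y - K₀) F volume :=
          ⟨((hkm.comp measurable_prodMk_left).sub measurable_const).aestronglyMeasurable,
            (hN.left x hx).trans_lt hE.lt_top⟩
        refine (hi.add (integrableOn_const hFf.ne (C := K₀))).congr (ae_of_all _ fun y => ?_)
        simp
      have e : ∀ w : Rn n → ℂ, (∀ x ∉ F, w x = 0) → ∫ y, k x y * w y = ∫ y in F, k x y * w y := by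
        intro w hw
        refine (setIntegral_eq_integral_of_forall_compl_eq_zero fun y hy => ?_).symm
        rw [hw y hy, mul_zero]
      rw [e ψ hψF, e _ hbψF, ← integral_const_mul, ← integral_sub, ← integral_mul_const]
      · refine integral_congr_ae (ae_of_all _ fun y => ?_)
        simp only
        ring
      · exact (Integrable.mul_bdd (c := 1) hki hψ.aestronglyMeasurable (ae_of_all _ hψ1)).const_mul _
      · exact Integrable.mul_bdd (c := N) hki (hb.mul hψ).aestronglyMeasurable (ae_of_all _ hbψ)
    · rw [Set.indicator_of_notMem hx, hφG x hx, mul_zero]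
  rw [integral_congr_ae hpt, integral_indicator hG.measurableSet, integral_prod]
  refine (hN.integrable_kernel hkm hE hF.measurableSet hG.measurableSet hFf.ne hGf.ne hb
    (hbl.integrableOn_isCompact hF) (hbl.integrableOn_isCompact hG)).mul_bdd (c := 1) ?_ ?_
  · exact ((hψ.comp measurable_snd).mul (hφ.comp measurable_fst)).aestronglyMeasurable
  · refine ae_of_all _ fun z => ?_
    rw [norm_mul]
    exact mul_le_one₀ (hψ1 _) (norm_nonneg _) (hφ1 _)

/-- The representation of the commutator by the kernel, tested on bounded functions with
disjoint supports. -/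
theorem integral_commutator_mul_eq {T : (Rn n → ℂ) → (Rn n → ℂ)} {p q : ℝ≥0∞}
    [Fact (1 ≤ p)] [Fact (1 ≤ q)] (hp1 : 1 < p) (hp : p < ∞)
    {S : Lp ℂ p (volume : Measure (Rn n)) →L[ℂ] Lp ℂ q (volume : Measure (Rn n))}
    {b : Rn n → ℂ} (hT : IsLpBounded T) (hkT : OffDiagonalKernel T k) (hS : ExtendsCommutator b T S)
    (hN : NearConst k F G K₀ E) (hE : E ≠ ∞) (hF : IsCompact F) (hG : IsCompact G)
    (hFG : Disjoint F G) (hb : Measurable b) (hbl : LocallyIntegrable b volume) {ψ φ : Rn n → ℂ}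
    (hψ : Measurable ψ) (hφ : Measurable φ) (hψ1 : ∀ x, ‖ψ x‖ ≤ 1) (hφ1 : ∀ x, ‖φ x‖ ≤ 1)
    (hψF : ∀ x ∉ F, ψ x = 0) (hφG : ∀ x ∉ G, φ x = 0)
    {f : Lp ℂ p (volume : Measure (Rn n))} (hf : f =ᵐ[volume] ψ) :
    ∫ x, S f x * φ x = ∫ z, (b z.1 - b z.2) * k z.1 z.2 * (ψ z.2 * φ z.1)
      ∂((volume.restrict G).prod (volume.restrict F)) := by
  have hkm := hkT.measurable
  have hFf := hF.measure_lt_top (μ := (volume : Measure (Rn n)))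
  have hGf := hG.measure_lt_top (μ := (volume : Measure (Rn n)))
  have hψp : MemLp ψ p volume :=
    memLp_of_bounded_of_support hψ hψ1 hF.measurableSet hFf.ne hψF p
  -- For `b` merely locally integrable, `b ψ` need not lie in any `Lˢ` with `s > 1`, and nothing is
  -- known directly about `S f`. So `ψ` is cut off where `b` is large; the left side converges by
  -- continuity of `S`, the right side by dominated convergence.
  let Y : ℕ → Set (Rn n) := fun N => {x | ‖b x‖ ≤ N}
  have hY : ∀ N, MeasurableSet (Y N) := fun N => measurableSet_le hb.norm measurable_const
  have hYev : ∀ x, ∀ᶠ N in atTop, x ∈ Y N := fun x => by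
    obtain ⟨K, hK⟩ := exists_nat_gt ‖b x‖
    filter_upwards [eventually_ge_atTop K] with N hN
    exact hK.le.trans (by exact_mod_cast hN)
  let w : ℕ → Rn n → ℂ := fun N => (Y N).indicator ψ
  have hwm : ∀ N, Measurable (w N) := fun N => hψ.indicator (hY N)
  have hw1 : ∀ N x, ‖w N x‖ ≤ 1 := fun N x => (norm_indicator_le_norm_self _ _).trans (hψ1 x)
  have hwF : ∀ N, ∀ x ∉ F, w N x = 0 := fun N x hx => by
    by_cases h : x ∈ Y N
    · simp [w, h, hψF x hx]
    · simp [w, h]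
  have hwp : ∀ N, MemLp (w N) p volume := fun N => hψp.indicator (hY N)
  have hbw : ∀ N x, ‖b x * w N x‖ ≤ N := fun N x => by
    by_cases h : x ∈ Y N
    · rw [norm_mul]
      exact (mul_le_of_le_one_right (norm_nonneg _) (hw1 N x)).trans h
    · simp [w, h]
  have heq : ∀ N, ∫ x, S (hwp N).toLp x * φ x =
      ∫ z, (b z.1 - b z.2) * k z.1 z.2 * (w N z.2 * φ z.1)
        ∂((volume.restrict G).prod (volume.restrict F)) := fun N =>
    integral_commutator_mul_eq_of_bounded hp1 hp hT hkT hS hN hE hF hG hFG hb hbl (hwm N) hφ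
      (hw1 N) hφ1 (hwF N) hφG (hbw N) (hwp N).coeFn_toLp
  have hlim1 : Tendsto (fun N => ∫ x, S (hwp N).toLp x * φ x) atTop (𝓝 (∫ x, S f x * φ x)) := by
    let q' := q.conjExponent
    have hconj : ENNReal.HolderConjugate q q' := ENNReal.HolderConjugate.conjExponent Fact.out
    have : Fact (1 ≤ q') := ⟨hconj.symm.one_le⟩
    have hφq : MemLp φ q' volume :=
      memLp_of_bounded_of_support hφ hφ1 hG.measurableSet hGf.ne hφG q'
    have hpair : ∀ g : Lp ℂ q (volume : Measure (Rn n)),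
        (ContinuousLinearMap.mul ℂ ℂ).lpPairing volume q q' g hφq.toLp = ∫ x, g x * φ x := by
      intro g
      rw [ContinuousLinearMap.lpPairing_eq_integral]
      refine integral_congr_ae ?_
      filter_upwards [hφq.coeFn_toLp] with x hx
      rw [hx]; rfl
    simp only [← hpair]
    have hconv : Tendsto (fun N => (hwp N).toLp) atTop (𝓝 f) := by
      have hfψ : f = hψp.toLp := Lp.ext (hf.trans hψp.coeFn_toLp.symm)
      rw [hfψ, Lp.tendsto_Lp_iff_tendsto_eLpNorm'']
      exact tendsto_eLpNorm_indicator_sub (zero_lt_one.trans hp1).ne' hp.ne hψp hY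
        (ae_of_all _ hYev)
    have hc : Continuous fun g => (ContinuousLinearMap.mul ℂ ℂ).lpPairing volume q q' (S g)
        hφq.toLp := by fun_prop
    exact (hc.tendsto f).comp hconv
  have hker := hN.integrable_kernel hkm hE hF.measurableSet hG.measurableSet hFf.ne hGf.ne hb
    (hbl.integrableOn_isCompact hF) (hbl.integrableOn_isCompact hG)
  refine tendsto_nhds_unique hlim1 ?_
  simp only [heq]
  refine tendsto_integral_of_dominated_convergence _ (fun N => ?_) hker.norm (fun N => ?_) ?_
  · exact hker.1.mul
      (((hwm N).comp measurable_snd).mul (hφ.comp measurable_fst)).aestronglyMeasurable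
  · refine ae_of_all _ fun z => ?_
    rw [norm_mul]
    refine mul_le_of_le_one_right (norm_nonneg _) ?_
    rw [norm_mul]
    exact mul_le_one₀ (hw1 N _) (norm_nonneg _) (hφ1 _)
  · refine ae_of_all _ fun z => ?_
    refine tendsto_const_nhds.congr' ?_
    filter_upwards [hYev z.2] with N hz
    simp [w, hz]

end

end CZCommutator

/-! ### Test functions that detect oscillation. -/

namespace CZCommutator

variable {n : ℕ}

/-- The complex phase that turns `w` into its modulus. -/
noncomputable def phase (w : ℂ) : ℂ := (starRingEnd ℂ) w / ‖w‖

theorem norm_phase_le (w : ℂ) : ‖phase w‖ ≤ 1 := by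
  rw [phase, norm_div, RCLike.norm_conj, Complex.norm_real, norm_norm]
  exact div_self_le_one _

theorem phase_mul_self (w : ℂ) : phase w * w = ‖w‖ := by
  rcases eq_or_ne w 0 with rfl | hw
  · simp
  · rw [phase, div_mul_eq_mul_div, mul_comm, Complex.mul_conj, Complex.normSq_eq_norm_sq]
    have : (‖w‖ : ℂ) ≠ 0 := by simpa using hw
    push_cast
    field_simp

theorem measurable_phase : Measurable phase := by
  unfold phase
  exact (Complex.continuous_conj.measurable).div (by fun_prop)

/-- The double integral of `b(x) - b(y)` against a kernel and two test functions. -/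
noncomputable def commForm (b : Rn n → ℂ) (k : Rn n → Rn n → ℂ) (F G : Set (Rn n))
    (ψ φ : Rn n → ℂ) : ℂ :=
  ∫ z, (b z.1 - b z.2) * k z.1 z.2 * (ψ z.2 * φ z.1)
    ∂((volume.restrict G).prod (volume.restrict F))

section

variable {k : Rn n → Rn n → ℂ} {F G : Set (Rn n)} {K₀ : ℂ} {E : ℝ≥0∞}

/-- With the kernel frozen at `K₀` the form splits into products of single integrals. The freezing
error involves `b` only through its deviations from `α` on `G` and from `β` on `F`, and through `α -
β`. -/
theorem norm_commForm_sub_le (hk : Measurable (Function.uncurry k))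
    (hN : NearConst k F G K₀ E) (hE : E ≠ ∞) (hF : MeasurableSet F) (hG : MeasurableSet G)
    (hFf : volume F ≠ ∞) (hGf : volume G ≠ ∞) {b : Rn n → ℂ}
    (hb : Measurable b) (hbF : IntegrableOn b F volume) (hbG : IntegrableOn b G volume)
    {ψ φ : Rn n → ℂ} (hψ : Measurable ψ) (hφ : Measurable φ) (hψ1 : ∀ x, ‖ψ x‖ ≤ 1)
    (hφ1 : ∀ x, ‖φ x‖ ≤ 1) (α β : ℂ) :
    ‖K₀ * ((∫ x in G, b x * φ x) * (∫ y in F, ψ y) - (∫ x in G, φ x) * ∫ y in F, b y * ψ y) -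
        commForm b k F G ψ φ‖ ≤
      E.toReal * ((∫ x in G, ‖b x - α‖) + ‖α - β‖ * volume.real G + ∫ y in F, ‖b y - β‖) := by
  have hfF : IsFiniteMeasure (volume.restrict F) := ⟨by simpa using hFf.lt_top⟩
  have hfG : IsFiniteMeasure (volume.restrict G) := ⟨by simpa using hGf.lt_top⟩
  set μ := (volume.restrict G).prod (volume.restrict F) with hμ
  have htm : AEStronglyMeasurable (fun z : Rn n × Rn n => ψ z.2 * φ z.1) μ :=
    ((hψ.comp measurable_snd).mul (hφ.comp measurable_fst)).aestronglyMeasurable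
  have ht1 : ∀ z : Rn n × Rn n, ‖ψ z.2 * φ z.1‖ ≤ 1 := fun z => by
    rw [norm_mul]; exact mul_le_one₀ (hψ1 _) (norm_nonneg _) (hφ1 _)
  have hψi : IntegrableOn ψ F volume :=
    Integrable.of_bound hψ.aestronglyMeasurable 1 (ae_of_all _ hψ1)
  have hφi : IntegrableOn φ G volume :=
    Integrable.of_bound hφ.aestronglyMeasurable 1 (ae_of_all _ hφ1)
  have hbφ : IntegrableOn (fun x => b x * φ x) G volume :=
    Integrable.mul_bdd (c := 1) hbG hφ.aestronglyMeasurable (ae_of_all _ hφ1)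
  have hbψ : IntegrableOn (fun x => b x * ψ x) F volume :=
    Integrable.mul_bdd (c := 1) hbF hψ.aestronglyMeasurable (ae_of_all _ hψ1)
  have h1 : K₀ * ((∫ x in G, b x * φ x) * (∫ y in F, ψ y) - (∫ x in G, φ x) *
      ∫ y in F, b y * ψ y) = ∫ z, (b z.1 - b z.2) * K₀ * (ψ z.2 * φ z.1) ∂μ := by
    rw [← integral_prod_mul (fun x => b x * φ x) ψ, ← integral_prod_mul φ (fun y => b y * ψ y),
      ← integral_sub (hbφ.mul_prod hψi) (hφi.mul_prod hbψ), ← integral_const_mul]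
    refine integral_congr_ae (ae_of_all _ fun z => ?_)
    simp only
    ring
  have hint1 : Integrable (fun z : Rn n × Rn n => (b z.1 - b z.2) * K₀ * (ψ z.2 * φ z.1)) μ :=
    ((integrable_sub_prod hbF hbG hFf hGf).mul_const K₀).mul_bdd (c := 1) htm (ae_of_all _ ht1)
  have hint2 : Integrable (fun z : Rn n × Rn n => (b z.1 - b z.2) * k z.1 z.2 *
      (ψ z.2 * φ z.1)) μ :=
    (hN.integrable_kernel hk hE hF hG hFf hGf hb hbF hbG).mul_bdd (c := 1) htm (ae_of_all _ ht1)
  rw [h1, commForm, ← integral_sub hint1 hint2]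
  have hαG : IntegrableOn (fun x => b x - α) G volume := hbG.sub (integrableOn_const hGf)
  have hβF : IntegrableOn (fun x => b x - β) F volume := hbF.sub (integrableOn_const hFf)
  have h2 := hN.lintegral_sub_mul_le hk hF hG hb α β
  have hfin : (∫⁻ x in G, ‖b x - α‖ₑ) + ‖α - β‖ₑ * volume G + ∫⁻ y in F, ‖b y - β‖ₑ ≠ ∞ :=
    ENNReal.add_ne_top.2 ⟨ENNReal.add_ne_top.2 ⟨hαG.2.ne, ENNReal.mul_ne_top (by simp) hGf⟩,
      hβF.2.ne⟩
  have h3 : ‖∫ z, ((b z.1 - b z.2) * K₀ * (ψ z.2 * φ z.1) -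
      (b z.1 - b z.2) * k z.1 z.2 * (ψ z.2 * φ z.1)) ∂μ‖ₑ ≤
      E * ((∫⁻ x in G, ‖b x - α‖ₑ) + ‖α - β‖ₑ * volume G + ∫⁻ y in F, ‖b y - β‖ₑ) := by
    refine (enorm_integral_le_lintegral_enorm _).trans (le_trans ?_ h2)
    refine lintegral_mono fun z => ?_
    rw [enorm_le_iff_norm_le]
    calc _ = ‖(b z.1 - b z.2) * (k z.1 z.2 - K₀)‖ * ‖ψ z.2 * φ z.1‖ := by
          rw [← norm_mul, ← norm_neg]; congr 1; ring
      _ ≤ _ := mul_le_of_le_one_right (norm_nonneg _) (ht1 z)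
  rw [← toReal_enorm]
  refine (ENNReal.toReal_mono (ENNReal.mul_ne_top hE hfin) h3).trans (le_of_eq ?_)
  rw [ENNReal.toReal_mul, ENNReal.toReal_add (ENNReal.add_ne_top.1 hfin).1 hβF.2.ne,
    ENNReal.toReal_add hαG.2.ne (ENNReal.mul_ne_top (by simp) hGf), ENNReal.toReal_mul,
    toReal_enorm, integral_norm_eq_lintegral_enorm hαG.1, integral_norm_eq_lintegral_enorm hβF.1]
  rfl

/-- One of three pairs of test functions detects the oscillation of `b` on `F`. -/
theorem exists_test_functions (hk : Measurable (Function.uncurry k))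
    (hN : NearConst k F G K₀ E) (hE : E ≠ ∞) (hF : MeasurableSet F) (hG : MeasurableSet G)
    {m : ℝ} (hm : 0 < m) (hFm : volume.real F = m) (hGm : volume.real G = m) {b : Rn n → ℂ}
    (hb : Measurable b) (hbF : IntegrableOn b F volume) (hbG : IntegrableOn b G volume)
    (hEK : 10 * E.toReal ≤ ‖K₀‖ * m) :
    ∃ ψ φ : Rn n → ℂ, Measurable ψ ∧ Measurable φ ∧ (∀ x, ‖ψ x‖ ≤ 1) ∧ (∀ x, ‖φ x‖ ≤ 1) ∧
      (∀ x ∉ F, ψ x = 0) ∧ (∀ x ∉ G, φ x = 0) ∧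
      ‖K₀‖ * m * (∫ y in F, ‖b y - ⨍ z in F, b z‖) ≤ 10 * (commForm b k F G ψ φ).re := by
  have hFf : volume F ≠ ∞ := fun h => by simp [Measure.real, h] at hFm; exact hm.ne hFm
  have hGf : volume G ≠ ∞ := fun h => by simp [Measure.real, h] at hGm; exact hm.ne hGm
  have hfF : IsFiniteMeasure (volume.restrict F) := ⟨by simpa using hFf.lt_top⟩
  have hfG : IsFiniteMeasure (volume.restrict G) := ⟨by simpa using hGf.lt_top⟩
  have hmc : (m : ℂ) ≠ 0 := by exact_mod_cast hm.ne'
  set β := ⨍ z in F, b z with hβ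
  set α := ⨍ z in G, b z with hα
  have hβm : ∫ y in F, b y = m * β := by
    rw [hβ, setAverage_eq, hFm, Complex.real_smul, Complex.ofReal_inv, mul_inv_cancel_left₀ hmc]
  have hαm : ∫ y in G, b y = m * α := by
    rw [hα, setAverage_eq, hGm, Complex.real_smul, Complex.ofReal_inv, mul_inv_cancel_left₀ hmc]
  set O := ∫ y in F, ‖b y - β‖
  set O' := ∫ x in G, ‖b x - α‖
  have hO : 0 ≤ O := integral_nonneg fun _ => norm_nonneg _
  have hO' : 0 ≤ O' := integral_nonneg fun _ => norm_nonneg _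
  set D := O' + ‖α - β‖ * m + O with hD
  set e := E.toReal
  have he : 0 ≤ e := ENNReal.toReal_nonneg
  have hD0 : 0 ≤ D := by positivity
  have main : ∀ ψ φ : Rn n → ℂ, Measurable ψ → Measurable φ → (∀ x, ‖ψ x‖ ≤ 1) →
      (∀ x, ‖φ x‖ ≤ 1) →
      ‖K₀‖ * ‖(∫ x in G, b x * φ x) * (∫ y in F, ψ y) - (∫ x in G, φ x) * ∫ y in F, b y * ψ y‖ ≤
        ‖commForm b k F G ψ φ‖ + e * D := by
    intro ψ φ h1 h2 h3 h4
    have := norm_commForm_sub_le hk hN hE hF hG hFf hGf hb hbF hbG h1 h2 h3 h4 α β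
    rw [hGm] at this
    rw [← norm_mul]
    have h5 := norm_sub_norm_le (K₀ * ((∫ x in G, b x * φ x) * (∫ y in F, ψ y) -
      (∫ x in G, φ x) * ∫ y in F, b y * ψ y)) (commForm b k F G ψ φ)
    linarith
  -- The pair `(ψ₁, φ₁)` sees the difference of the two means; `(ψ₂, φ₁)` and `(ψ₁, φ₂)` see the
  -- oscillations on `F` and on `G`, up to that difference. All three quantities are needed, because
  -- they all occur in the freezing error.
  let ψ₁ : Rn n → ℂ := F.indicator 1
  let φ₁ : Rn n → ℂ := G.indicator 1
  let ψ₂ : Rn n → ℂ := F.indicator fun y => phase (b y - β)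
  let φ₂ : Rn n → ℂ := G.indicator fun x => phase (b x - α)
  have ind1 : ∀ (H : Set (Rn n)) (w : Rn n → ℂ), (∀ x, ‖w x‖ ≤ 1) → ∀ x, ‖H.indicator w x‖ ≤ 1 :=
    fun H w hw x => (norm_indicator_le_norm_self _ _).trans (hw x)
  have ψ₁m : Measurable ψ₁ := measurable_one.indicator hF
  have φ₁m : Measurable φ₁ := measurable_one.indicator hG
  have ψ₂m : Measurable ψ₂ := (measurable_phase.comp (hb.sub measurable_const)).indicator hF
  have φ₂m : Measurable φ₂ := (measurable_phase.comp (hb.sub measurable_const)).indicator hG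
  have ψ₁1 : ∀ x, ‖ψ₁ x‖ ≤ 1 := ind1 _ _ (by simp)
  have φ₁1 : ∀ x, ‖φ₁ x‖ ≤ 1 := ind1 _ _ (by simp)
  have ψ₂1 : ∀ x, ‖ψ₂ x‖ ≤ 1 := ind1 _ _ fun x => norm_phase_le _
  have φ₂1 : ∀ x, ‖φ₂ x‖ ≤ 1 := ind1 _ _ fun x => norm_phase_le _
  have one_int : ∀ {H : Set (Rn n)}, MeasurableSet H → volume.real H = m →
      ∫ x in H, H.indicator (1 : Rn n → ℂ) x = m := by
    intro H hH hHm
    rw [setIntegral_indicator hH, Set.inter_self]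
    simp [hHm]
  have b_int : ∀ {H : Set (Rn n)}, MeasurableSet H →
      ∫ x in H, b x * H.indicator (1 : Rn n → ℂ) x = ∫ x in H, b x := by
    intro H hH
    refine setIntegral_congr_fun hH fun x hx => ?_
    simp [hx]
  have ph_int : ∀ {H : Set (Rn n)}, MeasurableSet H → volume H ≠ ∞ → IntegrableOn b H volume →
      ∀ γ : ℂ, ∫ x in H, b x * H.indicator (fun y => phase (b y - γ)) x =
        ((∫ x in H, ‖b x - γ‖ : ℝ) : ℂ) + γ * ∫ x in H, H.indicator (fun y => phase (b y - γ)) x := by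
    intro H hH hHf hbH γ
    have hfH : IsFiniteMeasure (volume.restrict H) := ⟨by simpa using hHf.lt_top⟩
    have hI : IntegrableOn (H.indicator fun y => phase (b y - γ)) H volume :=
      Integrable.of_bound
        ((measurable_phase.comp (hb.sub measurable_const)).indicator hH).aestronglyMeasurable 1
        (ae_of_all _ (ind1 _ _ fun x => norm_phase_le _))
    have hI2 : IntegrableOn (fun x => ((‖b x - γ‖ : ℝ) : ℂ)) H volume :=
      (hbH.sub (integrableOn_const hHf)).norm.ofReal
    rw [← integral_complex_ofReal, ← integral_const_mul, ← integral_add hI2 (hI.const_mul γ)]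
    refine setIntegral_congr_fun hH fun x hx => ?_
    simp only [Set.indicator_of_mem hx, ← phase_mul_self]
    ring
  have P_le : ∀ {H : Set (Rn n)}, volume H ≠ ∞ → volume.real H = m → ∀ w : Rn n → ℂ,
      (∀ x, ‖w x‖ ≤ 1) → ‖∫ x in H, w x‖ ≤ m := by
    intro H hHf hHm w hw
    have := norm_setIntegral_le_of_norm_le_const (μ := volume) hHf.lt_top (f := w) (C := 1)
      (fun x _ => hw x)
    rwa [hHm, one_mul] at this
  have t₁ := main ψ₁ φ₁ ψ₁m φ₁m ψ₁1 φ₁1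
  have t₂ := main ψ₂ φ₁ ψ₂m φ₁m ψ₂1 φ₁1
  have t₃ := main ψ₁ φ₂ ψ₁m φ₂m ψ₁1 φ₂1
  rw [b_int hG, b_int hF, one_int hF hFm, one_int hG hGm, hαm, hβm] at t₁
  rw [b_int hG, one_int hG hGm, hαm, ph_int hF hFf hbF] at t₂
  rw [b_int hF, one_int hF hFm, hβm, ph_int hG hGf hbG] at t₃
  change _ * ‖_ * (∫ y in F, ψ₂ y) - _ * ((O : ℂ) + _ * ∫ y in F, ψ₂ y)‖ ≤ _ at t₂
  change _ * ‖((O' : ℂ) + _ * ∫ y in G, φ₂ y) * _ - (∫ y in G, φ₂ y) * _‖ ≤ _ at t₃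
  have hP := P_le hFf hFm ψ₂ ψ₂1
  have hP' := P_le hGf hGm φ₂ φ₂1
  set P := ∫ y in F, ψ₂ y
  set P' := ∫ y in G, φ₂ y
  have n₁ : ‖(m : ℂ) * α * m - m * (m * β)‖ = m * (‖α - β‖ * m) := by
    rw [show (m : ℂ) * α * m - m * (m * β) = m * ((α - β) * m) by ring, norm_mul, norm_mul,
      Complex.norm_real, Real.norm_of_nonneg hm.le]
  have n₂ : m * O - m * (‖α - β‖ * m) ≤ ‖(m : ℂ) * α * P - m * (O + β * P)‖ := by
    have hrev : ‖(m : ℂ) * α * P - m * (O + β * P)‖ = ‖(m : ℂ) * O - m * ((α - β) * P)‖ := by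
      rw [← norm_neg]; congr 1; ring
    rw [hrev]
    refine le_trans ?_ (norm_sub_norm_le _ _)
    rw [norm_mul, norm_mul, norm_mul, Complex.norm_real, Complex.norm_real,
      Real.norm_of_nonneg hm.le, Real.norm_of_nonneg hO]
    gcongr
  have n₃ : m * O' - m * (‖α - β‖ * m) ≤ ‖((O' : ℂ) + α * P') * m - P' * (m * β)‖ := by
    rw [show ((O' : ℂ) + α * P') * m - P' * (m * β) = m * O' - m * ((β - α) * P') by ring]
    refine le_trans ?_ (norm_sub_norm_le _ _)
    rw [norm_mul, norm_mul, norm_mul, Complex.norm_real, Complex.norm_real,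
      Real.norm_of_nonneg hm.le, Real.norm_of_nonneg hO', norm_sub_rev β α]
    gcongr
  have hK : 0 ≤ ‖K₀‖ := norm_nonneg _
  have t₂' := (mul_le_mul_of_nonneg_left n₂ hK).trans t₂
  have t₃' := (mul_le_mul_of_nonneg_left n₃ hK).trans t₃
  rw [n₁] at t₁
  -- The weights `3, 1, 1` cancel the two negative copies of the difference of the means and leave
  -- exactly `D`. The total error is `5 e D`, at most half of the left side, so `3 x + y + z` for
  -- the three form values is at least half of it and one of them is at least a tenth.
  have hsum : ‖K₀‖ * m * D ≤ 3 * ‖commForm b k F G ψ₁ φ₁‖ + ‖commForm b k F G ψ₂ φ₁‖ +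
      ‖commForm b k F G ψ₁ φ₂‖ + 5 * (e * D) := by
    rw [hD] at t₁ t₂' t₃' ⊢
    linarith
  have habs : 10 * e * D ≤ ‖K₀‖ * m * D := by gcongr
  have hfinal : ∀ ψ φ : Rn n → ℂ, Measurable ψ → Measurable φ → (∀ x, ‖ψ x‖ ≤ 1) →
      (∀ x, ‖φ x‖ ≤ 1) → (∀ x ∉ F, ψ x = 0) → (∀ x ∉ G, φ x = 0) →
      ‖K₀‖ * m * D ≤ 10 * ‖commForm b k F G ψ φ‖ →
      ∃ ψ φ : Rn n → ℂ, Measurable ψ ∧ Measurable φ ∧ (∀ x, ‖ψ x‖ ≤ 1) ∧ (∀ x, ‖φ x‖ ≤ 1) ∧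
        (∀ x ∉ F, ψ x = 0) ∧ (∀ x ∉ G, φ x = 0) ∧
        ‖K₀‖ * m * O ≤ 10 * (commForm b k F G ψ φ).re := by
    intro ψ φ h1 h2 h3 h4 h5 h6 h7
    -- A unimodular factor on `ψ` (or zero, if the form vanishes) turns the modulus of the form into
    -- its real part.
    set u := phase (commForm b k F G ψ φ) with hu
    refine ⟨fun y => u * ψ y, φ, h1.const_mul u, h2, fun x => ?_, h4, fun x hx => ?_, h6, ?_⟩
    · rw [norm_mul]; exact mul_le_one₀ (norm_phase_le _) (norm_nonneg _) (h3 x)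
    · simp only [h5 x hx, mul_zero]
    · have h8 : commForm b k F G (fun y => u * ψ y) φ = u * commForm b k F G ψ φ := by
        unfold commForm
        rw [← integral_const_mul]
        refine integral_congr_ae (ae_of_all _ fun z => ?_)
        simp only
        ring
      rw [h8, hu, phase_mul_self, Complex.ofReal_re]
      refine le_trans ?_ h7
      gcongr
      rw [hD]
      have : 0 ≤ ‖α - β‖ * m := by positivity
      linarith
  have offF : ∀ w : Rn n → ℂ, ∀ x ∉ F, F.indicator w x = 0 := fun w x hx =>
    Set.indicator_of_notMem hx _
  have offG : ∀ w : Rn n → ℂ, ∀ x ∉ G, G.indicator w x = 0 := fun w x hx =>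
    Set.indicator_of_notMem hx _
  by_cases c₁ : ‖K₀‖ * m * D ≤ 10 * ‖commForm b k F G ψ₁ φ₁‖
  · exact hfinal _ _ ψ₁m φ₁m ψ₁1 φ₁1 (offF _) (offG _) c₁
  by_cases c₂ : ‖K₀‖ * m * D ≤ 10 * ‖commForm b k F G ψ₂ φ₁‖
  · exact hfinal _ _ ψ₂m φ₁m ψ₂1 φ₁1 (offF _) (offG _) c₂
  refine hfinal _ _ ψ₁m φ₂m ψ₁1 φ₂1 (offF _) (offG _) ?_
  push Not at c₁ c₂
  linarith

end

/-- On every ball, paired with a suitable disjoint ball at a comparable distance, the kernel is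
nearly equal to a constant of the largest possible size. -/
def LocallyNearConst (k : Rn n → Rn n → ℂ) : Prop :=
  ∀ ε : ℝ, 0 < ε → ∃ A a : ℝ, 1 ≤ A ∧ 0 < a ∧ ∀ (c : Rn n) (ρ : ℝ), 0 < ρ → ∃ (c' : Rn n) (K₀ : ℂ),
    Disjoint (Metric.closedBall c ρ) (Metric.closedBall c' ρ) ∧
    Metric.closedBall c' ρ ⊆ Metric.closedBall c (A * ρ) ∧ a ≤ ‖K₀‖ * ρ ^ n ∧
    NearConst k (Metric.closedBall c ρ) (Metric.closedBall c' ρ) K₀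
      (ENNReal.ofReal (ε * ‖K₀‖ * ρ ^ n))

theorem ExtendsCommutator.congr_ae {T : (Rn n → ℂ) → (Rn n → ℂ)} {p q : ℝ≥0∞}
    [Fact (1 ≤ p)] [Fact (1 ≤ q)] (hT : IsLpBounded T)
    {S : Lp ℂ p (volume : Measure (Rn n)) →L[ℂ] Lp ℂ q (volume : Measure (Rn n))}
    {b b' : Rn n → ℂ} (hbb : b =ᵐ[volume] b') (hS : ExtendsCommutator b T S) :
    ExtendsCommutator b' T S := by
  rintro f ⟨s, h1, h2, hs⟩
  have hbf : (fun y => b y * f y) =ᵐ[volume] fun y => b' y * f y := by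
    filter_upwards [hbb] with y hy; rw [hy]
  have hs' := hs.ae_eq hbf.symm
  filter_upwards [hS f ⟨s, h1, h2, hs'⟩, hbb, hT.congr_ae h1 h2 hs' hbf] with x h3 h4 h5
  rw [h3, commutator, commutator, h4, h5]

theorem oscBall_congr_ae {b b' : Rn n → ℂ} (hbb : b =ᵐ[volume] b') (c : Rn n) (ρ : ℝ) :
    oscBall b c ρ = oscBall b' c ρ := by
  have h : b =ᵐ[volume.restrict (Metric.closedBall c ρ)] b' := ae_restrict_of_ae hbb
  unfold oscBall
  rw [setAverage_congr_fun Metric.isClosed_closedBall.measurableSet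
    (by filter_upwards [hbb] with x hx _ using hx)]
  refine integral_congr_ae ?_
  filter_upwards [h] with x hx
  rw [hx]

/-- Combines the geometric input on pairs of balls with the three test pairs and the kernel
representation of `S`. A measurable representative of `b` is used, which changes neither the
commutator nor the oscillations. -/
theorem exists_hasTestFunctions {k : Rn n → Rn n → ℂ} {T : (Rn n → ℂ) → (Rn n → ℂ)} {p q : ℝ≥0∞}
    [Fact (1 ≤ p)] [Fact (1 ≤ q)] (hp1 : 1 < p) (hp : p < ∞)
    {S : Lp ℂ p (volume : Measure (Rn n)) →L[ℂ] Lp ℂ q (volume : Measure (Rn n))}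
    {b : Rn n → ℂ} (hT : IsLpBounded T) (hkT : OffDiagonalKernel T k) (hN : LocallyNearConst k)
    (hS : ExtendsCommutator b T S) (hb : LocallyIntegrable b volume) :
    ∃ C A : ℝ, 0 ≤ C ∧ 0 < A ∧ HasTestFunctions b S C A := by
  obtain ⟨b', hb'm, hbb⟩ := hb.aestronglyMeasurable
  have hb' : Measurable b' := hb'm.measurable
  have hbl : LocallyIntegrable b' volume := hb.congr hbb
  have hS' := hS.congr_ae hT hbb
  set ω := volume.real (Metric.closedBall (0 : Rn n) 1)
  have hω : 0 < ω := ENNReal.toReal_pos (Metric.measure_closedBall_pos _ _ one_pos).ne'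
    measure_closedBall_lt_top.ne
  -- With `m = ρ ^ n * ω`, this accuracy gives equality in the smallness condition of
  -- `exists_test_functions`.
  obtain ⟨A, a, hA, ha, H⟩ := hN (ω / 10) (by positivity)
  refine ⟨10 / (a * ω), A, by positivity, by linarith, fun c ρ hρ => ?_⟩
  obtain ⟨c', K₀, hdisj, hsub, haK, hnear⟩ := H c ρ hρ
  have hm : 0 < ρ ^ n * ω := by positivity
  obtain ⟨ψ, φ, hψ, hφ, hψ1, hφ1, hψF, hφG, hle⟩ := exists_test_functions hkT.measurable hnear
    ENNReal.ofReal_ne_top Metric.isClosed_closedBall.measurableSet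
    Metric.isClosed_closedBall.measurableSet hm (volume_real_closedBall c hρ.le)
    (volume_real_closedBall c' hρ.le) hb'
    (hbl.integrableOn_isCompact (isCompact_closedBall c ρ))
    (hbl.integrableOn_isCompact (isCompact_closedBall c' ρ)) (by
      rw [ENNReal.toReal_ofReal (by positivity)]
      apply le_of_eq
      ring)
  have hsub' : Metric.closedBall c ρ ⊆ Metric.closedBall c (A * ρ) :=
    Metric.closedBall_subset_closedBall (by nlinarith)
  refine ⟨ψ, φ, hψ, hφ, hψ1, hφ1, fun x hx => hψF x fun h => hx (hsub' h),
    fun x hx => hφG x fun h => hx (hsub h), fun f hf => ?_⟩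
  rw [integral_commutator_mul_eq hp1 hp hT hkT hS' hnear ENNReal.ofReal_ne_top
    (isCompact_closedBall c ρ) (isCompact_closedBall c' ρ) hdisj hb' hbl hψ hφ hψ1 hφ1 hψF hφG hf,
    oscBall_congr_ae hbb]
  change ‖K₀‖ * (ρ ^ n * ω) * oscBall b' c ρ ≤ _ at hle
  change _ ≤ _ * (commForm b' k _ _ ψ φ).re
  rw [div_mul_eq_mul_div, le_div_iff₀ (by positivity)]
  refine le_trans ?_ hle
  have h1 := oscBall_nonneg b' c ρ
  have h2 : a * ω ≤ ‖K₀‖ * (ρ ^ n * ω) := by nlinarith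
  nlinarith

/-- Boundedness of the commutator forces `b` into `Lʳ` modulo constants. -/
theorem memLpModConst_of_commutatorBounded (hn : 0 < n) {k : Rn n → Rn n → ℂ}
    {T : (Rn n → ℂ) → (Rn n → ℂ)} {p q r : ℝ≥0∞} [Fact (1 ≤ p)] [Fact (1 ≤ q)]
    [ENNReal.HolderTriple r p q] (hr1 : 1 ≤ r) (hq : 1 < q) (hqp : q < p) (hp : p < ∞)
    {b : Rn n → ℂ} (hT : IsLpBounded T) (hkT : OffDiagonalKernel T k) (hN : LocallyNearConst k)
    (hb : LocallyIntegrable b volume) (hS : CommutatorBounded b T p q) : MemLpModConst b r := by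
  obtain ⟨S, hS⟩ := hS
  obtain ⟨C, A, hC, hA, H⟩ := exists_hasTestFunctions (hq.trans hqp) hp hT hkT hN hS hb
  exact H.memLpModConst hn hr1 hq hqp hp hb hC hA

end CZCommutator

/-! ### Regular kernels. -/

namespace CZCommutator

variable {n : ℕ}

theorem IsModulus.exists_forall_le {ω : ℝ → ℝ} (hω : IsModulus ω)
    (h0 : Tendsto ω (𝓝[>] 0) (𝓝 0)) {ε : ℝ} (hε : 0 < ε) :
    ∃ δ : ℝ, 0 < δ ∧ δ < 1 ∧ ∀ t, 0 ≤ t → t ≤ δ → ω t ≤ ε := by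
  have h1 : ∀ᶠ t in 𝓝[>] (0 : ℝ), ω t < ε := h0.eventually_lt_const hε
  have h2 : ∀ᶠ t in 𝓝[>] (0 : ℝ), t ∈ Set.Ioo (0 : ℝ) 1 := Ioo_mem_nhdsGT one_pos
  obtain ⟨δ, h3, h4⟩ := (h1.and h2).exists
  exact ⟨δ, h4.1, h4.2, fun t ht0 ht => (hω.1 ⟨ht0, ht.trans_lt h4.2⟩ ⟨h4.1.le, h4.2⟩ ht).trans h3.le⟩

/-- Otherwise, by monotonicity, `ω` stays above some `ε > 0` on `(0, 1)`, and `ω t / t` dominates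
the non-integrable `ε / t`. -/
theorem DiniCondition.tendsto {ω : ℝ → ℝ} (hω : IsModulus ω) (hD : DiniCondition ω) :
    Tendsto ω (𝓝[>] 0) (𝓝 0) := by
  rw [Metric.tendsto_nhdsWithin_nhds]
  intro ε hε
  suffices h : ∃ t ∈ Set.Ioo (0 : ℝ) 1, ω t < ε by
    obtain ⟨t, ht, htε⟩ := h
    refine ⟨t, ht.1, fun {x} hx hxt => ?_⟩
    rw [dist_zero_right, Real.norm_of_nonneg (le_of_lt hx)] at hxt
    have hx1 : x ∈ Set.Ico (0 : ℝ) 1 := ⟨le_of_lt hx, hxt.trans ht.2⟩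
    rw [dist_zero_right, Real.norm_of_nonneg (hω.2 x hx1)]
    exact (hω.1 hx1 ⟨ht.1.le, ht.2⟩ hxt.le).trans_lt htε
  by_contra! hcon
  have h1 : IntegrableOn (fun t : ℝ => ε * t⁻¹) (Set.Ioo 0 1) := by
    refine Integrable.mono' hD (by fun_prop) ?_
    filter_upwards [ae_restrict_mem measurableSet_Ioo] with t ht
    have ht0 : 0 < t := ht.1
    rw [Real.norm_of_nonneg (by positivity), div_eq_mul_inv]
    gcongr
    exact hcon t ht
  have h2 : IntegrableOn (fun t : ℝ => t⁻¹) (Set.Ioo 0 1) := by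
    have := Integrable.const_mul h1 ε⁻¹
    refine this.congr (ae_of_all _ fun t => ?_)
    simp only
    field_simp
  have h3 : IntervalIntegrable (fun x : ℝ => x⁻¹) volume 0 1 := by
    rw [intervalIntegrable_iff_integrableOn_Ioo_of_le zero_le_one]
    exact h2
  rw [intervalIntegrable_inv_iff] at h3
  simp at h3

/-- A kernel with a vanishing modulus of continuity is continuous off the diagonal. -/
theorem IsCZKernel.continuousOn {K : Rn n → Rn n → ℂ} {ω : ℝ → ℝ} {C : ℝ} (hK : IsCZKernel K ω C)
    (h0 : Tendsto ω (𝓝[>] 0) (𝓝 0)) :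
    ContinuousOn (Function.uncurry K) {z : Rn n × Rn n | z.1 ≠ z.2} := by
  rintro ⟨x, y⟩ hxy
  refine ContinuousAt.continuousWithinAt ?_
  have hxy : x ≠ y := hxy
  have hd : 0 < ‖x - y‖ := norm_pos_iff.2 (sub_ne_zero.2 hxy)
  rw [Metric.continuousAt_iff]
  intro ε hε
  set d := ‖x - y‖
  set D := C / (d / 2) ^ n with hD
  have hDp : 0 < D := div_pos hK.const_pos (by positivity)
  obtain ⟨δ, hδ0, hδ1, hδ⟩ := hK.modulus.exists_forall_le h0 (ε := ε / (4 * D)) (by positivity)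
  refine ⟨min (d / 8) (δ * d / 4), by positivity, ?_⟩
  rintro ⟨x', y'⟩ hlt
  rw [Prod.dist_eq, max_lt_iff] at hlt
  obtain ⟨hx, hy⟩ := hlt
  simp only at hx hy
  rw [dist_comm, dist_eq_norm] at hx hy
  obtain ⟨hx1, hx2⟩ := lt_min_iff.1 hx
  obtain ⟨hy1, hy2⟩ := lt_min_iff.1 hy
  have hxy' : d / 2 ≤ ‖x - y'‖ := by
    have : ‖x - y‖ ≤ ‖x - y'‖ + ‖y - y'‖ := by
      rw [norm_sub_rev y y']
      exact norm_sub_le_norm_sub_add_norm_sub x y' y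
    change d ≤ _ at this
    linarith
  have key : ∀ e s : ℝ, d / 2 ≤ e → 0 ≤ s → s < δ * d / 4 → C / e ^ n * ω (s / e) ≤ ε / 4 := by
    intro e s he hs hsδ
    have he0 : 0 < e := by linarith
    have h1 : ω (s / e) ≤ ε / (4 * D) := by
      refine hδ _ (by positivity) ?_
      rw [div_le_iff₀ he0]
      nlinarith
    have h2 : C / e ^ n ≤ D := by
      rw [hD]
      have := hK.const_pos
      gcongr
    have h3 : 0 ≤ ω (s / e) := by
      refine hK.modulus.2 _ ⟨by positivity, ?_⟩
      rw [div_lt_one he0]; nlinarith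
    calc C / e ^ n * ω (s / e) ≤ D * (ε / (4 * D)) := by gcongr
      _ = ε / 4 := by field_simp
  have r1 := hK.regular x x' y' (by linarith)
  have r2 := hK.regular y y' x (by rw [norm_sub_rev y x]; change _ < 1 / 2 * d; linarith)
  have k1 := key ‖x - y'‖ ‖x - x'‖ hxy' (norm_nonneg _) hx2
  have k2 := key ‖y - x‖ ‖y - y'‖ (by rw [norm_sub_rev]; change _ ≤ d; linarith) (norm_nonneg _) hy2
  rw [dist_comm, dist_eq_norm]
  change ‖K x y - K x' y'‖ < ε
  calc ‖K x y - K x' y'‖ ≤ ‖K x y - K x y'‖ + ‖K x y' - K x' y'‖ :=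
        norm_sub_le_norm_sub_add_norm_sub _ _ _
    _ < ε := by
        have a1 := norm_nonneg (K y' x - K y' x')
        have a2 := norm_nonneg (K y x - K y' x)
        linarith

/-- The kernel with the value zero on the diagonal. -/
noncomputable def offDiag (K : Rn n → Rn n → ℂ) (x y : Rn n) : ℂ :=
  open Classical in if x = y then 0 else K x y

theorem offDiag_of_ne {K : Rn n → Rn n → ℂ} {x y : Rn n} (h : x ≠ y) : offDiag K x y = K x y := by
  simp [offDiag, h]

/-- Away from the origin the integrand is comparable to `(1 + |z|)^(-n u)`, which is integrable
because `n u > n`. -/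
theorem lintegral_inv_norm_pow_lt_top {δ u : ℝ} (hn : 0 < n) (hδ : 0 < δ) (hu : 1 < u) :
    ∫⁻ z in {z : Rn n | δ ≤ ‖z‖}, ENNReal.ofReal ((‖z‖ ^ n)⁻¹) ^ u < ∞ := by
  have hn' : (0 : ℝ) < n := by exact_mod_cast hn
  have hint := integrable_one_add_norm (E := Rn n) (μ := volume) (r := n * u) (by
    simp only [finrank_euclideanSpace, Fintype.card_fin]
    nlinarith)
  have hint2 := hint.const_mul ((1 + δ⁻¹) ^ (n * u))
  refine lt_of_le_of_lt ?_ hint2.lintegral_lt_top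
  refine le_trans ?_ (setLIntegral_le_lintegral {z : Rn n | δ ≤ ‖z‖} _)
  refine setLIntegral_mono' (measurableSet_le measurable_const measurable_norm) fun z hz => ?_
  have hz : δ ≤ ‖z‖ := hz
  have hz0 : 0 < ‖z‖ := hδ.trans_le hz
  rw [ENNReal.ofReal_rpow_of_pos (by positivity)]
  refine ENNReal.ofReal_le_ofReal ?_
  rw [Real.rpow_neg (by positivity), ← div_eq_mul_inv, ← Real.div_rpow (by positivity)
    (by positivity), Real.rpow_mul (by positivity), Real.rpow_natCast]
  refine Real.rpow_le_rpow (by positivity) ?_ (by linarith)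
  rw [← inv_pow]
  refine pow_le_pow_left₀ (by positivity) ?_ n
  rw [le_div_iff₀ (by positivity), ← sub_nonneg]
  have h1 : ‖z‖⁻¹ ≤ δ⁻¹ := inv_anti₀ hδ hz
  have : 1 + δ⁻¹ - ‖z‖⁻¹ * (1 + ‖z‖) = δ⁻¹ - ‖z‖⁻¹ := by field_simp; ring
  rw [this]; linarith

theorem nontrivial_of_pos (hn : 0 < n) : Nontrivial (Rn n) := by
  have : Nonempty (Fin n) := ⟨⟨0, hn⟩⟩
  infer_instance

theorem offDiag_ae_eq (hn : 0 < n) (K : Rn n → Rn n → ℂ) (x : Rn n) :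
    ∀ᵐ y, offDiag K x y = K x y := by
  have := nontrivial_of_pos hn
  filter_upwards [compl_mem_ae_iff.2 (measure_singleton (μ := (volume : Measure (Rn n))) x)]
    with y hy
  exact offDiag_of_ne fun h => hy h.symm

theorem offDiag_ae_eq_left (hn : 0 < n) (K : Rn n → Rn n → ℂ) (y : Rn n) :
    ∀ᵐ x, offDiag K x y = K x y := by
  have := nontrivial_of_pos hn
  filter_upwards [compl_mem_ae_iff.2 (measure_singleton (μ := (volume : Measure (Rn n))) y)]
    with x hx
  exact offDiag_of_ne fun h => hx h

/-- The size condition gives the majorant `C |z|⁻ⁿ`. Regularity makes the kernel continuous off the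
diagonal, hence measurable, and it serves as its own continuous approximation on products of
disjoint compact sets. -/
theorem IsDiniOperator.offDiagonalKernel (hn : 0 < n) {T : (Rn n → ℂ) → (Rn n → ℂ)}
    {K : Rn n → Rn n → ℂ} (hT : IsDiniOperator T K) : OffDiagonalKernel T (offDiag K) := by
  obtain ⟨-, ⟨ω, C, hK, hD⟩, hker⟩ := hT
  have hC := hK.const_pos
  have h0 := hD.tendsto hK.modulus
  have hcont := hK.continuousOn h0
  have hopen : IsOpen {z : Rn n × Rn n | z.1 ≠ z.2} :=
    isOpen_ne_fun continuous_fst continuous_snd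
  have hmeas : Measurable (Function.uncurry (offDiag K)) := by
    classical
    have h1 := hcont.measurable_piecewise (g := fun _ => 0) continuousOn_const hopen.measurableSet
    convert h1 using 1
    ext ⟨x, y⟩
    by_cases h : x = y
    · simp [offDiag, h]
    · simp [offDiag, h]
  refine ⟨hmeas, ?_, ?_, ?_⟩
  · intro F hF f hf hfF
    have hsupp : tsupport f ⊆ F := by
      refine closure_minimal (fun x hx => ?_) hF.isClosed
      by_contra hxF
      exact hx (hfF x hxF)
    have hcs : HasCompactSupport f := hF.of_isClosed_subset (isClosed_tsupport f) hsupp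
    have hf2 : MemLp f 2 volume := by
      have : f = F.indicator f := by
        ext x; by_cases hx : x ∈ F
        · simp [hx]
        · simp [hx, hfF x hx]
      rw [this, memLp_indicator_iff_restrict hF.measurableSet]
      have : IsFiniteMeasure (volume.restrict F) := ⟨by simpa using hF.measure_lt_top⟩
      exact (hf.restrict F).mono_exponent le_top
    filter_upwards [hker f hf2 hcs] with x hx hxF
    rw [hx fun h => hxF (hsupp h)]
    refine integral_congr_ae ?_
    filter_upwards [offDiag_ae_eq hn K x] with y hy
    rw [hy]
  -- The bound `2` on the exponents is arbitrary: every `u > 1` works.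
  · refine ⟨fun z => ENNReal.ofReal (C / ‖z‖ ^ n), by fun_prop, fun x y => ?_, 2, one_lt_two,
      fun u hu _ => ?_⟩
    · by_cases h : x = y
      · simp [offDiag, h]
      · rw [offDiag_of_ne h, ← ofReal_norm]
        exact ENNReal.ofReal_le_ofReal (hK.size x y h)
    · have h1 := lintegral_inv_norm_pow_lt_top hn one_pos hu
      have h2 : ∀ z : Rn n, ENNReal.ofReal (C / ‖z‖ ^ n) ^ u =
          ENNReal.ofReal C ^ u * ENNReal.ofReal ((‖z‖ ^ n)⁻¹) ^ u := fun z => by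
        rw [div_eq_mul_inv, ENNReal.ofReal_mul hC.le, ENNReal.mul_rpow_of_nonneg _ _ (by linarith)]
      simp only [h2]
      rw [lintegral_const_mul' _ _ (ENNReal.rpow_ne_top_of_nonneg (by linarith)
        ENNReal.ofReal_ne_top)]
      exact ENNReal.mul_lt_top (ENNReal.rpow_lt_top_of_nonneg (by linarith)
        ENNReal.ofReal_ne_top) h1
  · intro F G _ _ hFG ε _
    refine ⟨offDiag K, fun _ => 0, hmeas, ?_, measurable_const, by simp, by simp⟩
    have hsub : F ×ˢ G ⊆ {z : Rn n × Rn n | z.1 ≠ z.2} := by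
      rintro ⟨x, y⟩ ⟨hx, hy⟩ h
      have h : x = y := h
      exact Set.disjoint_left.1 hFG hx (h ▸ hy)
    refine (hcont.mono hsub).congr fun z hz => ?_
    exact offDiag_of_ne (hsub hz)

/-- The near-constancy is measured in the mean over either variable, so null sets in each variable
do not matter. -/
theorem LocallyNearConst.congr {k k' : Rn n → Rn n → ℂ} (h1 : ∀ x, ∀ᵐ y, k x y = k' x y)
    (h2 : ∀ y, ∀ᵐ x, k x y = k' x y) (hk : LocallyNearConst k) : LocallyNearConst k' := by
  intro ε hε
  obtain ⟨A, a, hA, ha, H⟩ := hk ε hε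
  refine ⟨A, a, hA, ha, fun c ρ hρ => ?_⟩
  obtain ⟨c', K₀, h3, h4, h5, h6⟩ := H c ρ hρ
  refine ⟨c', K₀, h3, h4, h5, ⟨fun x hx => ?_, fun y hy => ?_⟩⟩
  · refine le_trans (le_of_eq (lintegral_congr_ae ?_)) (h6.left x hx)
    filter_upwards [ae_restrict_of_ae (h1 x)] with y hy
    rw [hy]
  · refine le_trans (le_of_eq (lintegral_congr_ae ?_)) (h6.right y hy)
    filter_upwards [ae_restrict_of_ae (h2 y)] with x hx
    rw [hx]

/-- Regular kernels with a lower bound are nearly constant on suitable pairs of balls. -/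
theorem IsCZKernel.locallyNearConst (hn : 0 < n) {K : Rn n → Rn n → ℂ} {ω : ℝ → ℝ} {C : ℝ}
    (hK : IsCZKernel K ω C) (h0 : Tendsto ω (𝓝[>] 0) (𝓝 0)) {c₀ : ℝ} (hc₀ : 0 < c₀)
    (hlow : ∀ (y : Rn n) (r : ℝ), 0 < r →
      ∃ x : Rn n, x ∉ Metric.ball y r ∧ 1 / (c₀ * r ^ n) ≤ ‖K x y‖) : LocallyNearConst K := by
  intro ε hε
  have hC := hK.const_pos
  set v := volume.real (Metric.closedBall (0 : Rn n) 1)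
  have hv : 0 < v := ENNReal.toReal_pos (Metric.measure_closedBall_pos _ _ one_pos).ne'
    measure_closedBall_lt_top.ne
  obtain ⟨δ, hδ0, hδ1, hδ⟩ := hK.modulus.exists_forall_le h0
    (ε := ε / (2 ^ (n + 1) * C * c₀ * v)) (by positivity)
  -- The separation of the two balls in units of `ρ`. The summand `2 / δ` makes the argument of `ω`
  -- at most `δ`; the `5` gives disjointness and the room required by the regularity condition.
  set N : ℝ := 5 + 2 / δ with hN
  have hNδ : 2 / δ ≤ N := by rw [hN]; linarith
  have hN5 : 5 ≤ N := by rw [hN]; have : 0 < 2 / δ := by positivity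
                         linarith
  have hN0 : 0 < N := by linarith
  -- Non-degeneracy only places `c'` far away; comparing its lower bound with the size condition
  -- shows that it is not too far, within `Λ N ρ`.
  set Λ : ℝ := max 1 (C * c₀) with hΛ
  have hΛ1 : 1 ≤ Λ := le_max_left _ _
  refine ⟨Λ * N + 1, 1 / (c₀ * N ^ n), by nlinarith, by positivity, fun c ρ hρ => ?_⟩
  obtain ⟨c', hc', hKc⟩ := hlow c (N * ρ) (by positivity)
  have hd1 : N * ρ ≤ ‖c' - c‖ := by
    rw [Metric.mem_ball, not_lt, dist_eq_norm] at hc'; exact hc'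
  have hd0 : 0 < ‖c' - c‖ := lt_of_lt_of_le (by positivity) hd1
  have hcc : c' ≠ c := fun h => by rw [h, sub_self, norm_zero] at hd0; exact lt_irrefl _ hd0
  have hd2 : ‖c' - c‖ ≤ Λ * N * ρ := by
    by_contra! hlt
    have h1 := hKc.trans (hK.size c' c hcc)
    rw [div_le_div_iff₀ (by positivity) (by positivity), one_mul] at h1
    have h2 : (Λ * N * ρ) ^ n < ‖c' - c‖ ^ n := pow_lt_pow_left₀ hlt (by positivity) hn.ne'
    have h3 : Λ ≤ Λ ^ n := le_self_pow₀ hΛ1 hn.ne'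
    have h4 : C * c₀ ≤ Λ ^ n := (le_max_right _ _).trans h3
    have h5 : C * (c₀ * (N * ρ) ^ n) ≤ (Λ * N * ρ) ^ n := by
      rw [mul_assoc Λ, mul_pow Λ, ← mul_assoc]
      gcongr
    linarith
  have hpt : ∀ x ∈ Metric.closedBall c' ρ, ∀ y ∈ Metric.closedBall c ρ,
      ‖K x y - K c' c‖ ≤ ε * ‖K c' c‖ / v := by
    intro x hx y hy
    rw [Metric.mem_closedBall, dist_comm, dist_eq_norm] at hx hy
    have key : ∀ e s : ℝ, N * ρ / 2 ≤ e → 0 ≤ s → s ≤ ρ →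
        C / e ^ n * ω (s / e) ≤ ε * ‖K c' c‖ / v / 2 := by
      intro e s he hs hsρ
      have he0 : 0 < e := lt_of_lt_of_le (by positivity) he
      have hse : s / e ≤ δ := by
        rw [div_le_iff₀ he0]
        have : 2 ≤ δ * N := by rwa [div_le_iff₀' hδ0] at hNδ
        nlinarith
      have h1 := hδ (s / e) (by positivity) hse
      have h3 : 0 ≤ ω (s / e) := hK.modulus.2 _ ⟨by positivity, hse.trans_lt hδ1⟩
      have h2 : C / e ^ n ≤ C * 2 ^ n * c₀ * ‖K c' c‖ := by
        calc C / e ^ n ≤ C / (N * ρ / 2) ^ n := by gcongr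
          _ = C * 2 ^ n * c₀ * (1 / (c₀ * (N * ρ) ^ n)) := by rw [div_pow]; field_simp
          _ ≤ _ := by gcongr
      calc C / e ^ n * ω (s / e) ≤ (C * 2 ^ n * c₀ * ‖K c' c‖) *
            (ε / (2 ^ (n + 1) * C * c₀ * v)) := by gcongr
        _ = _ := by rw [pow_succ]; field_simp
    have hcy : N * ρ / 2 ≤ ‖c' - y‖ := by
      have := norm_sub_le_norm_sub_add_norm_sub c' y c
      rw [norm_sub_rev y c] at this
      nlinarith
    have r1 := hK.regular c' x y (by nlinarith)
    have r2 := hK.regular c y c' (by rw [norm_sub_rev c c']; nlinarith)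
    have k1 := key ‖c' - y‖ ‖c' - x‖ hcy (norm_nonneg _) hx
    have k2 := key ‖c - c'‖ ‖c - y‖ (by rw [norm_sub_rev]; nlinarith) (norm_nonneg _) hy
    rw [norm_sub_rev]
    calc ‖K c' c - K x y‖ ≤ ‖K c' c - K c' y‖ + ‖K c' y - K x y‖ :=
          norm_sub_le_norm_sub_add_norm_sub _ _ _
      _ ≤ _ := by
          have a1 := norm_nonneg (K y c' - K y x)
          have a2 := norm_nonneg (K c c' - K y c')
          linarith
  have hbound : ∀ (w : Rn n) (f : Rn n → ℂ),
      (∀ z ∈ Metric.closedBall w ρ, ‖f z‖ ≤ ε * ‖K c' c‖ / v) →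
      ∫⁻ z in Metric.closedBall w ρ, ‖f z‖ₑ ≤ ENNReal.ofReal (ε * ‖K c' c‖ * ρ ^ n) := by
    intro w f hf
    calc ∫⁻ z in Metric.closedBall w ρ, ‖f z‖ₑ
        ≤ ∫⁻ z in Metric.closedBall w ρ, ENNReal.ofReal (ε * ‖K c' c‖ / v) := by
          refine setLIntegral_mono' Metric.isClosed_closedBall.measurableSet fun z hz => ?_
          rw [← ofReal_norm]
          exact ENNReal.ofReal_le_ofReal (hf z hz)
      _ = _ := by
          rw [setLIntegral_const, ← ofReal_measureReal measure_closedBall_lt_top.ne,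
            volume_real_closedBall _ hρ.le, ← ENNReal.ofReal_mul (by positivity)]
          congr 1
          change ε * ‖K c' c‖ / v * (ρ ^ n * v) = _
          field_simp
  refine ⟨c', K c' c, ?_, ?_, ?_, ⟨fun x hx => ?_, fun y hy => ?_⟩⟩
  · refine Metric.closedBall_disjoint_closedBall ?_
    rw [dist_comm, dist_eq_norm]; nlinarith
  · refine Metric.closedBall_subset_closedBall' ?_
    rw [dist_eq_norm]; nlinarith
  · calc 1 / (c₀ * N ^ n) = 1 / (c₀ * (N * ρ) ^ n) * ρ ^ n := by rw [mul_pow]; field_simp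
      _ ≤ _ := by gcongr
  · exact hbound c _ fun y hy => hpt x hx y hy
  · exact hbound c' _ fun x hx => hpt x hx y hy

end CZCommutator

/-! ### Homogeneous kernels and polar coordinates. -/

namespace CZCommutator

variable {n : ℕ}

/-- Integration in polar coordinates of a product of an angular and a radial function. -/
theorem lintegral_polar (hn : 0 < n) {W : Rn n → ℝ≥0∞} (hW : Measurable W) {g : ℝ → ℝ≥0∞}
    (hg : Measurable g) :
    ∫⁻ z : Rn n, W (‖z‖⁻¹ • z) * g ‖z‖ =
      (∫⁻ θ : Metric.sphere (0 : Rn n) 1, W θ ∂(sphereMeasure n)) *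
        ∫⁻ t : Set.Ioi (0 : ℝ), g t ∂(Measure.volumeIoiPow (n - 1)) := by
  have := nontrivial_of_pos hn
  have hmp := (volume : Measure (Rn n)).measurePreserving_homeomorphUnitSphereProd
  have hfr : Module.finrank ℝ (Rn n) = n := by simp
  rw [hfr] at hmp
  have h1 : ∫⁻ z : Rn n, W (‖z‖⁻¹ • z) * g ‖z‖ =
      ∫⁻ z : ({0}ᶜ : Set (Rn n)), W (‖(z : Rn n)‖⁻¹ • (z : Rn n)) * g ‖(z : Rn n)‖
        ∂((volume : Measure (Rn n)).comap (↑)) := by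
    rw [lintegral_subtype_comap (measurableSet_singleton (0 : Rn n)).compl
      (fun z => W (‖z‖⁻¹ • z) * g ‖z‖), restrict_compl_singleton]
  rw [h1, ← lintegral_prod_mul (f := fun θ : Metric.sphere (0 : Rn n) 1 => W θ)
      (g := fun t : Set.Ioi (0 : ℝ) => g t) (hW.comp measurable_subtype_coe).aemeasurable
      (hg.comp measurable_subtype_coe).aemeasurable,
    ← hmp.lintegral_comp_emb (Homeomorph.measurableEmbedding _)]
  simp only [homeomorphUnitSphereProd_apply_fst_coe, homeomorphUnitSphereProd_apply_snd_coe]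

theorem ae_polar (hn : 0 < n) {P : Rn n → Prop}
    (h : ∀ᵐ θ : Metric.sphere (0 : Rn n) 1 ∂(sphereMeasure n), P θ) :
    ∀ᵐ z : Rn n, P (‖z‖⁻¹ • z) := by
  have := nontrivial_of_pos hn
  have hmp := (volume : Measure (Rn n)).measurePreserving_homeomorphUnitSphereProd
  have h1 := hmp.quasiMeasurePreserving.ae (Measure.quasiMeasurePreserving_fst.ae h)
  rw [← restrict_compl_singleton (μ := (volume : Measure (Rn n))) 0,
    ae_restrict_iff_subtype (measurableSet_singleton (0 : Rn n)).compl]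
  filter_upwards [h1] with z hz
  rwa [homeomorphUnitSphereProd_apply_fst_coe] at hz

/-- The convolution kernel that is homogeneous of degree `-n` with the symbol `Ω` on the sphere. -/
noncomputable def homKernel (Ω : Rn n → ℂ) (z : Rn n) : ℂ := Ω (‖z‖⁻¹ • z) / ((‖z‖ ^ n : ℝ) : ℂ)

section

variable {Ω : Rn n → ℂ}

theorem measurable_homKernel (hΩ : Measurable Ω) : Measurable (homKernel Ω) := by
  unfold homKernel
  exact (hΩ.comp (by fun_prop)).div (by fun_prop)

theorem homKernel_smul {t : ℝ} (ht : 0 < t) (z : Rn n) :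
    homKernel Ω (t • z) = ((t ^ n : ℝ) : ℂ)⁻¹ * homKernel Ω z := by
  have h1 : ‖t • z‖⁻¹ • t • z = ‖z‖⁻¹ • z := by
    rw [norm_smul, Real.norm_of_nonneg ht.le, smul_smul]
    congr 1
    rw [mul_inv, mul_comm t⁻¹, mul_assoc, inv_mul_cancel₀ ht.ne', mul_one]
  rw [homKernel, homKernel, h1, norm_smul, Real.norm_of_nonneg ht.le, mul_pow]
  push_cast
  rw [div_eq_mul_inv, div_eq_mul_inv, mul_inv]
  ring

theorem enorm_homKernel (z : Rn n) :
    ‖homKernel Ω z‖ₑ = ‖Ω (‖z‖⁻¹ • z)‖ₑ * ENNReal.ofReal ((‖z‖ ^ n)⁻¹) := by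
  rw [homKernel, div_eq_mul_inv, enorm_mul, ← Complex.ofReal_inv]
  congr 1
  rw [← ofReal_norm, Complex.norm_real, Real.norm_of_nonneg (by positivity)]

theorem sphereMeasure_univ_ne_zero (hn : 0 < n) : sphereMeasure n Set.univ ≠ 0 := by
  have := nontrivial_of_pos hn
  rw [Ne, Measure.measure_univ_eq_zero]
  exact Measure.toSphere_ne_zero _

/-- The radial part of an integral in polar coordinates, compared with a radial integral. -/
theorem lintegral_radial (hn : 0 < n) {g : ℝ → ℝ≥0∞} (hg : Measurable g) :
    ∫⁻ z : Rn n, g ‖z‖ = sphereMeasure n Set.univ *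
        ∫⁻ t : Set.Ioi (0 : ℝ), g t ∂(Measure.volumeIoiPow (n - 1)) := by
  have := lintegral_polar hn (W := fun _ => 1) measurable_const hg
  simpa using this

theorem setLIntegral_homKernel_eq (hn : 0 < n) (hΩ : Measurable Ω) {I : Set ℝ}
    (hI : MeasurableSet I) {u : ℝ} (hu : 0 ≤ u) :
    ∫⁻ z in {z : Rn n | ‖z‖ ∈ I}, ‖homKernel Ω z‖ₑ ^ u =
      (∫⁻ θ : Metric.sphere (0 : Rn n) 1, ‖Ω θ‖ₑ ^ u ∂(sphereMeasure n)) *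
      ∫⁻ t : Set.Ioi (0 : ℝ), I.indicator (fun s => ENNReal.ofReal ((s ^ n)⁻¹) ^ u) t
        ∂(Measure.volumeIoiPow (n - 1)) := by
  have hg : Measurable (I.indicator fun s : ℝ => ENNReal.ofReal ((s ^ n)⁻¹) ^ u) :=
    Measurable.indicator (by fun_prop) hI
  rw [← lintegral_polar hn (W := fun x => ‖Ω x‖ₑ ^ u) (hΩ.enorm.pow_const u) hg,
    ← lintegral_indicator (s := {z : Rn n | ‖z‖ ∈ I}) (measurable_norm hI)]
  refine lintegral_congr fun z => ?_
  by_cases hz : ‖z‖ ∈ I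
  · rw [Set.indicator_of_mem (by exact hz), Set.indicator_of_mem hz, enorm_homKernel,
      ENNReal.mul_rpow_of_nonneg _ _ hu]
  · rw [Set.indicator_of_notMem (by exact hz), Set.indicator_of_notMem hz, mul_zero]

theorem setLIntegral_norm_eq (hn : 0 < n) {I : Set ℝ} (hI : MeasurableSet I) (u : ℝ) :
    ∫⁻ z in {z : Rn n | ‖z‖ ∈ I}, ENNReal.ofReal ((‖z‖ ^ n)⁻¹) ^ u =
      sphereMeasure n Set.univ *
      ∫⁻ t : Set.Ioi (0 : ℝ), I.indicator (fun s => ENNReal.ofReal ((s ^ n)⁻¹) ^ u) t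
        ∂(Measure.volumeIoiPow (n - 1)) := by
  have hg : Measurable (I.indicator fun s : ℝ => ENNReal.ofReal ((s ^ n)⁻¹) ^ u) :=
    Measurable.indicator (by fun_prop) hI
  rw [← lintegral_radial hn hg, ← lintegral_indicator (s := {z : Rn n | ‖z‖ ∈ I}) (measurable_norm hI)]
  refine lintegral_congr fun z => ?_
  by_cases hz : ‖z‖ ∈ I
  · rw [Set.indicator_of_mem (by exact hz), Set.indicator_of_mem hz]
  · rw [Set.indicator_of_notMem (by exact hz), Set.indicator_of_notMem hz]

/-- The radial factor is the same for every symbol. Its finiteness is read off from the constant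
symbol, because the sphere has nonzero measure, so it never has to be computed. -/
theorem setLIntegral_homKernel_lt_top (hn : 0 < n) (hΩ : Measurable Ω) {I : Set ℝ}
    (hI : MeasurableSet I) {u : ℝ} (hu : 0 ≤ u)
    (h1 : ∫⁻ θ : Metric.sphere (0 : Rn n) 1, ‖Ω θ‖ₑ ^ u ∂(sphereMeasure n) < ∞)
    (h2 : ∫⁻ z in {z : Rn n | ‖z‖ ∈ I}, ENNReal.ofReal ((‖z‖ ^ n)⁻¹) ^ u < ∞) :
    ∫⁻ z in {z : Rn n | ‖z‖ ∈ I}, ‖homKernel Ω z‖ₑ ^ u < ∞ := by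
  rw [setLIntegral_homKernel_eq hn hΩ hI hu]
  rw [setLIntegral_norm_eq hn hI] at h2
  refine ENNReal.mul_lt_top h1 ?_
  by_contra h
  rw [not_lt, top_le_iff] at h
  rw [h, ENNReal.mul_top (sphereMeasure_univ_ne_zero hn)] at h2
  exact lt_irrefl _ h2

theorem integrableOn_homKernel (hn : 0 < n) (hΩ : Measurable Ω)
    (hi : Integrable (fun θ : Metric.sphere (0 : Rn n) 1 => Ω θ) (sphereMeasure n))
    {δ M : ℝ} (hδ : 0 < δ) :
    IntegrableOn (homKernel Ω) {z : Rn n | ‖z‖ ∈ Set.Icc δ M} volume := by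
  refine ⟨(measurable_homKernel hΩ).aestronglyMeasurable, ?_⟩
  have h1 := setLIntegral_homKernel_lt_top hn hΩ (I := Set.Icc δ M) measurableSet_Icc (u := 1)
    zero_le_one (by simpa [HasFiniteIntegral] using hi.2) ?_
  · simpa [HasFiniteIntegral] using h1
  · calc ∫⁻ z in {z : Rn n | ‖z‖ ∈ Set.Icc δ M}, ENNReal.ofReal ((‖z‖ ^ n)⁻¹) ^ (1 : ℝ)
        ≤ ∫⁻ z in {z : Rn n | ‖z‖ ∈ Set.Icc δ M}, ENNReal.ofReal ((δ ^ n)⁻¹) := by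
          refine setLIntegral_mono' (measurable_norm measurableSet_Icc) fun z hz => ?_
          rw [ENNReal.rpow_one]
          have : δ ≤ ‖z‖ := hz.1
          gcongr
      _ < ∞ := by
          rw [setLIntegral_const]
          refine ENNReal.mul_lt_top ENNReal.ofReal_lt_top ?_
          refine (measure_mono fun z hz => ?_).trans_lt
            (measure_closedBall_lt_top (x := (0 : Rn n)) (r := M))
          rw [mem_closedBall_zero_iff]; exact hz.2

/-- A measurable representative of a homogeneous symbol. -/
theorem IsHomogeneousSymbol.exists_measurable (hn : 0 < n) (hΩ : IsHomogeneousSymbol Ω) :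
    ∃ Ω' : Rn n → ℂ, Measurable Ω' ∧
      (∀ᵐ θ : Metric.sphere (0 : Rn n) 1 ∂(sphereMeasure n), Ω' θ = Ω θ) ∧
      ∀ᵐ z : Rn n, homKernel Ω' z = Ω z / ((‖z‖ ^ n : ℝ) : ℂ) := by
  have := nontrivial_of_pos hn
  obtain ⟨g, hg, hgΩ⟩ := hΩ.integrable.aestronglyMeasurable
  -- Measurability is only known on the sphere, up to null sets; a measurable representative there
  -- is extended to the whole space, and homogeneity is restored by normalizing the argument in
  -- `homKernel`.
  obtain ⟨Ω', hΩ', hext⟩ := (MeasurableEmbedding.subtype_coe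
    (Metric.isClosed_sphere (x := (0 : Rn n)) (ε := 1)).measurableSet).exists_measurable_extend
    hg.measurable (fun _ => ⟨0⟩)
  have hae : ∀ᵐ θ : Metric.sphere (0 : Rn n) 1 ∂(sphereMeasure n), Ω' θ = Ω θ := by
    filter_upwards [hgΩ] with θ hθ
    rw [hθ, ← hext]; rfl
  refine ⟨Ω', hΩ', hae, ?_⟩
  filter_upwards [ae_polar hn (P := fun x => Ω' x = Ω x) hae,
    compl_mem_ae_iff.2 (measure_singleton (μ := (volume : Measure (Rn n))) 0)] with z hz hz0
  have hz0 : z ≠ 0 := hz0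
  have hpos : 0 < ‖z‖ := norm_pos_iff.2 hz0
  rw [homKernel, hz]
  have h1 := hΩ.homogeneous ‖z‖ hpos (‖z‖⁻¹ • z) (by
    rw [mem_sphere_zero_iff_norm, norm_smul, norm_inv, norm_norm, inv_mul_cancel₀ hpos.ne'])
  rw [smul_smul, mul_inv_cancel₀ hpos.ne', one_smul] at h1
  rw [h1]

/-- Homogeneous kernels are nearly constant on suitable pairs of balls. -/
theorem locallyNearConst_homKernel (hn : 0 < n) (hΩ : Measurable Ω)
    (hi : Integrable (fun θ : Metric.sphere (0 : Rn n) 1 => Ω θ) (sphereMeasure n))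
    (h0 : ¬ ((fun θ : Metric.sphere (0 : Rn n) 1 => Ω θ) =ᵐ[sphereMeasure n] 0)) :
    LocallyNearConst fun x y : Rn n => homKernel Ω (x - y) := by
  set U : Set (Rn n) := {z | ‖z‖ ∈ Set.Ioo (1 : ℝ) 2} with hU
  have hUo : IsOpen U := isOpen_Ioo.preimage continuous_norm
  set f : Rn n → ℂ := U.indicator (homKernel Ω) with hf
  have hint : IntegrableOn (homKernel Ω) U volume :=
    (integrableOn_homKernel hn hΩ hi (δ := 1) (M := 2) one_pos).mono_set
      fun z hz => Set.Ioo_subset_Icc_self hz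
  have hfi : Integrable f volume := (integrable_indicator_iff hUo.measurableSet).2 hint
  have hf0 : ¬ (f =ᵐ[volume] 0) := by
    intro hf0
    have h1 : ∫⁻ z in U, ‖homKernel Ω z‖ₑ ^ (1 : ℝ) = 0 := by
      have h2 : ∫⁻ z, ‖f z‖ₑ = 0 := by
        rw [lintegral_congr_ae (g := fun _ => 0) (by filter_upwards [hf0] with z hz; simp [hz])]
        simp
      rw [hf] at h2
      simp only [enorm_indicator_eq_indicator_enorm] at h2
      rw [lintegral_indicator hUo.measurableSet] at h2
      simpa using h2
    rw [setLIntegral_homKernel_eq hn hΩ measurableSet_Ioo zero_le_one, mul_eq_zero] at h1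
    rcases h1 with h1 | h1
    · refine h0 ?_
      simp only [ENNReal.rpow_one] at h1
      rw [lintegral_eq_zero_iff' hi.1.enorm] at h1
      filter_upwards [h1] with θ hθ
      simpa using hθ
    · have h2 := setLIntegral_norm_eq hn (I := Set.Ioo (1 : ℝ) 2) measurableSet_Ioo 1
      rw [h1, mul_zero, lintegral_eq_zero_iff (by fun_prop)] at h2
      have h3 : volume U = 0 := by
        rw [← Measure.restrict_apply_univ]
        rw [EventuallyEq, ae_restrict_iff' hUo.measurableSet] at h2
        rw [Measure.restrict_apply_univ]
        refine measure_mono_null (fun z hz => ?_) h2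
        intro hcon
        have h4 := hcon hz
        have hz1 : 0 < ‖z‖ := lt_trans one_pos hz.1
        simp only [ENNReal.rpow_one, Pi.zero_apply, ENNReal.ofReal_eq_zero] at h4
        have : 0 < (‖z‖ ^ n)⁻¹ := by positivity
        linarith
      have : Nontrivial (Rn n) := nontrivial_of_pos hn
      obtain ⟨w, hw⟩ := exists_norm_eq (Rn n) (c := 3 / 2) (by norm_num)
      exact (hUo.measure_pos volume ⟨w, by
        rw [hU, Set.mem_ofPred_eq, hw]; norm_num⟩).ne' h3
  -- A rough symbol has no regularity; its substitute is a Lebesgue point of the kernel in the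
  -- annulus at which the value is nonzero. Near it the kernel is almost constant in the mean.
  obtain ⟨z₀, hz₀, hLeb⟩ : ∃ z₀, f z₀ ≠ 0 ∧ ∀ (δ : ℕ → ℝ), Tendsto δ atTop (𝓝[>] 0) →
      Tendsto (fun j => ⨍ y in Metric.closedBall z₀ (δ j), ‖f y - f z₀‖) atTop (𝓝 0) := by
    have h1 := IsUnifLocDoublingMeasure.ae_tendsto_average_norm_sub volume
      hfi.locallyIntegrable 1
    by_contra! hcon
    refine hf0 ?_
    filter_upwards [h1] with z hz
    by_contra hne
    obtain ⟨δ, hδ, hnot⟩ := hcon z hne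
    refine hnot (hz (fun _ => z) δ hδ ?_)
    have h2 : ∀ᶠ j in atTop, δ j ∈ Set.Ioi (0 : ℝ) := hδ.eventually self_mem_nhdsWithin
    filter_upwards [h2] with j hj
    exact Metric.mem_closedBall_self (by rw [one_mul]; exact le_of_lt hj)
  have hz₀U : z₀ ∈ U := by
    by_contra h
    exact hz₀ (by rw [hf, Set.indicator_of_notMem h])
  have hfz₀ : f z₀ = homKernel Ω z₀ := by rw [hf, Set.indicator_of_mem hz₀U]
  set κ₀ := homKernel Ω z₀ with hκ₀
  rw [hfz₀] at hz₀ hLeb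
  have hκpos : 0 < ‖κ₀‖ := norm_pos_iff.2 hz₀
  intro ε hε
  set v := volume.real (Metric.closedBall (0 : Rn n) 1)
  have hv : 0 < v := ENNReal.toReal_pos (Metric.measure_closedBall_pos _ _ one_pos).ne'
    measure_closedBall_lt_top.ne
  obtain ⟨δ, hδ0, hδ1, hδU, hδ⟩ : ∃ δ : ℝ, 0 < δ ∧ δ ≤ 1 / 4 ∧
      Metric.closedBall z₀ (2 * δ) ⊆ U ∧
      ∫ y in Metric.closedBall z₀ (2 * δ), ‖f y - κ₀‖ ≤ ε * ‖κ₀‖ * δ ^ n := by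
    have hseq : Tendsto (fun j : ℕ => 2 * (1 / ((j : ℝ) + 1))) atTop (𝓝[>] 0) := by
      refine tendsto_nhdsWithin_iff.2 ⟨?_, Eventually.of_forall fun j => ?_⟩
      · simpa using tendsto_one_div_add_atTop_nhds_zero_nat.const_mul (2 : ℝ)
      · exact Set.mem_Ioi.2 (by positivity)
    have h1 := hLeb _ hseq
    have h2 : ∀ᶠ j : ℕ in atTop, ⨍ y in Metric.closedBall z₀ (2 * (1 / ((j : ℝ) + 1))),
        ‖f y - κ₀‖ < ε * ‖κ₀‖ / (2 ^ n * v) := h1.eventually_lt_const (by positivity)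
    have h3 : ∀ᶠ j : ℕ in atTop, 1 / ((j : ℝ) + 1) < 1 / 4 :=
      tendsto_one_div_add_atTop_nhds_zero_nat.eventually_lt_const (by norm_num)
    obtain ⟨η, hη, hηU⟩ := Metric.isOpen_iff.1 hUo z₀ hz₀U
    have h4 : ∀ᶠ j : ℕ in atTop, 1 / ((j : ℝ) + 1) < η / 2 :=
      tendsto_one_div_add_atTop_nhds_zero_nat.eventually_lt_const (by positivity)
    obtain ⟨j, hj2, hj3, hj4⟩ := (h2.and (h3.and h4)).exists
    have hj0 : 0 < 1 / ((j : ℝ) + 1) := by positivity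
    set δ := 1 / ((j : ℝ) + 1)
    refine ⟨δ, hj0, hj3.le, fun z hz => hηU ?_, ?_⟩
    · rw [Metric.mem_closedBall] at hz
      rw [Metric.mem_ball]; linarith
    · rw [setAverage_eq, volume_real_closedBall _ (by positivity), smul_eq_mul,
        inv_mul_eq_div, div_lt_div_iff₀ (by positivity) (by positivity)] at hj2
      change _ < ε * ‖κ₀‖ * ((2 * δ) ^ n * v) at hj2
      have h5 : (∫ y in Metric.closedBall z₀ (2 * δ), ‖f y - κ₀‖) * (2 ^ n * v) ≤
          (ε * ‖κ₀‖ * δ ^ n) * (2 ^ n * v) := by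
        refine hj2.le.trans (le_of_eq ?_)
        rw [mul_pow]; ring
      exact le_of_mul_le_mul_right h5 (by positivity)
  have hz1 : 1 < ‖z₀‖ := hz₀U.1
  have hz2 : ‖z₀‖ < 2 := hz₀U.2
  refine ⟨2 / δ + 1, ‖κ₀‖ * δ ^ n, by have : 0 < 2 / δ := by positivity
                                      linarith, by positivity, fun c ρ hρ => ?_⟩
  -- Homogeneity transports the situation at `z₀` to every scale: dilation by `t` maps radius `δ` to
  -- radius `ρ`, and convolution structure transports it to every centre.
  set t := ρ / δ with ht
  have ht0 : 0 < t := by positivity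
  have htδ : t * δ = ρ := by rw [ht]; field_simp
  set K₀ : ℂ := ((t ^ n : ℝ) : ℂ)⁻¹ * κ₀ with hK₀
  have hK₀n : ‖K₀‖ = ‖κ₀‖ / t ^ n := by
    rw [hK₀, norm_mul, norm_inv, Complex.norm_real, Real.norm_of_nonneg (by positivity)]
    rw [inv_mul_eq_div]
  have hK₀ρ : ‖K₀‖ * ρ ^ n = ‖κ₀‖ * δ ^ n := by
    rw [hK₀n, ← htδ, mul_pow]; field_simp
  have hnt : ‖t • z₀‖ = t * ‖z₀‖ := by rw [norm_smul, Real.norm_of_nonneg ht0.le]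
  have hmain : ∫⁻ w in Metric.closedBall (t • z₀) (2 * ρ), ‖homKernel Ω w - K₀‖ₑ ≤
      ENNReal.ofReal (ε * ‖K₀‖ * ρ ^ n) := by
    have hball : Metric.closedBall (t • z₀) (2 * ρ) = (fun z : Rn n => t • z) ''
        Metric.closedBall z₀ (2 * δ) := by
      have := smul_closedBall (c := t) z₀ (r := 2 * δ) (by positivity)
      rw [Real.norm_of_nonneg ht0.le, show t * (2 * δ) = 2 * ρ by rw [← htδ]; ring] at this
      rw [← this]; rfl
    have hinv : (fun z : Rn n => t • z) '' Metric.closedBall z₀ (2 * δ) =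
        (fun z : Rn n => t⁻¹ • z) ⁻¹' Metric.closedBall z₀ (2 * δ) := by
      ext w
      constructor
      · rintro ⟨z, hz, rfl⟩
        simpa [smul_smul, inv_mul_cancel₀ ht0.ne'] using hz
      · intro hw
        exact ⟨t⁻¹ • w, hw, by simp [smul_smul, mul_inv_cancel₀ ht0.ne']⟩
    set G : Rn n → ℝ≥0∞ := (Metric.closedBall z₀ (2 * δ)).indicator fun z => ‖homKernel Ω z - κ₀‖ₑ
    have hG : ∀ w, (Metric.closedBall (t • z₀) (2 * ρ)).indicator
        (fun w => ‖homKernel Ω w - K₀‖ₑ) w = ENNReal.ofReal ((t ^ n)⁻¹) * G (t⁻¹ • w) := by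
      intro w
      rw [hball, hinv]
      by_cases hw : t⁻¹ • w ∈ Metric.closedBall z₀ (2 * δ)
      · rw [Set.indicator_of_mem (by exact hw)]
        simp only [G]
        rw [Set.indicator_of_mem hw]
        have h1 : homKernel Ω w = ((t ^ n : ℝ) : ℂ)⁻¹ * homKernel Ω (t⁻¹ • w) := by
          rw [← homKernel_smul ht0, smul_smul, mul_inv_cancel₀ ht0.ne', one_smul]
        rw [h1, hK₀, ← mul_sub, enorm_mul, ← Complex.ofReal_inv]
        congr 1
        rw [← ofReal_norm, Complex.norm_real, Real.norm_of_nonneg (by positivity)]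
      · rw [Set.indicator_of_notMem (by exact hw)]
        simp only [G]
        rw [Set.indicator_of_notMem hw, mul_zero]
    have hGm : Measurable G := Measurable.indicator
      ((measurable_homKernel hΩ).sub measurable_const).enorm
      Metric.isClosed_closedBall.measurableSet
    rw [← lintegral_indicator Metric.isClosed_closedBall.measurableSet, lintegral_congr hG,
      lintegral_const_mul' _ _ ENNReal.ofReal_ne_top,
      ← lintegral_map hGm (measurable_const_smul t⁻¹),
      Measure.map_addHaar_smul volume (inv_ne_zero ht0.ne'), lintegral_smul_measure,
      lintegral_indicator Metric.isClosed_closedBall.measurableSet]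
    have hfr : Module.finrank ℝ (Rn n) = n := by simp
    have h2 : ∫⁻ z in Metric.closedBall z₀ (2 * δ), ‖homKernel Ω z - κ₀‖ₑ ≤
        ENNReal.ofReal (ε * ‖κ₀‖ * δ ^ n) := by
      have h3 : ∫⁻ z in Metric.closedBall z₀ (2 * δ), ‖homKernel Ω z - κ₀‖ₑ =
          ∫⁻ z in Metric.closedBall z₀ (2 * δ), ‖f z - κ₀‖ₑ := by
        refine setLIntegral_congr_fun Metric.isClosed_closedBall.measurableSet fun z hz => ?_
        simp only [hf]
        rw [Set.indicator_of_mem (hδU hz)]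
      have h4 : IntegrableOn (fun z => f z - κ₀) (Metric.closedBall z₀ (2 * δ)) volume :=
        hfi.integrableOn.sub (integrableOn_const measure_closedBall_lt_top.ne)
      rw [h3, ← ofReal_integral_norm_eq_lintegral_enorm h4]
      exact ENNReal.ofReal_le_ofReal hδ
    rw [hfr, mul_assoc ε, hK₀ρ, ← mul_assoc ε]
    rw [smul_eq_mul, ← mul_assoc]
    refine le_trans (mul_le_of_le_one_left' ?_) h2
    -- The Jacobian `t ^ n` cancels the factor `t⁻ⁿ` from homogeneity.
    rw [inv_pow, inv_inv, abs_of_pos (by positivity), ← ENNReal.ofReal_mul (by positivity),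
      inv_mul_cancel₀ (by positivity), ENNReal.ofReal_one]
  have hnear : ∀ x y : Rn n, x ∈ Metric.closedBall (c + t • z₀) ρ → y ∈ Metric.closedBall c ρ →
      x - y ∈ Metric.closedBall (t • z₀) (2 * ρ) := by
    intro x y hx hy
    rw [Metric.mem_closedBall, dist_eq_norm] at hx hy ⊢
    calc ‖x - y - t • z₀‖ = ‖(x - (c + t • z₀)) - (y - c)‖ := by congr 1; abel
      _ ≤ _ := (norm_sub_le _ _).trans (by linarith)
  refine ⟨c + t • z₀, K₀, ?_, ?_, hK₀ρ.ge, ⟨fun x hx => ?_, fun y hy => ?_⟩⟩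
  -- The centres are `t ‖z₀‖ > ρ / δ ≥ 4 ρ` apart, by `δ ≤ 1 / 4`.
  · refine Metric.closedBall_disjoint_closedBall ?_
    rw [dist_self_add_right, hnt]
    nlinarith
  · refine Metric.closedBall_subset_closedBall' ?_
    rw [dist_self_add_left, hnt]
    have : 2 / δ * ρ = 2 * t := by rw [ht]; ring
    nlinarith
  · refine le_trans ?_ hmain
    rw [← lintegral_indicator Metric.isClosed_closedBall.measurableSet,
      ← lintegral_indicator Metric.isClosed_closedBall.measurableSet,
      ← lintegral_sub_left_eq_self ((Metric.closedBall (t • z₀) (2 * ρ)).indicator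
        fun w => ‖homKernel Ω w - K₀‖ₑ) x]
    refine lintegral_mono fun y => ?_
    by_cases hy : y ∈ Metric.closedBall c ρ
    · rw [Set.indicator_of_mem hy, Set.indicator_of_mem (hnear x y hx hy)]
    · rw [Set.indicator_of_notMem hy]; exact zero_le
  · refine le_trans ?_ hmain
    rw [← lintegral_indicator Metric.isClosed_closedBall.measurableSet,
      ← lintegral_indicator Metric.isClosed_closedBall.measurableSet,
      ← lintegral_sub_right_eq_self ((Metric.closedBall (t • z₀) (2 * ρ)).indicator
        fun w => ‖homKernel Ω w - K₀‖ₑ) y]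
    refine lintegral_mono fun x => ?_
    by_cases hx : x ∈ Metric.closedBall (c + t • z₀) ρ
    · rw [Set.indicator_of_mem hx, Set.indicator_of_mem (hnear x y hx hy)]
    · rw [Set.indicator_of_notMem hx]; exact zero_le

end

end CZCommutator

/-! ### Rough operators: from principal values to an off-diagonal kernel. -/

namespace CZCommutator

variable {n : ℕ}

theorem exists_smooth_cutoff {F : Set (Rn n)} (hF : IsClosed F) {δ : ℝ} (hδ : 0 < δ) :
    ∃ χ : Rn n → ℝ, ContDiff ℝ (⊤ : ℕ∞) χ ∧ (∀ x ∈ F, χ x = 1) ∧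
      (∀ x ∉ Metric.cthickening δ F, χ x = 0) ∧ ∀ x, 0 ≤ χ x ∧ χ x ≤ 1 := by
  obtain ⟨χ, h1, h2, h3⟩ := exists_contMDiffMap_one_nhds_of_subset_interior (n := (⊤ : ℕ∞))
    (modelWithCornersSelf ℝ (Rn n)) (t := Metric.cthickening δ F) hF
    ((Metric.self_subset_thickening hδ F).trans (Metric.thickening_subset_interior_cthickening δ F))
  exact ⟨χ, χ.contMDiff.contDiff, fun x hx => h1.self_of_nhdsSet x hx, h2, h3⟩

theorem le_dist_of_notMem_cthickening {F : Set (Rn n)} {δ : ℝ} (hδ : 0 < δ) {x y : Rn n}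
    (hx : x ∉ Metric.cthickening δ F) (hy : y ∈ Metric.cthickening (δ / 2) F) :
    δ / 2 ≤ ‖x - y‖ := by
  by_contra! hlt
  refine hx ?_
  have h1 : x ∈ Metric.cthickening (δ / 2) (Metric.cthickening (δ / 2) F) :=
    Metric.mem_cthickening_of_dist_le x y _ _ hy (by rw [dist_eq_norm]; exact hlt.le)
  have h2 := Metric.cthickening_cthickening_subset (by positivity) (by positivity) F h1
  rwa [add_halves] at h2

/-- Smooth approximation in `Lˢ` of a function supported in `F` by functions supported near `F`. -/
theorem exists_smooth_seq {F : Set (Rn n)} (hF : IsCompact F) {δ : ℝ} (hδ : 0 < δ) {s : ℝ≥0∞}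
    (hs1 : 1 ≤ s) (hs : s ≠ ∞) {f : Rn n → ℂ} (hf : MemLp f s volume) (hfF : ∀ x ∉ F, f x = 0) :
    ∃ g : ℕ → Rn n → ℂ, (∀ j, ContDiff ℝ (⊤ : ℕ∞) (g j)) ∧ (∀ j, HasCompactSupport (g j)) ∧
      (∀ j, ∀ x ∉ Metric.cthickening δ F, g j x = 0) ∧
      Tendsto (fun j => eLpNorm (g j - f) s volume) atTop (𝓝 0) := by
  obtain ⟨χ, hχ, hχ1, hχ0, hχb⟩ := exists_smooth_cutoff hF.isClosed hδ
  choose g hgc hgs hg using fun j : ℕ => hf.exist_eLpNorm_sub_le hs hs1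
    (ε := 1 / ((j : ℝ) + 1)) (by positivity)
  refine ⟨fun j x => (χ x : ℂ) * g j x, fun j => ?_, fun j => ?_, fun j x hx => ?_, ?_⟩
  · exact (Complex.ofRealCLM.contDiff.comp hχ).mul (hgs j)
  · exact (hgc j).mul_left
  · simp only [hχ0 x hx, Complex.ofReal_zero, zero_mul]
  · have hlim : Tendsto (fun j : ℕ => ENNReal.ofReal (1 / ((j : ℝ) + 1))) atTop (𝓝 0) := by
      have := ENNReal.tendsto_ofReal (tendsto_one_div_add_atTop_nhds_zero_nat (𝕜 := ℝ))
      simpa using this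
    refine tendsto_of_tendsto_of_tendsto_of_le_of_le tendsto_const_nhds hlim
      (fun _ => zero_le) fun j => ?_
    refine le_trans (eLpNorm_mono fun x => ?_) (hg j)
    -- The cutoff is one on `F`, so multiplying by it leaves `f` unchanged and cannot increase the
    -- error.
    have h1 : (χ x : ℂ) * f x = f x := by
      by_cases hx : x ∈ F
      · rw [hχ1 x hx, Complex.ofReal_one, one_mul]
      · rw [hfF x hx, mul_zero]
    simp only [Pi.sub_apply]
    calc ‖(χ x : ℂ) * g j x - f x‖ = ‖(χ x : ℂ) * (f x - g j x)‖ := by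
          rw [mul_sub, h1, norm_sub_rev]
      _ ≤ _ := by
          rw [norm_mul, Complex.norm_real, Real.norm_of_nonneg (hχb x).1]
          exact mul_le_of_le_one_left (norm_nonneg _) (hχb x).2

/-- The principal value off the support is the integral. -/
theorem IsPrincipalValue.eq_integral {T : (Rn n → ℂ) → (Rn n → ℂ)} {K : Rn n → Rn n → ℂ}
    {κ : Rn n → ℂ} (hpv : IsPrincipalValue T K) (hκ : ∀ x, ∀ᵐ y, κ (x - y) = K x y)
    {F : Set (Rn n)} {δ : ℝ} (hδ : 0 < δ) {g : Rn n → ℂ}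
    (hg : ContDiff ℝ (⊤ : ℕ∞) g) (hgc : HasCompactSupport g)
    (hgF : ∀ x ∉ Metric.cthickening (δ / 2) F, g x = 0) :
    ∀ᵐ x, x ∉ Metric.cthickening δ F → T g x = ∫ y, κ (x - y) * g y := by
  filter_upwards [hpv g hg hgc] with x hx hxF
  refine tendsto_nhds_unique hx (tendsto_const_nhds.congr' ?_)
  obtain ⟨R, hR⟩ := hgc.isCompact.isBounded.exists_norm_le
  -- For `x` away from the support, the truncation is inactive as soon as `ε` is below the distance
  -- to it and `1 / ε` is beyond its farthest point.
  have h1 : ∀ᶠ ε : ℝ in 𝓝[>] 0, ε ∈ Set.Ioo (0 : ℝ) (min (δ / 2) (1 / (‖x‖ + |R| + 1))) :=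
    Ioo_mem_nhdsGT (by positivity)
  filter_upwards [h1] with ε hε
  obtain ⟨hε0, hε1⟩ := hε
  obtain ⟨hε2, hε3⟩ := lt_min_iff.1 hε1
  have hzero : ∀ y ∉ {y : Rn n | ε < ‖x - y‖ ∧ ‖x - y‖ < 1 / ε}, K x y * g y = 0 := by
    intro y hy
    by_contra hne
    have hgy : g y ≠ 0 := right_ne_zero_of_mul hne
    refine hy ⟨?_, ?_⟩
    · have hyF : y ∈ Metric.cthickening (δ / 2) F := by
        by_contra h
        exact hgy (hgF y h)
      exact hε2.trans_le (le_dist_of_notMem_cthickening hδ hxF hyF)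
    · have hyR : ‖y‖ ≤ R := hR y (subset_tsupport g hgy)
      refine lt_of_le_of_lt (b := ‖x‖ + |R| + 1) ?_ ((lt_one_div (by positivity) hε0).2 hε3)
      have := norm_sub_le x y
      have := le_abs_self R
      linarith
  rw [setIntegral_eq_integral_of_forall_compl_eq_zero hzero]
  refine integral_congr_ae ?_
  filter_upwards [hκ x] with y hy
  rw [hy]

/-- The kernel representation off the support for bounded functions. -/
theorem IsPrincipalValue.ae_eq_integral {T : (Rn n → ℂ) → (Rn n → ℂ)} {K : Rn n → Rn n → ℂ}
    {κ : Rn n → ℂ} (hT : IsLpBounded T) (hpv : IsPrincipalValue T K)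
    (hκ : ∀ x, ∀ᵐ y, κ (x - y) = K x y) {v : ℝ≥0∞} (hv : 1 < v) (hvt : v ≠ ∞)
    (hκv : ∀ δ : ℝ, 0 < δ → MemLp ({z : Rn n | δ ≤ ‖z‖}.indicator κ) v volume)
    {F : Set (Rn n)} (hF : IsCompact F) {f : Rn n → ℂ} (hf : MemLp f ∞ volume)
    (hfF : ∀ x ∉ F, f x = 0) : ∀ᵐ x, x ∉ F → T f x = ∫ y, κ (x - y) * f y := by
  suffices H : ∀ δ : ℝ, 0 < δ → ∀ᵐ x, x ∉ Metric.cthickening δ F →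
      T f x = ∫ y, κ (x - y) * f y by
    have h1 : ∀ᵐ x, ∀ m : ℕ, x ∉ Metric.cthickening (1 / ((m : ℝ) + 1)) F →
        T f x = ∫ y, κ (x - y) * f y := ae_all_iff.2 fun m => H _ (by positivity)
    filter_upwards [h1] with x hx hxF
    rw [← hF.isClosed.closure_eq, Metric.closure_eq_iInter_cthickening] at hxF
    simp only [Set.mem_iInter, not_forall] at hxF
    obtain ⟨δ, hδ, hxδ⟩ := hxF
    obtain ⟨m, hm⟩ := exists_nat_one_div_lt hδ
    exact hx m fun h => hxδ (Metric.cthickening_mono hm.le F h)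
  intro δ hδ
  -- The kernel away from the origin lies in `Lᵛ`, so approximation of `f` in the dual `Lˢ` makes
  -- the integrals converge, while `T` of the approximations converges in measure to `T f`.
  set s := v.conjExponent with hsdef
  have hconj : ENNReal.HolderConjugate v s := ENNReal.HolderConjugate.conjExponent hv.le
  have hs1 : 1 < s := (ENNReal.HolderConjugate.lt_top_iff_one_lt v s).1 hvt.lt_top
  have hst : s < ∞ := (ENNReal.HolderConjugate.lt_top_iff_one_lt s v).2 hv
  have hfs : MemLp f s volume := by
    have : f = F.indicator f := by
      ext x; by_cases hx : x ∈ F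
      · simp [hx]
      · simp [hx, hfF x hx]
    rw [this, memLp_indicator_iff_restrict hF.measurableSet]
    have : IsFiniteMeasure (volume.restrict F) := ⟨by simpa using hF.measure_lt_top⟩
    exact (hf.restrict F).mono_exponent le_top
  obtain ⟨g, hg, hgc, hgF, hlim⟩ := exists_smooth_seq hF (δ := δ / 2) (by positivity) hs1.le hst.ne
    hfs hfF
  have hgs : ∀ j, MemLp (g j) s volume := fun j =>
    (hg j).continuous.memLp_of_hasCompactSupport (hgc j)
  obtain ⟨ns, hns, hae⟩ := (hT.tendstoInMeasure hs1 hst hfs hgs hlim).exists_seq_tendsto_ae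
  have hrep : ∀ᵐ x, ∀ j, x ∉ Metric.cthickening δ F → T (g j) x = ∫ y, κ (x - y) * g j y :=
    ae_all_iff.2 fun j => hpv.eq_integral hκ hδ (hg j) (hgc j) (hgF j)
  filter_upwards [hae, hrep] with x hx1 hx2 hxF
  refine tendsto_nhds_unique hx1 ?_
  simp only [hx2 _ hxF]
  set κ' : Rn n → ℂ := fun y => {z : Rn n | δ / 2 ≤ ‖z‖}.indicator κ (x - y) with hκ'
  have hκ'm : MemLp κ' v volume := (hκv (δ / 2) (by positivity)).comp_measurePreserving
    (Measure.measurePreserving_sub_left volume x)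
  have hswap : ∀ w : Rn n → ℂ, (∀ y ∉ Metric.cthickening (δ / 2) F, w y = 0) →
      ∫ y, κ (x - y) * w y = ∫ y, κ' y * w y := by
    intro w hw
    refine integral_congr_ae (ae_of_all _ fun y => ?_)
    by_cases hy : y ∈ Metric.cthickening (δ / 2) F
    · have : x - y ∈ {z : Rn n | δ / 2 ≤ ‖z‖} := le_dist_of_notMem_cthickening hδ hxF hy
      simp only [hκ', Set.indicator_of_mem this]
    · simp only [hw y hy, mul_zero]
  have hfF' : ∀ y ∉ Metric.cthickening (δ / 2) F, f y = 0 := fun y hy =>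
    hfF y fun h => hy (Metric.self_subset_cthickening F h)
  rw [hswap f hfF']
  simp only [fun j => hswap (g (ns j)) (hgF (ns j))]
  have hi : ∀ w : Rn n → ℂ, MemLp w s volume → Integrable (fun y => κ' y * w y) volume :=
    fun w hw => hκ'm.integrable_mul hw
  refine tendsto_iff_edist_tendsto_0.2 ?_
  have hlim' : Tendsto (fun j => eLpNorm κ' v volume * eLpNorm (g (ns j) - f) s volume) atTop
      (𝓝 0) := by
    have := ENNReal.Tendsto.const_mul (hlim.comp hns.tendsto_atTop)
      (Or.inr hκ'm.2.ne) (a := eLpNorm κ' v volume)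
    simpa using this
  refine tendsto_of_tendsto_of_tendsto_of_le_of_le tendsto_const_nhds hlim'
    (fun _ => zero_le) fun j => ?_
  simp only
  rw [edist_eq_enorm_sub, ← integral_sub (hi _ (hgs _)) (hi _ hfs)]
  refine (enorm_integral_le_lintegral_enorm _).trans ?_
  have h2 := eLpNorm_smul_le_mul_eLpNorm (r := 1) ((hgs (ns j)).sub hfs).1 hκ'm.1 (p := v) (q := s)
  rw [eLpNorm_one_eq_lintegral_enorm] at h2
  refine le_trans (le_of_eq (lintegral_congr fun y => ?_)) h2
  simp [mul_sub]

/-- Rough homogeneous operators are represented off the diagonal by a measurable kernel. -/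
theorem IsRoughOperator.exists_offDiagonalKernel (hn : 0 < n) {T : (Rn n → ℂ) → (Rn n → ℂ)}
    {K : Rn n → Rn n → ℂ} (hT : IsRoughOperator T K) :
    ∃ k, OffDiagonalKernel T k ∧ (∀ x, ∀ᵐ y, k x y = K x y) ∧ ∀ y, ∀ᵐ x, k x y = K x y := by
  have := nontrivial_of_pos hn
  obtain ⟨hTb, ⟨Ω, hΩ, ⟨v₀, hv₀, hΩv⟩, hKΩ⟩, hpv⟩ := hT
  obtain ⟨Ω', hΩ'm, hΩ'ae, hae⟩ := hΩ.exists_measurable hn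
  set κ := homKernel Ω' with hκ
  have hκm : Measurable κ := measurable_homKernel hΩ'm
  have h1 : ∀ x, ∀ᵐ y, κ (x - y) = K x y := by
    intro x
    filter_upwards [(Measure.measurePreserving_sub_left volume x).quasiMeasurePreserving.ae hae,
      compl_mem_ae_iff.2 (measure_singleton (μ := (volume : Measure (Rn n))) x)] with y hy hyx
    rw [hy, hKΩ x y fun h => hyx h.symm]; rfl
  have h2 : ∀ y, ∀ᵐ x, κ (x - y) = K x y := by
    intro y
    filter_upwards [(measurePreserving_sub_right volume y).quasiMeasurePreserving.ae hae,
      compl_mem_ae_iff.2 (measure_singleton (μ := (volume : Measure (Rn n))) y)] with x hx hxy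
    rw [hx, hKΩ x y fun h => hxy h]; rfl
  -- The given exponent may be infinite; since the sphere has finite measure, a smaller finite one
  -- is available.
  obtain ⟨v', hv'1, hv'2⟩ := ENNReal.lt_iff_exists_nnreal_btwn.1 hv₀
  set v : ℝ := (v' : ℝ) with hv
  have hv1 : 1 < v := by exact_mod_cast hv'1
  have hΩ'v : MemLp (fun θ : Metric.sphere (0 : Rn n) 1 => Ω' θ) v' (sphereMeasure n) :=
    (hΩv.mono_exponent hv'2.le).ae_eq (by filter_upwards [hΩ'ae] with θ hθ; rw [hθ])
  have hΩ'i : Integrable (fun θ : Metric.sphere (0 : Rn n) 1 => Ω' θ) (sphereMeasure n) :=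
    hΩ.integrable.congr (by filter_upwards [hΩ'ae] with θ hθ; rw [hθ])
  have hsph : ∀ u : ℝ, 1 < u → u ≤ v →
      ∫⁻ θ : Metric.sphere (0 : Rn n) 1, ‖Ω' θ‖ₑ ^ u ∂(sphereMeasure n) < ∞ := by
    intro u hu huv
    have hu0 : 0 < u := by linarith
    have h3 : MemLp (fun θ : Metric.sphere (0 : Rn n) 1 => Ω' θ) (ENNReal.ofReal u)
        (sphereMeasure n) := hΩ'v.mono_exponent (by
      rw [← ENNReal.ofReal_coe_nnreal]; exact ENNReal.ofReal_le_ofReal huv)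
    have h4 := lintegral_rpow_enorm_lt_top_of_eLpNorm_lt_top (by simpa using hu0)
      ENNReal.ofReal_ne_top h3.2
    rwa [ENNReal.toReal_ofReal hu0.le] at h4
  have htail : ∀ u : ℝ, 1 < u → u ≤ v → ∀ δ : ℝ, 0 < δ →
      ∫⁻ z in {z : Rn n | δ ≤ ‖z‖}, ‖κ z‖ₑ ^ u < ∞ := by
    intro u hu huv δ hδ
    exact setLIntegral_homKernel_lt_top hn hΩ'm (I := Set.Ici δ) measurableSet_Ici (by linarith)
      (hsph u hu huv) (lintegral_inv_norm_pow_lt_top hn hδ hu)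
  refine ⟨fun x y => κ (x - y), ⟨?_, ?_, ?_, ?_⟩, h1, h2⟩
  · exact hκm.comp (measurable_fst.sub measurable_snd)
  · intro F hF f hf hfF
    refine hpv.ae_eq_integral hTb h1 (v := v') (by exact_mod_cast hv'1) ENNReal.coe_ne_top
      (fun δ hδ => ?_) hF hf hfF
    have hms : MeasurableSet {z : Rn n | δ ≤ ‖z‖} := measurableSet_le measurable_const measurable_norm
    rw [memLp_indicator_iff_restrict hms]
    refine ⟨hκm.aestronglyMeasurable, ?_⟩
    have hv0 : (v' : ℝ≥0∞) ≠ 0 := by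
      have : v' ≠ 0 := fun h => by simp [hv, h] at hv1; linarith
      exact_mod_cast this
    rw [eLpNorm_lt_top_iff_lintegral_rpow_enorm_lt_top hv0 ENNReal.coe_ne_top]
    exact htail v hv1 le_rfl δ hδ
  · exact ⟨fun z => ‖κ z‖ₑ, hκm.enorm, fun x y => le_rfl, v, hv1, fun u hu huv =>
      htail u hu huv 1 one_pos⟩
  · intro F G hF hG hFG ε hε
    obtain ⟨δ, hδ, hδd⟩ : ∃ δ : ℝ, 0 < δ ∧ ∀ x ∈ F, ∀ y ∈ G, δ ≤ ‖x - y‖ := by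
      obtain ⟨δ, hδ, hd⟩ := hFG.exists_thickenings hF hG.isClosed
      refine ⟨δ, hδ, fun x hx y hy => ?_⟩
      by_contra! hlt
      refine Set.disjoint_left.1 hd (Metric.mem_thickening_iff.2 ⟨x, hx, ?_⟩)
        (Metric.self_subset_thickening hδ G hy)
      rwa [dist_comm, dist_eq_norm]
    obtain ⟨R₁, hR₁⟩ := hF.isBounded.exists_norm_le
    obtain ⟨R₂, hR₂⟩ := hG.isBounded.exists_norm_le
    -- All differences of points of `F` and `G` lie in this shell, where the convolution kernel is
    -- integrable and hence an `L¹` limit of continuous functions.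
    set A : Set (Rn n) := {z | ‖z‖ ∈ Set.Icc δ (R₁ + R₂)} with hA
    have hAm : MeasurableSet A := measurable_norm measurableSet_Icc
    have hint : Integrable (A.indicator κ) volume :=
      (integrable_indicator_iff hAm).2 (integrableOn_homKernel hn hΩ'm hΩ'i hδ)
    obtain ⟨κ', -, hκε, hκc, -⟩ := hint.exists_hasCompactSupport_lintegral_sub_le hε
    refine ⟨fun x y => κ' (x - y), fun z => ‖A.indicator κ z - κ' z‖ₑ, ?_, ?_, ?_, hκε, ?_⟩
    · exact hκc.measurable.comp (measurable_fst.sub measurable_snd)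
    · exact (hκc.comp (continuous_fst.sub continuous_snd)).continuousOn
    · exact ((hκm.indicator hAm).sub hκc.measurable).enorm
    · intro x hx y hy
      have hxy : x - y ∈ A := by
        refine ⟨hδd x hx y hy, (norm_sub_le x y).trans ?_⟩
        exact add_le_add (hR₁ x hx) (hR₂ y hy)
      simp only [Set.indicator_of_mem hxy, le_refl]

end CZCommutator

/-! ### The two kernel properties for each type, and the theorem. -/

namespace CZCommutator

variable {n : ℕ}

theorem IsNondegenerate.locallyNearConst (hn : 0 < n) {K : Rn n → Rn n → ℂ}
    (hK : IsNondegenerate K) : LocallyNearConst K := by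
  have := nontrivial_of_pos hn
  rcases hK with ⟨ω, C, hK, h0, c₀, hc₀, hlow⟩ | ⟨Ω, hΩ, hne, hKΩ⟩
  · exact hK.locallyNearConst hn h0 hc₀ hlow
  · obtain ⟨Ω', hΩ'm, hΩ'ae, hae⟩ := hΩ.exists_measurable hn
    have hΩΩ' : (fun θ : Metric.sphere (0 : Rn n) 1 => Ω' θ) =ᵐ[sphereMeasure n] fun θ => Ω θ :=
      hΩ'ae
    refine (locallyNearConst_homKernel hn hΩ'm (hΩ.integrable.congr hΩΩ'.symm)
      fun h => hne (hΩΩ'.symm.trans h)).congr (fun x => ?_) fun y => ?_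
    · filter_upwards [(Measure.measurePreserving_sub_left volume x).quasiMeasurePreserving.ae hae,
        compl_mem_ae_iff.2 (measure_singleton (μ := (volume : Measure (Rn n))) x)] with y hy hyx
      rw [hy, hKΩ x y fun h => hyx h.symm]; rfl
    · filter_upwards [(measurePreserving_sub_right volume y).quasiMeasurePreserving.ae hae,
        compl_mem_ae_iff.2 (measure_singleton (μ := (volume : Measure (Rn n))) y)] with x hx hxy
      rw [hx, hKΩ x y fun h => hxy h]; rfl

/-- A Calderón–Zygmund operator of either type has a measurable kernel off the diagonal, which
agrees with `K` almost everywhere in each variable. -/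
theorem exists_offDiagonalKernel (hn : 0 < n) {T : (Rn n → ℂ) → (Rn n → ℂ)}
    {K : Rn n → Rn n → ℂ} (hT : IsDiniOperator T K ∨ IsRoughOperator T K) :
    ∃ k, OffDiagonalKernel T k ∧ (∀ x, ∀ᵐ y, k x y = K x y) ∧ ∀ y, ∀ᵐ x, k x y = K x y := by
  rcases hT with hT | hT
  · exact ⟨offDiag K, hT.offDiagonalKernel hn, offDiag_ae_eq hn K, offDiag_ae_eq_left hn K⟩
  · exact hT.exists_offDiagonalKernel hn

end CZCommutator

theorem theorem2p11 (n : ℕ) (hn : 0 < n)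
    (p q r : ℝ≥0∞) [Fact (1 ≤ p)] [Fact (1 ≤ q)]
    (hq : 1 < q) (hqp : q < p) (hp : p < ∞) (hr : 1 / r = 1 / q - 1 / p)
    (T : (CZCommutator.Rn n → ℂ) → (CZCommutator.Rn n → ℂ))
    (K : CZCommutator.Rn n → CZCommutator.Rn n → ℂ)
    (hK : CZCommutator.IsNondegenerate K)
    (hT : CZCommutator.IsDiniOperator T K ∨ CZCommutator.IsRoughOperator T K)
    (b : CZCommutator.Rn n → ℂ) (hb : LocallyIntegrable b volume) :
    List.TFAE [
      CZCommutator.CommutatorCompact b T p q,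
      CZCommutator.CommutatorBounded b T p q,
      CZCommutator.MemLpModConst b r] := by
  rw [one_div, one_div, one_div] at hr
  -- Makes the truncated subtraction in `hr` a genuine one, so that it is the Hölder relation.
  have hpq : p⁻¹ ≤ q⁻¹ := ENNReal.inv_le_inv.2 hqp.le
  have hHolder : ENNReal.HolderTriple r p q := ⟨by rw [hr, tsub_add_cancel_of_le hpq]⟩
  have hr1 : 1 ≤ r := by
    rw [← ENNReal.inv_le_inv, hr, inv_one]
    exact tsub_le_self.trans (ENNReal.inv_le_one.2 hq.le)
  have : Fact (1 ≤ r) := ⟨hr1⟩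
  have hTb : CZCommutator.IsLpBounded T := hT.elim (fun h => h.1) fun h => h.1
  obtain ⟨k, hk, h1, h2⟩ := CZCommutator.exists_offDiagonalKernel hn hT
  have hN : CZCommutator.LocallyNearConst k := (hK.locallyNearConst hn).congr
    (fun x => (h1 x).mono fun _ h => h.symm) fun y => (h2 y).mono fun _ h => h.symm
  tfae_have 1 → 2 := fun ⟨S, hS, _⟩ => ⟨S, hS⟩
  tfae_have 2 → 3 :=
    CZCommutator.memLpModConst_of_commutatorBounded hn hr1 hq hqp hp hTb hk hN hb
  tfae_have 3 → 1 := fun h => hk.commutatorCompact hTb hq hqp hp hb h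
  tfae_finish
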